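/- **Setting.** The KP equation is $$(4u_t-12uu_x-u_{xxx})_x+3u_{yy}=0,\qquad u=u(x,y,t),$$ and a lump solution is a smooth real solution on $\mathbb R^3$ with $u(x,y,t)\to0$ as $|(x,y)|\to\infty$ for each fixed $t$. The second and third AKNS flows for potentials $q,r$ are $$\mathrm i q_y=-q_{xx}-2q^2r,\quad \mathrm i r_y=r_{xx}+2qr^2,\quad q_t=q_{xxx}+6qrq_x,\quad r_t=r_{xxx}+6qrr_x,$$ with Lax pair $\Phi_x=U\Phi$, $\Phi_y=V\Phi$, $\Phi_t=W\Phi$, where $\sigma_3=\mathrm{diag}(1,-1)$, $Q=\begin{pmatrix}0&r\\q&0\end{pmatrix}$ and $$U=\mathrm i(\lambda\sigma_3+Q),\qquad V=2\left(\mathrm i\lambda^2\sigma_3+\mathrm i\lambda Q-\tfrac{\mathrm i}{2}\sigma_3Q^2+\tfrac12\sigma_3Q_x\right),$$ $$W=-4\mathrm i\lambda^3\sigma_3-4\mathrm i\lambda^2Q+2\lambda(\mathrm i\sigma_3Q^2-\sigma_3Q_x)+\mathrm iQ_{xx}+2\mathrm iQ^3+Q_xQ-QQ_x .$$ **The determinants.**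 Let $N\ge1$ and let $A=(a_3,a_5,\dots,a_{2N-1})$ be arbitrary complex numbers; put $a_1=0$. Define the Schur polynomials of a sequence $\mathbf x=(x_1,x_2,\dots)$ by $\sum_{j\ge0}S_j(\mathbf x)\lambda^j=\exp\big(\sum_{j\ge1}x_j\lambda^j\big)$, the vector $\mathbf s=(s_1,s_2,\dots)$ by $\sum_{j\ge1}s_j\lambda^j=\ln\big[\tfrac2\lambda\tanh\tfrac\lambda2\big]$, and $\mathbf x^{\pm}(n)=(x_1^\pm(n),0,x_3^\pm(n),0,\dots)$, for $n\in\{0,1\}$ and odd $j$, by $$x_j^{+}(n)=\frac{x+3t+2^j\mathrm iy+3^jt}{j!}+a_j+n\,\delta_{j,1},\qquad x_j^{-}(n)=\frac{x+3t-2^j\mathrm iy+3^jt}{j!}+a_j^*-n\,\delta_{j,1}$$ (the value of $a_j$ for $j>2N-1$ plays no role; take it to be $0$). Let $$\tau^{(n)}_{i,j}=(-1)^n\sum_{\nu=0}^{\min(i,j)}\frac1{4^\nu}S_{i-\nu}(\mathbf x^+(n)+\nu\mathbf s)\,S_{j-\nu}(\mathbf x^-(n)+\nu\mathbf s),\qquad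 \sigma_n(x,y,t;A)=\det_{1\le i,j\le N}\big(\tau^{(n)}_{2i-1,2j-1}\big).$$ **The Darboux transformation at $\lambda=-\mathrm i$.** Let $a(\lambda)$ be analytic at $\lambda=-\mathrm i$, let $\hat a_k$ be the coefficients in $a(\lambda)=\mathfrak q^{-1}\sum_{k\ge0}\hat a_k(\ln \mathfrak q)^k$, $\mathfrak q=\mathrm i(\lambda+\xi)$, $\xi=\sqrt{\lambda^2+1}$, near $\lambda=-\mathrm i$ (i.e. the Taylor coefficients at $\kappa=0$ of $\mathrm e^{\kappa}a(-\mathrm i\cosh\kappa)$), and let $\omega=x+2\lambda y+2(1-2\lambda^2)t+a(\lambda)$. Say that $a(\lambda)$ is a phase for $A$ if $\hat a_1=0$ and $a_{2k+1}=\hat a_{2k+1}^*$ for $1\le k\le N-1$. Put $$\Phi=\mathrm e^{-\mathrm iy\sigma_3}\left\{\frac{(\mathrm i\lambda+1)\sin(\xi\omega)}{\xi}\begin{pmatrix}1\\\mathrm i\end{pmatrix}+\cos(\xi\omega)\begin{pmatrix}1\\-\mathrm i\end{pmatrix}\right\},\qquad \Phi^{[k]}=\frac1{k!}\frac{\mathrm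 d^k\Phi}{\mathrm d\lambda^k}\Big|_{\lambda=-\mathrm i},$$ $Y=[\Phi^{[0]},\dots,\Phi^{[N-1]}]$, $M=X^\dagger SX$, where $X$ has in block row $k$ and column $j$ ($0\le k,j\le N-1$) the vector $\Phi^{[j-k]}$ if $k\le j$ and $0$ otherwise, and $S$ has the blocks $\binom{k+l}{k}\frac{(-1)^k}{(2\mathrm i)^{k+l+1}}\mathbb I_2$ ($0\le k,l\le N-1$). Let $D(\lambda)$ be the lower triangular $N\times N$ matrix with entries $(\lambda-\mathrm i)^{-(i-j+1)}$, $j\le i$, and let $$T_N(\lambda)=\mathbb I+YM^{-1}D(\lambda)Y^\dagger,\qquad q^{[N]}=\mathrm e^{2\mathrm iy}+2\,Y_2M^{-1}Y_1^\dagger,\qquad r^{[N]}=(q^{[N]})^*,$$ where $Y_i$ is the $i$-th row of $Y$. **Theorem.** For all $N\ge1$ and all $A\in\mathbb C^{N-1}$: 1. $\sigma_0(\cdot;A)$ has no zero on $\mathbb R^3$, and $$u_N(x,y,t;A)=\left|\frac{\sigma_1(x-3t,y,t;A)}{\sigma_0(x-3t,y,t;A)}\right|^2-1$$ is a lump solution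 of the KP equation. 2. There is a phase $a(\lambda)$ for $A$, so the parameters $a_3,\dots,a_{2N-1}$ are free. 3. For every phase $a(\lambda)$ for $A$, $u_N$ is obtained from the $N$-th order AKNS Darboux transformation at $\lambda=-\mathrm i$ under the one-constraint $u=qr$: $M$ is invertible everywhere; for $\lambda\ne\mathrm i$, $T_N(\lambda)$ is smooth in $(x,y,t)$ and is a Darboux matrix from the Lax pair $(U,V,W)$ of the seed $q=\mathrm e^{2\mathrm iy}$, $r=\mathrm e^{-2\mathrm iy}$ to the Lax pair $(U^{[N]},V^{[N]},W^{[N]})$ of $(q^{[N]},r^{[N]})$, i.e. $T_{N,x}+T_NU=U^{[N]}T_N$, $T_{N,y}+T_NV=V^{[N]}T_N$, $T_{N,t}+T_NW=W^{[N]}T_N$; $(q^{[N]},r^{[N]})$ is a smooth solution of the second and third AKNS flows; $$q^{[N]}=\mathrm e^{2\mathrm iy}\,\frac{\sigma_1}{\sigma_0};$$ $u=q^{[N]}r^{[N]}$ is a smooth real solution of the KP equation; and $u_N(x,y,t;A)=u(x-3t,y,t)-1$. -/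

import Mathlib

open scoped ContDiff

noncomputable section

namespace KPLump

/-! ### Partial derivatives, the KP equation and the AKNS flows -/

section Fields

variable {E : Type*} [NormedAddCommGroup E] [NormedSpace ℝ E]

/-- Partial derivative in `x` of a field `f (x, y, t)`. -/
def pdx (f : ℝ → ℝ → ℝ → E) : ℝ → ℝ → ℝ → E := fun x y t => deriv (fun s => f s y t) x

/-- Partial derivative in `y`. -/
def pdy (f : ℝ → ℝ → ℝ → E) : ℝ → ℝ → ℝ → E := fun x y t => deriv (fun s => f x s t) y

/-- Partial derivative in `t`. -/
def pdt (f : ℝ → ℝ → ℝ → E) : ℝ → ℝ → ℝ → E := fun x y t => deriv (fun s => f x y s) t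

/-- `f` is a `C^∞` function of `(x, y, t) ∈ ℝ³`. -/
def Smooth3 (f : ℝ → ℝ → ℝ → E) : Prop :=
  ContDiff ℝ ∞ (fun p : ℝ × ℝ × ℝ => f p.1 p.2.1 p.2.2)

end Fields

/-- `u` is a smooth solution on `ℝ³` of the KP equation
`(4 u_t - 12 u u_x - u_xxx)_x + 3 u_yy = 0`. -/
def IsKPSolution (u : ℝ → ℝ → ℝ → ℝ) : Prop :=
  Smooth3 u ∧ ∀ x y t : ℝ,
    pdx (fun x y t => 4 * pdt u x y t - 12 * u x y t * pdx u x y t - pdx (pdx (pdx u)) x y t) x y t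
      + 3 * pdy (pdy u) x y t = 0

/-- A lump solution: a smooth solution of the KP equation which, at every time, is localized in
the `(x, y)`-plane, that is, decays to the zero background in all directions of the plane. -/
def IsLumpSolution (u : ℝ → ℝ → ℝ → ℝ) : Prop :=
  IsKPSolution u ∧
    ∀ t : ℝ, Filter.Tendsto (fun p : ℝ × ℝ => u p.1 p.2 t) (Filter.cocompact (ℝ × ℝ)) (nhds 0)

/-- `(q, r)` is a smooth solution of the second and the third flow of the AKNS hierarchy. -/
structure IsAKNSSolution (q r : ℝ → ℝ → ℝ → ℂ) : Prop where
  smooth_q : Smooth3 q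
  smooth_r : Smooth3 r
  flow2_q : ∀ x y t : ℝ,
    Complex.I * pdy q x y t = -pdx (pdx q) x y t - 2 * q x y t ^ 2 * r x y t
  flow2_r : ∀ x y t : ℝ,
    Complex.I * pdy r x y t = pdx (pdx r) x y t + 2 * q x y t * r x y t ^ 2
  flow3_q : ∀ x y t : ℝ,
    pdt q x y t = pdx (pdx (pdx q)) x y t + 6 * pdx q x y t * q x y t * r x y t
  flow3_r : ∀ x y t : ℝ,
    pdt r x y t = pdx (pdx (pdx r)) x y t + 6 * q x y t * r x y t * pdx r x y t

/-! ### The Lax pair and Darboux matrices -/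

/-- Fields with values in the `2 × 2` complex matrices. -/
abbrev MatField := ℝ → ℝ → ℝ → Matrix (Fin 2) (Fin 2) ℂ

/-- Entrywise `x`-derivative. -/
def mpdx (F : MatField) : MatField :=
  fun x y t => Matrix.of fun i j => pdx (fun x y t => F x y t i j) x y t

/-- Entrywise `y`-derivative. -/
def mpdy (F : MatField) : MatField :=
  fun x y t => Matrix.of fun i j => pdy (fun x y t => F x y t i j) x y t

/-- Entrywise `t`-derivative. -/
def mpdt (F : MatField) : MatField :=
  fun x y t => Matrix.of fun i j => pdt (fun x y t => F x y t i j) x y t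

/-- The Pauli matrix `σ₃`. -/
def pauli3 : Matrix (Fin 2) (Fin 2) ℂ := !![1, 0; 0, -1]

/-- The potential matrix `Q`. -/
def potMat (q r : ℝ → ℝ → ℝ → ℂ) : MatField := fun x y t => !![0, r x y t; q x y t, 0]

/-- `U = i (λ σ₃ + Q)`. -/
def laxU (lam : ℂ) (q r : ℝ → ℝ → ℝ → ℂ) : MatField := fun x y t =>
  Complex.I • (lam • pauli3 + potMat q r x y t)

/-- `V = 2 (i λ² σ₃ + i λ Q - (i/2) σ₃ Q² + (1/2) σ₃ Q_x)`. -/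
def laxV (lam : ℂ) (q r : ℝ → ℝ → ℝ → ℂ) : MatField := fun x y t =>
  let Q := potMat q r x y t
  let Qx := mpdx (potMat q r) x y t
  (2 : ℂ) • ((Complex.I * lam ^ 2) • pauli3 + (Complex.I * lam) • Q
    - (Complex.I / 2) • (pauli3 * Q ^ 2) + (1 / 2 : ℂ) • (pauli3 * Qx))

/-- `W = -4 i λ³ σ₃ - 4 i λ² Q + 2 λ (i σ₃ Q² - σ₃ Q_x) + i Q_xx + 2 i Q³ + Q_x Q - Q Q_x`. -/
def laxW (lam : ℂ) (q r : ℝ → ℝ → ℝ → ℂ) : MatField := fun x y t =>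
  let Q := potMat q r x y t
  let Qx := mpdx (potMat q r) x y t
  let Qxx := mpdx (mpdx (potMat q r)) x y t
  (-4 * Complex.I * lam ^ 3) • pauli3 - (4 * Complex.I * lam ^ 2) • Q
    + (2 * lam) • (Complex.I • (pauli3 * Q ^ 2) - pauli3 * Qx)
    + Complex.I • Qxx + (2 * Complex.I) • Q ^ 3 + Qx * Q - Q * Qx

/-- `T (λ; x, y, t)`, regular for `λ ≠ pole`, is a Darboux matrix from the potentials `(q, r)` to
the potentials `(q', r')`: if `Φ` solves the Lax pair of `(q, r)` then `T Φ` solves the Lax pair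
of `(q', r')`, i.e. `T_x + T U = U' T`, `T_y + T V = V' T` and `T_t + T W = W' T`. -/
structure IsDarbouxMatrix (pole : ℂ) (T : ℂ → MatField) (q r q' r' : ℝ → ℝ → ℝ → ℂ) : Prop where
  smooth : ∀ lam : ℂ, lam ≠ pole → ∀ i j : Fin 2, Smooth3 (fun x y t => T lam x y t i j)
  eq_x : ∀ lam : ℂ, lam ≠ pole → ∀ x y t : ℝ,
    mpdx (T lam) x y t + T lam x y t * laxU lam q r x y t
      = laxU lam q' r' x y t * T lam x y t
  eq_y : ∀ lam : ℂ, lam ≠ pole → ∀ x y t : ℝ,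
    mpdy (T lam) x y t + T lam x y t * laxV lam q r x y t
      = laxV lam q' r' x y t * T lam x y t
  eq_t : ∀ lam : ℂ, lam ≠ pole → ∀ x y t : ℝ,
    mpdt (T lam) x y t + T lam x y t * laxW lam q r x y t
      = laxW lam q' r' x y t * T lam x y t

/-! ### The `N`-fold Darboux transformation of the plane wave at `λ = -i` -/

/-- The plane wave seed `q = e^{2 i y}`. -/
def seedQ : ℝ → ℝ → ℝ → ℂ := fun _ y _ => Complex.exp (2 * Complex.I * y)

/-- The plane wave seed `r = e^{-2 i y}`. -/
def seedR : ℝ → ℝ → ℝ → ℂ := fun _ y _ => Complex.exp (-(2 * Complex.I * y))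

/-- `ξ = √(λ² + 1)`. -/
def xi (lam : ℂ) : ℂ := (lam ^ 2 + 1) ^ (1 / 2 : ℂ)

/-- `ω = x + 2 λ y + 2 (1 - 2 λ²) t + a(λ)`. -/
def omega (a : ℂ → ℂ) (lam : ℂ) (x y t : ℝ) : ℂ :=
  x + 2 * lam * y + 2 * (1 - 2 * lam ^ 2) * t + a lam

/-- `sin (ξ ω) / ξ`, with the value `ω` at the removable singularity `ξ = 0`: here
`dslope sin 0 z` is `sin z / z` for `z ≠ 0`, and `1` for `z = 0`. -/
def sinOverXi (a : ℂ → ℂ) (lam : ℂ) (x y t : ℝ) : ℂ :=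
  omega a lam x y t * dslope Complex.sin 0 (xi lam * omega a lam x y t)

/-- The vector solution of the seed Lax pair at `λ` that generates the transformation,
`e^{-i y σ₃} ( (i λ + 1) sin(ξ ω)/ξ (1, i)ᵀ + cos(ξ ω) (1, -i)ᵀ )`. -/
def phi (a : ℂ → ℂ) (lam : ℂ) (x y t : ℝ) : Fin 2 → ℂ :=
  ![Complex.exp (-(Complex.I * y)) *
      ((Complex.I * lam + 1) * sinOverXi a lam x y t
        + Complex.cos (xi lam * omega a lam x y t)),
    Complex.exp (Complex.I * y) *
      ((Complex.I * lam + 1) * sinOverXi a lam x y t * Complex.I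
        - Complex.cos (xi lam * omega a lam x y t) * Complex.I)]

/-- `Φ^{[k]} = (1/k!) (d/dλ)^k Φ` at `λ = -i`. -/
def phiCoeff (a : ℂ → ℂ) (k : ℕ) (x y t : ℝ) : Fin 2 → ℂ := fun c =>
  iteratedDeriv k (fun lam => phi a lam x y t c) (-Complex.I) / (k.factorial : ℂ)

section Darboux

variable (N : ℕ) (a : ℂ → ℂ)

/-- `Y_N = [Φ^{[0]}, …, Φ^{[N-1]}]`. -/
def matY (x y t : ℝ) : Matrix (Fin 2) (Fin N) ℂ :=
  Matrix.of fun c k => phiCoeff a k x y t c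

/-- The block upper triangular Toeplitz matrix `X` with `Φ^{[j-k]}` in block row `k`, column `j`. -/
def matX (x y t : ℝ) : Matrix (Fin N × Fin 2) (Fin N) ℂ :=
  Matrix.of fun kc j => if kc.1 ≤ j then phiCoeff a (j - kc.1 : ℕ) x y t kc.2 else 0

/-- The matrix `S`, with blocks `(-1)^k C(k+l, k) / (2i)^{k+l+1} 𝕀₂`. -/
def matS : Matrix (Fin N × Fin 2) (Fin N × Fin 2) ℂ :=
  Matrix.of fun kc ld =>
    if kc.2 = ld.2 then
      (-1) ^ (kc.1 : ℕ) * (((kc.1 : ℕ) + (ld.1 : ℕ)).choose (kc.1 : ℕ) : ℂ)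
        / (2 * Complex.I) ^ ((kc.1 : ℕ) + (ld.1 : ℕ) + 1)
    else 0

/-- `M = X† S X`. -/
def matM (x y t : ℝ) : Matrix (Fin N) (Fin N) ℂ :=
  (matX N a x y t).conjTranspose * matS N * matX N a x y t

/-- The lower triangular matrix `D(λ)` with entries `(λ - i)^{-(i-j+1)}` for `j ≤ i`. -/
def matD (lam : ℂ) : Matrix (Fin N) (Fin N) ℂ :=
  Matrix.of fun i j => if j ≤ i then 1 / (lam - Complex.I) ^ ((i : ℕ) - (j : ℕ) + 1) else 0

/-- The `N`-th order Darboux matrix `T_N = 𝕀 + Y M⁻¹ D Y†`. -/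
def darbouxT (lam : ℂ) : MatField := fun x y t =>
  1 + matY N a x y t * (matM N a x y t)⁻¹ * matD N lam * (matY N a x y t).conjTranspose

/-- The new potential `q^{[N]} = q + 2 Y_{N,2} M⁻¹ Y_{N,1}†`, where `Y_{N,i}` is the `i`-th row
of `Y_N`. -/
def darbouxQ : ℝ → ℝ → ℝ → ℂ := fun x y t =>
  seedQ x y t +
    2 * (matY N a x y t * (matM N a x y t)⁻¹ * (matY N a x y t).conjTranspose) 1 0

end Darboux

/-- The coefficient `â_k` in `a(λ) = q⁻¹ ∑_k â_k (ln q)^k`, `q = i (λ + ξ)`, near `λ = -i`: with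
`κ = ln q` one has `q = e^κ` and `λ = -i cosh κ`. -/
def aHat (a : ℂ → ℂ) (k : ℕ) : ℂ :=
  iteratedDeriv k (fun κ : ℂ => Complex.exp κ * a (-Complex.I * Complex.cosh κ)) 0
    / (k.factorial : ℂ)

/-- The phase `a(λ)` is analytic at `λ = -i`, it has `a_1 = 0`, and its further parameters
`a_{2k+1} = conj â_{2k+1}`, `k = 1, …, N-1`, are the entries of
`A = (a_3, a_5, …, a_{2N-1})`. -/
structure IsPhase {N : ℕ} (A : Fin (N - 1) → ℂ) (a : ℂ → ℂ) : Prop where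
  analytic : AnalyticAt ℂ a (-Complex.I)
  normalized : aHat a 1 = 0
  params : ∀ k : Fin (N - 1), A k = (starRingEnd ℂ) (aHat a (2 * (k : ℕ) + 3))

/-! ### The determinants `σ_0`, `σ_1` -/

/-- The Schur polynomial `S_j(𝐱)` of `𝐱 = (x_1, x_2, …)`, defined by
`∑_j S_j(𝐱) λ^j = exp (∑_{j ≥ 1} x_j λ^j)` as formal power series. -/
def schur (v : ℕ → ℂ) (j : ℕ) : ℂ :=
  PowerSeries.coeff j
    ((PowerSeries.exp ℂ).subst (PowerSeries.mk fun k => if k = 0 then 0 else v k))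

/-- The coefficient `s_j` of `ln [(2/λ) tanh (λ/2)] = ∑_{j ≥ 1} s_j λ^j`; the function
`(2/λ) tanh (λ/2)` is extended by `1` to `λ = 0`. -/
def sCoeff (j : ℕ) : ℂ :=
  iteratedDeriv j
    (fun z : ℂ => Complex.log (dslope (fun w : ℂ => 2 * Complex.tanh (w / 2)) 0 z)) 0
    / (j.factorial : ℂ)

section Sigma

variable {N : ℕ} (A : Fin (N - 1) → ℂ)

/-- The parameter `a_j`: the entry of `A = (a_3, a_5, …, a_{2N-1})` of index `j`, and `0` if
there is none. -/
def aParam (j : ℕ) : ℂ := ∑ k : Fin (N - 1), if j = 2 * (k : ℕ) + 3 then A k else 0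

/-- `x_j^+(n) = ((x + 3t) + 2^j i y) / j! + 3^j t / j! + a_j` for odd `j`, with an additional
summand `n` if `j = 1`; `x_j^+(n) = 0` for even `j`. -/
def xPlus (n : ℕ) (x y t : ℝ) (j : ℕ) : ℂ :=
  if Odd j then
    ((x + 3 * t) + 2 ^ j * Complex.I * y) / (j.factorial : ℂ) + 3 ^ j * t / (j.factorial : ℂ)
      + aParam A j + (if j = 1 then (n : ℂ) else 0)
  else 0

/-- `x_j^-(n) = ((x + 3t) - 2^j i y) / j! + 3^j t / j! + conj a_j` for odd `j`, with an additional
summand `-n` if `j = 1`; `x_j^-(n) = 0` for even `j`. -/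
def xMinus (n : ℕ) (x y t : ℝ) (j : ℕ) : ℂ :=
  if Odd j then
    ((x + 3 * t) - 2 ^ j * Complex.I * y) / (j.factorial : ℂ) + 3 ^ j * t / (j.factorial : ℂ)
      + (starRingEnd ℂ) (aParam A j) - (if j = 1 then (n : ℂ) else 0)
  else 0

/-- `τ_{i,j}^{(n)} = (-1)^n ∑_{ν=0}^{min(i,j)} 4^{-ν} S_{i-ν}(𝐱^+(n) + ν 𝐬) S_{j-ν}(𝐱^-(n) + ν 𝐬)`. -/
def tau (n i j : ℕ) (x y t : ℝ) : ℂ :=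
  (-1) ^ n * ∑ ν ∈ Finset.range (min i j + 1), 1 / 4 ^ ν
    * schur (fun m => xPlus A n x y t m + ν * sCoeff m) (i - ν)
    * schur (fun m => xMinus A n x y t m + ν * sCoeff m) (j - ν)

/-- `σ_n = det (τ_{2i-1,2j-1}^{(n)})_{1 ≤ i, j ≤ N}`. -/
def sigma (n : ℕ) (x y t : ℝ) : ℂ :=
  Matrix.det (Matrix.of fun i j : Fin N => tau A n (2 * (i : ℕ) + 1) (2 * (j : ℕ) + 1) x y t)

/-- `u_N(x, y, t; A) = |σ_1(x - 3t, y, t; A) / σ_0(x - 3t, y, t; A)|² - 1`. -/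
def lumpU : ℝ → ℝ → ℝ → ℝ := fun x y t =>
  ‖sigma A 1 (x - 3 * t) y t / sigma A 0 (x - 3 * t) y t‖ ^ 2 - 1

end Sigma

end KPLump

end

/-!
The proof compares two matrices which agree up to a constant factor and a constant change of basis:
the matrix `M` of the Darboux transformation, and the matrix `(τ^{(0)}_{2i-1,2j-1})` of Schur
polynomials.

*Change of basis.* Put `λ = -i cosh κ`. Then `sinh κ · Φ` is the odd part in `κ` of
`(e^{-iy} (cosh κ + 1 + sinh κ), i e^{iy} (cosh κ + 1 - sinh κ)) e^θ`, `θ = sinh κ · ω`, and the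
phase condition says that the odd Taylor coefficients of `θ` are the variables `x^-_j(0)`. Hence
the Taylor coefficients of `Φ` at `λ = -i` (the matrix `Y`) and the odd coefficients in `κ` (the
matrix `oddCoeffs`) differ by a constant triangular matrix `kappaBasis`, which turns the Jordan
block `Λ` of `λ` into the Toeplitz matrix of `-i cosh κ` (`matY_mul_kappaBasis`,
`jordan_mul_kappaBasis`). The same triangular matrix shows that every `A` comes from a polynomial
phase (`exists_isPhase`).

*Sylvester equations.* By construction `Λ† M - M Λ = Y† Y` (`sylvester_matM`). Since the spectra of
`Λ†` and `Λ` are `{i}` and `{-i}`, this determines `M`; together with `Φ(-i) ≠ 0` it forces `M` to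
be invertible (`det_ne_zero_of_sylvester`). On the other side, the factor `(2/λ) tanh (λ/2)` in the
definition of `s` makes the sum defining `τ` telescope: `τ^{(0)}` solves the corresponding equation
with `cosh κ` in place of `λ` (`sylvester_tauMat`), and `τ^{(0)} - τ^{(1)}` has rank one
(`tauMat_sub`). So `M` is `τ^{(0)}` up to a constant change of basis, which gives `σ_0 ≠ 0`, and
the matrix determinant lemma gives `q^{[N]} = e^{2iy} σ_1 / σ_0` (`darbouxQ_eq`).

*Dressing.* Along a flow `Y' = ∑ L_m Y Λ^m` with anti-Hermitian `L_m`, the derivative of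
`G_B = Y M⁻¹ B Y†` is computed from the Sylvester equation alone (`hasMDerivAt_dressG`): it is a
polynomial in the `L_m`, the `G_{(Λ†)^m B}` and the coefficients `G_{(Λ†)^m}` of the Darboux matrix
at `λ = ∞`. For `B = (λ - Λ†)⁻¹ = D(λ)` this is the Darboux equation, and for `B = 1` it expresses
all derivatives of the new potentials, so that the AKNS flows become polynomial identities
(`IsDressing.isAKNSSolution`, `IsDressing.isDarbouxMatrix`). The KP equation for `u = q r` follows
from the two flows (`IsAKNSSolution.isKPSolution`), and a Galilean transformation removes the
background.

*Decay.* With `z = x + 2iy`, the Schur polynomials of index `j` behave like `z^j / j!` as `z → ∞`.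
Writing `τ^{(n)}` as a product of rectangular matrices and factoring out its dominant square block
(`exists_tendsto_det`), one finds that `σ_0` and `(-1)^N σ_1` have the same leading term, whose
coefficient is the square of a Vandermonde-type determinant (`det_schurLimit_ne_zero`).
-/

open scoped ContDiff

noncomputable section

namespace KPLump

/-! ### Formal exponentials and Schur polynomials -/

open PowerSeries in
/-- The formal exponent `∑_{k ≥ 1} v_k X^k`. -/
def expo (v : ℕ → ℂ) : PowerSeries ℂ := mk fun k => if k = 0 then 0 else v k

/-- The generating series `exp (∑_{k ≥ 1} v_k X^k)` of the Schur polynomials of `v`. -/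
def expSeries (v : ℕ → ℂ) : PowerSeries ℂ := (PowerSeries.exp ℂ).subst (expo v)

open PowerSeries

lemma schur_eq_coeff (v : ℕ → ℂ) (j : ℕ) : schur v j = coeff j (expSeries v) := rfl

lemma constantCoeff_expo (v : ℕ → ℂ) : constantCoeff (expo v) = 0 := by
  simp [expo, ← coeff_zero_eq_constantCoeff_apply]

lemma hasSubst_expo (v : ℕ → ℂ) : HasSubst (expo v) :=
  HasSubst.of_constantCoeff_zero' (constantCoeff_expo v)

lemma constantCoeff_expSeries (v : ℕ → ℂ) : constantCoeff (expSeries v) = 1 := by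
  have h := PowerSeries.constantCoeff_subst_eq_zero (constantCoeff_expo v) (exp ℂ - 1) (by simp)
  rw [PowerSeries.subst_sub (hasSubst_expo v)] at h
  have h1 : (1 : PowerSeries ℂ).subst (expo v) = 1 := by
    rw [← coe_substAlgHom (hasSubst_expo v), map_one]
  rw [h1, map_sub, sub_eq_zero] at h
  exact h.trans (by simp)

lemma derivative_expSeries (v : ℕ → ℂ) :
    d⁄dX ℂ (expSeries v) = d⁄dX ℂ (expo v) * expSeries v := by
  rw [expSeries, derivative_subst (hasSubst_expo v), derivative_exp, mul_comm]

/-- A formal linear differential equation `F' = H F` is a recurrence for the coefficients. -/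
lemma coeff_succ_of_derivative_eq {F H : PowerSeries ℂ} (h : d⁄dX ℂ F = H * F) (n : ℕ) :
    coeff (n + 1) F
      = (∑ k ∈ Finset.range (n + 1), coeff k H * coeff (n - k) F) / ((n : ℂ) + 1) := by
  have h1 := congrArg (coeff n) h
  rw [coeff_derivative, coeff_mul, Finset.Nat.sum_antidiagonal_eq_sum_range_succ_mk] at h1
  rw [eq_div_iff (Nat.cast_add_one_ne_zero n)]
  exact h1

lemma eq_of_derivative_eq {F G H : PowerSeries ℂ} (hF : d⁄dX ℂ F = H * F)
    (hG : d⁄dX ℂ G = H * G) (h0 : constantCoeff F = constantCoeff G) : F = G := by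
  ext n
  induction n using Nat.strong_induction_on with
  | _ n ih =>
    cases n with
    | zero => simpa using h0
    | succ n =>
      rw [coeff_succ_of_derivative_eq hF, coeff_succ_of_derivative_eq hG]
      congr 1
      exact Finset.sum_congr rfl fun k _ => by rw [ih (n - k) (by omega)]

lemma expo_add (v w : ℕ → ℂ) : expo (fun m => v m + w m) = expo v + expo w := by
  ext n
  by_cases hn : n = 0 <;> simp [expo, hn]

lemma expSeries_add (v w : ℕ → ℂ) :
    expSeries (fun m => v m + w m) = expSeries v * expSeries w := by
  refine eq_of_derivative_eq (derivative_expSeries _) ?_ (by simp [constantCoeff_expSeries])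
  rw [Derivation.leibniz, derivative_expSeries, derivative_expSeries, expo_add, map_add,
    smul_eq_mul, smul_eq_mul]
  ring

lemma expSeries_zero : expSeries (fun _ => 0) = 1 := by
  refine eq_of_derivative_eq (derivative_expSeries _) ?_ (by simp [constantCoeff_expSeries])
  have : expo (fun _ => 0) = 0 := by ext n; simp [expo]
  simp [this]

lemma expSeries_nsmul (v : ℕ → ℂ) (ν : ℕ) :
    expSeries (fun m => ν * v m) = expSeries v ^ ν := by
  induction ν with
  | zero => simpa using expSeries_zero
  | succ ν ih =>
    rw [pow_succ, ← ih, ← expSeries_add]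
    congr 1
    funext m
    push_cast
    ring

lemma schur_zero (v : ℕ → ℂ) : schur v 0 = 1 := by
  rw [schur_eq_coeff, coeff_zero_eq_constantCoeff_apply, constantCoeff_expSeries]

/-- The recurrence of the Schur polynomials. -/
lemma schur_succ (v : ℕ → ℂ) (n : ℕ) :
    schur v (n + 1)
      = (∑ k ∈ Finset.range (n + 1), (v (k + 1) * ((k : ℂ) + 1)) * schur v (n - k))
        / ((n : ℂ) + 1) := by
  rw [schur_eq_coeff, coeff_succ_of_derivative_eq (derivative_expSeries v)]
  congr 1
  refine Finset.sum_congr rfl fun k _ => ?_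
  rw [coeff_derivative, schur_eq_coeff]
  simp [expo]

lemma schur_congr {v w : ℕ → ℂ} (j : ℕ) (h : ∀ m ≤ j, v m = w m) : schur v j = schur w j := by
  induction j using Nat.strong_induction_on with
  | _ j ih =>
    cases j with
    | zero => rw [schur_zero, schur_zero]
    | succ n =>
      rw [schur_succ, schur_succ]
      congr 1
      refine Finset.sum_congr rfl fun k hk => ?_
      rw [Finset.mem_range] at hk
      rw [h (k + 1) (by omega), ih (n - k) (by omega) fun m hm => h m (by omega)]

lemma schur_conj (v : ℕ → ℂ) (j : ℕ) :
    schur (fun m => (starRingEnd ℂ) (v m)) j = (starRingEnd ℂ) (schur v j) := by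
  induction j using Nat.strong_induction_on with
  | _ j ih =>
    cases j with
    | zero => simp [schur_zero]
    | succ n =>
      rw [schur_succ, schur_succ, map_div₀, map_sum]
      congr 1
      · refine Finset.sum_congr rfl fun k hk => ?_
        rw [ih (n - k) (by omega)]
        simp
      · simp

lemma contDiff_schur {E : Type*} [NormedAddCommGroup E] [NormedSpace ℝ E] {v : E → ℕ → ℂ}
    (h : ∀ m, ContDiff ℝ ∞ fun p => v p m) (j : ℕ) : ContDiff ℝ ∞ fun p => schur (v p) j := by
  induction j using Nat.strong_induction_on with
  | _ j ih =>
    cases j with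
    | zero => simp only [schur_zero]; exact contDiff_const
    | succ n =>
      simp only [schur_succ]
      refine ContDiff.div_const (ContDiff.sum fun k _ => ?_) _
      exact ((h (k + 1)).mul contDiff_const).mul (ih (n - k) (by omega))

/-- Coefficientwise differentiation of `exp` along a path of exponents. -/
lemma hasDerivAt_schur {v : ℝ → ℕ → ℂ} {w : ℕ → ℂ} {s : ℝ}
    (h : ∀ m, HasDerivAt (fun s => v s m) (w m) s) (j : ℕ) :
    HasDerivAt (fun s => schur (v s) j) (coeff j (expo w * expSeries (v s))) s := by
  have hd : d⁄dX ℂ (expo w * expSeries (v s))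
      = d⁄dX ℂ (expo w) * expSeries (v s)
        + d⁄dX ℂ (expo (v s)) * (expo w * expSeries (v s)) := by
    rw [Derivation.leibniz, derivative_expSeries, smul_eq_mul, smul_eq_mul]
    ring
  induction j using Nat.strong_induction_on with
  | _ j ih =>
    cases j with
    | zero => simpa [schur_zero, constantCoeff_expo] using hasDerivAt_const s (1 : ℂ)
    | succ n =>
      simp only [schur_succ]
      have hsum : HasDerivAt
          (fun s => ∑ k ∈ Finset.range (n + 1), (v s (k + 1) * ((k : ℂ) + 1)) * schur (v s) (n - k))
          (∑ k ∈ Finset.range (n + 1), ((w (k + 1) * ((k : ℂ) + 1)) * schur (v s) (n - k)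
            + (v s (k + 1) * ((k : ℂ) + 1)) * coeff (n - k) (expo w * expSeries (v s)))) s := by
        refine HasDerivAt.fun_sum fun k _ => ?_
        exact ((h (k + 1)).mul_const _).mul (ih (n - k) (by omega))
      refine (hsum.div_const _).congr_deriv ?_
      rw [div_eq_iff (Nat.cast_add_one_ne_zero n)]
      have h1 := congrArg (coeff n) hd
      rw [coeff_derivative, map_add, coeff_mul n (d⁄dX ℂ (expo w)),
        coeff_mul n (d⁄dX ℂ (expo (v s))),
        Finset.Nat.sum_antidiagonal_eq_sum_range_succ_mk,
        Finset.Nat.sum_antidiagonal_eq_sum_range_succ_mk, ← Finset.sum_add_distrib] at h1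
      rw [h1]
      refine Finset.sum_congr rfl fun k _ => ?_
      simp [coeff_derivative, expo, schur_eq_coeff]

/-! ### Taylor series of analytic functions -/

/-- The Taylor series at `0` of a function of one complex variable. -/
def taylor (f : ℂ → ℂ) : PowerSeries ℂ :=
  mk fun n => iteratedDeriv n f 0 / (n.factorial : ℂ)

lemma coeff_taylor (f : ℂ → ℂ) (n : ℕ) :
    coeff n (taylor f) = iteratedDeriv n f 0 / (n.factorial : ℂ) := by simp [taylor]

lemma constantCoeff_taylor (f : ℂ → ℂ) : constantCoeff (taylor f) = f 0 := by
  rw [← coeff_zero_eq_constantCoeff_apply, coeff_taylor]; simp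

lemma taylor_congr {f g : ℂ → ℂ} (h : f =ᶠ[nhds 0] g) : taylor f = taylor g := by
  ext n
  rw [coeff_taylor, coeff_taylor, h.iteratedDeriv_eq n]

lemma taylor_add {f g : ℂ → ℂ} (hf : AnalyticAt ℂ f 0) (hg : AnalyticAt ℂ g 0) :
    taylor (fun z => f z + g z) = taylor f + taylor g := by
  ext n
  rw [map_add, coeff_taylor, coeff_taylor, coeff_taylor,
    iteratedDeriv_fun_add hf.contDiffAt hg.contDiffAt, add_div]

lemma taylor_mul {f g : ℂ → ℂ} (hf : AnalyticAt ℂ f 0) (hg : AnalyticAt ℂ g 0) :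
    taylor (fun z => f z * g z) = taylor f * taylor g := by
  ext n
  rw [coeff_taylor, coeff_mul, Finset.Nat.sum_antidiagonal_eq_sum_range_succ_mk,
    iteratedDeriv_fun_mul hf.contDiffAt hg.contDiffAt, Finset.sum_div]
  refine Finset.sum_congr rfl fun k hk => ?_
  rw [Finset.mem_range] at hk
  have hk' : k ≤ n := by omega
  rw [coeff_taylor, coeff_taylor, Nat.cast_choose ℂ hk']
  have := Nat.cast_ne_zero (R := ℂ) |>.2 n.factorial_ne_zero
  field_simp

lemma taylor_const (c : ℂ) : taylor (fun _ => c) = C c := by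
  ext n
  rw [coeff_taylor, coeff_C, iteratedDeriv_const]
  by_cases hn : n = 0 <;> simp [hn]

lemma taylor_id : taylor (fun z => z) = X := by
  ext n
  rw [coeff_taylor, coeff_X, iteratedDeriv_fun_id_zero]
  by_cases hn : n = 1 <;> simp [hn]

lemma taylor_const_mul (c : ℂ) {f : ℂ → ℂ} (hf : AnalyticAt ℂ f 0) :
    taylor (fun z => c * f z) = C c * taylor f := by
  rw [taylor_mul analyticAt_const hf, taylor_const]

lemma taylor_pow {f : ℂ → ℂ} (hf : AnalyticAt ℂ f 0) (n : ℕ) :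
    taylor (fun z => f z ^ n) = taylor f ^ n := by
  induction n with
  | zero => simp [taylor_const]
  | succ n ih => simp only [pow_succ]; rw [taylor_mul (hf.fun_pow n) hf, ih]

lemma derivative_taylor (f : ℂ → ℂ) : d⁄dX ℂ (taylor f) = taylor (deriv f) := by
  ext n
  rw [coeff_derivative, coeff_taylor, coeff_taylor, iteratedDeriv_succ', Nat.factorial_succ]
  have := Nat.cast_ne_zero (R := ℂ) |>.2 n.factorial_ne_zero
  have := Nat.cast_add_one_ne_zero (R := ℂ) n
  push_cast
  field_simp

/-- Formal and analytic exponentials agree. -/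
lemma taylor_exp_comp {f : ℂ → ℂ} (hf : AnalyticAt ℂ f 0) (h0 : f 0 = 0) :
    taylor (fun z => Complex.exp (f z)) = expSeries fun k => coeff k (taylor f) := by
  have hexpo : expo (fun k => coeff k (taylor f)) = taylor f := by
    ext n
    by_cases hn : n = 0
    · subst hn; simp [expo, constantCoeff_taylor, h0]
    · simp [expo, hn]
  refine eq_of_derivative_eq (H := d⁄dX ℂ (taylor f)) ?_ ?_ ?_
  · have he : AnalyticAt ℂ (fun z => Complex.exp (f z)) 0 := hf.cexp
    rw [derivative_taylor, derivative_taylor, ← taylor_mul hf.deriv he]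
    refine taylor_congr ?_
    filter_upwards [hf.eventually_analyticAt] with z hz
    rw [hz.differentiableAt.hasDerivAt.cexp.deriv, mul_comm]
  · rw [derivative_expSeries, hexpo]
  · rw [constantCoeff_taylor, constantCoeff_expSeries]; simp [h0]

lemma coeff_taylor_comp_neg (f : ℂ → ℂ) (n : ℕ) :
    coeff n (taylor fun z => f (-z)) = (-1) ^ n * coeff n (taylor f) := by
  rw [coeff_taylor, coeff_taylor, iteratedDeriv_comp_neg]
  simp [mul_div_assoc]

lemma coeff_taylor_of_even {f : ℂ → ℂ} (hf : ∀ z, f (-z) = f z) {n : ℕ} (hn : Odd n) :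
    coeff n (taylor f) = 0 := by
  have h := coeff_taylor_comp_neg f n
  simp only [hf, hn.neg_one_pow] at h
  linear_combination h / 2

lemma coeff_taylor_of_odd {f : ℂ → ℂ} (hf : ∀ z, f (-z) = -f z) {n : ℕ} (hn : Even n) :
    coeff n (taylor f) = 0 := by
  have h := coeff_taylor_comp_neg f n
  have h2 : taylor (fun z => -f z) = -taylor f := by
    ext m
    rw [map_neg, coeff_taylor, coeff_taylor, iteratedDeriv_fun_neg, neg_div]
  simp only [hf, hn.neg_one_pow, h2, map_neg] at h
  linear_combination -h / 2

end KPLump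

namespace KPLump

open PowerSeries

/-! ### Hyperbolic series -/

/-- The power series of `cosh κ`. -/
def coshS : PowerSeries ℂ := taylor Complex.cosh

/-- The power series of `sinh κ`. -/
def sinhS : PowerSeries ℂ := taylor Complex.sinh

/-- The power series of `tanh (κ / 2)`. -/
def tanhS : PowerSeries ℂ := taylor fun z => Complex.tanh (z / 2)

lemma analyticAt_cosh (z : ℂ) : AnalyticAt ℂ Complex.cosh z :=
  Complex.differentiable_cosh.analyticAt z

lemma analyticAt_sinh (z : ℂ) : AnalyticAt ℂ Complex.sinh z :=
  Complex.differentiable_sinh.analyticAt z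

lemma analyticAt_tanh_half : AnalyticAt ℂ (fun z => Complex.tanh (z / 2)) 0 := by
  have hs : AnalyticAt ℂ (fun z : ℂ => Complex.sinh (z / 2)) 0 :=
    (show Differentiable ℂ fun z : ℂ => Complex.sinh (z / 2) by fun_prop).analyticAt 0
  have hc : AnalyticAt ℂ (fun z : ℂ => Complex.cosh (z / 2)) 0 :=
    (show Differentiable ℂ fun z : ℂ => Complex.cosh (z / 2) by fun_prop).analyticAt 0
  refine (hs.div hc (by simp)).congr ?_
  exact Filter.Eventually.of_forall fun z => (Complex.tanh_eq_sinh_div_cosh (z / 2)).symm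

lemma coshS_sq_sub : coshS ^ 2 - sinhS ^ 2 = 1 := by
  have h : taylor (fun z => Complex.cosh z ^ 2) = taylor (fun z => 1 + Complex.sinh z ^ 2) := by
    congr 1
    funext z
    rw [Complex.cosh_sq, add_comm]
  rw [taylor_pow (analyticAt_cosh 0), taylor_add analyticAt_const ((analyticAt_sinh 0).fun_pow 2),
    taylor_pow (analyticAt_sinh 0), taylor_const, map_one] at h
  rw [coshS, sinhS, h]
  ring

lemma tanhS_mul : tanhS * (coshS + 1) = sinhS := by
  have h1 : coshS + 1 = taylor fun z => Complex.cosh z + 1 := by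
    rw [taylor_add (analyticAt_cosh 0) analyticAt_const, taylor_const, map_one, coshS]
  rw [h1, tanhS, ← taylor_mul analyticAt_tanh_half ((analyticAt_cosh 0).fun_add analyticAt_const)]
  refine taylor_congr ?_
  have hc : ContinuousAt (fun z : ℂ => Complex.cosh (z / 2)) 0 := by fun_prop
  filter_upwards [hc.eventually_ne (show Complex.cosh (0 / 2) ≠ 0 by simp)] with z hz
  have e1 : Complex.cosh z = 2 * Complex.cosh (z / 2) ^ 2 - 1 := by
    have := Complex.cosh_two_mul (z / 2)
    rw [Complex.sinh_sq, mul_div_cancel₀ z two_ne_zero] at this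
    rw [this]; ring
  have e2 : Complex.sinh z = 2 * Complex.sinh (z / 2) * Complex.cosh (z / 2) := by
    have := Complex.sinh_two_mul (z / 2)
    rwa [mul_div_cancel₀ z two_ne_zero] at this
  rw [Complex.tanh_eq_sinh_div_cosh, e1, e2]
  field_simp
  ring

lemma constantCoeff_coshS : constantCoeff coshS = 1 := by simp [coshS, constantCoeff_taylor]

lemma constantCoeff_sinhS : constantCoeff sinhS = 0 := by simp [sinhS, constantCoeff_taylor]

lemma constantCoeff_tanhS : constantCoeff tanhS = 0 := by simp [tanhS, constantCoeff_taylor]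

lemma coshS_add_one_ne_zero : coshS + 1 ≠ 0 := by
  intro h
  have := congrArg constantCoeff h
  norm_num [constantCoeff_coshS] at this

/-- `cosh² (κ / 2) (1 - tanh² (κ / 2)) = 1`. -/
lemma coshS_add_one_mul_sub : (coshS + 1) * (1 - tanhS ^ 2) = 2 := by
  refine mul_left_cancel₀ coshS_add_one_ne_zero ?_
  linear_combination -(tanhS * (coshS + 1) + sinhS) * tanhS_mul + coshS_sq_sub

/-- `cosh² (κ / 2) (1 + tanh² (κ / 2)) = cosh κ`. -/
lemma coshS_add_one_mul_add : (coshS + 1) * (1 + tanhS ^ 2) = 2 * coshS := by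
  linear_combination -coshS_add_one_mul_sub

lemma coeff_coshS_of_odd {n : ℕ} (hn : Odd n) : coeff n coshS = 0 :=
  coeff_taylor_of_even Complex.cosh_neg hn

lemma coeff_sinhS_of_even {n : ℕ} (hn : Even n) : coeff n sinhS = 0 :=
  coeff_taylor_of_odd Complex.sinh_neg hn

lemma coeff_tanhS_pow_mul (F : PowerSeries ℂ) {ν i : ℕ} (h : i < ν) :
    coeff i (tanhS ^ ν * F) = 0 := by
  have h1 : X ∣ tanhS := X_dvd_iff.2 constantCoeff_tanhS
  have h2 : X ^ ν ∣ tanhS ^ ν * F := Dvd.dvd.mul_right (pow_dvd_pow_of_dvd h1 ν) F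
  exact X_pow_dvd_iff.1 h2 i h

/-- The unit vector `δ_{m,1}`, the exponent of `exp κ`. -/
def unitOne (m : ℕ) : ℂ := if m = 1 then 1 else 0

lemma expSeries_unitOne : expSeries unitOne = coshS + sinhS := by
  have h := taylor_exp_comp (f := fun z => z) analyticAt_id rfl
  have h2 : taylor (fun z => Complex.exp z) = coshS + sinhS := by
    rw [coshS, sinhS, ← taylor_add (analyticAt_cosh 0) (analyticAt_sinh 0)]
    simp [Complex.cosh_add_sinh]
  rw [← h2, h, taylor_id]
  congr 1
  funext k
  simp [unitOne, coeff_X]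

lemma expSeries_neg_unitOne : expSeries (fun m => -unitOne m) = coshS - sinhS := by
  have h : expSeries (fun m => -unitOne m) * expSeries unitOne = 1 := by
    rw [← expSeries_add]
    simpa using expSeries_zero
  have h2 : expSeries unitOne ≠ 0 := fun h0 => by simp [h0] at h
  refine mul_right_cancel₀ h2 ?_
  rw [h, expSeries_unitOne]
  linear_combination -coshS_sq_sub

/-- The vector `𝐬` is the exponent of `(2 / κ) tanh (κ / 2)`. -/
lemma X_mul_expSeries_sCoeff : X * expSeries sCoeff = C 2 * tanhS := by
  set f : ℂ → ℂ := fun w => 2 * Complex.tanh (w / 2) with hf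
  have hfan : AnalyticAt ℂ f 0 := analyticAt_const.mul analyticAt_tanh_half
  have hdan : AnalyticAt ℂ (dslope f 0) 0 := by
    obtain ⟨p, hp⟩ := hfan
    exact hp.has_fpower_series_dslope_fslope.analyticAt
  have hmul : ∀ z, z * dslope f 0 z = f z := fun z => by
    have := sub_smul_dslope f 0 z
    simpa [hf] using this
  have hX : X * taylor (dslope f 0) = C 2 * tanhS := by
    rw [← taylor_id, ← taylor_mul (f := fun z => z) analyticAt_id hdan, tanhS,
      ← taylor_const_mul 2 analyticAt_tanh_half]
    congr 1
    funext z
    exact hmul z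
  have h0 : dslope f 0 0 = 1 := by
    have h1 := congrArg (coeff 1) hX
    have h2 : coeff 1 tanhS * 2 = 1 := by
      have h3 := congrArg (coeff 1) tanhS_mul
      have h4 : coeff 1 sinhS = 1 := by
        rw [sinhS, coeff_taylor, iteratedDeriv_one, Complex.deriv_sinh]; simp
      rw [coeff_mul, Finset.Nat.sum_antidiagonal_eq_sum_range_succ_mk, h4,
        Finset.sum_range_succ, Finset.sum_range_one] at h3
      simp only [Nat.sub_self, map_add, coeff_zero_eq_constantCoeff_apply, constantCoeff_tanhS,
        constantCoeff_coshS, map_one, zero_mul, zero_add] at h3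
      linear_combination h3
    have h3 := coeff_succ_mul_X 0 (taylor (dslope f 0))
    rw [zero_add] at h3
    rw [coeff_C_mul, mul_comm X, h3,
      coeff_zero_eq_constantCoeff_apply, constantCoeff_taylor] at h1
    rw [h1]
    linear_combination h2
  have hlog : AnalyticAt ℂ (fun z => Complex.log (dslope f 0 z)) 0 :=
    hdan.clog (by rw [h0]; exact Complex.one_mem_slitPlane)
  have key : taylor (dslope f 0) = expSeries sCoeff := by
    have h1 := taylor_exp_comp hlog (by rw [h0, Complex.log_one])
    have h2 : (fun k => coeff k (taylor fun z => Complex.log (dslope f 0 z))) = sCoeff := by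
      funext k
      rw [coeff_taylor, sCoeff]
    rw [h2] at h1
    rw [← h1]
    refine taylor_congr ?_
    filter_upwards [hdan.continuousAt.eventually_ne (show dslope f 0 0 ≠ 0 by
        rw [h0]; exact one_ne_zero)]
      with z hz
    rw [Complex.exp_log hz]
  rw [← key, hX]

/-! ### The kernel `τ` -/

lemma schur_add_nsmul_sCoeff (v : ℕ → ℂ) {i ν : ℕ} (h : ν ≤ i) :
    schur (fun m => v m + ν * sCoeff m) (i - ν)
      = 2 ^ ν * coeff i (tanhS ^ ν * expSeries v) := by
  have h1 : C (2 ^ ν) * (tanhS ^ ν * expSeries v)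
      = X ^ ν * expSeries (fun m => v m + ν * sCoeff m) := by
    rw [expSeries_add v, expSeries_nsmul, map_pow]
    calc C 2 ^ ν * (tanhS ^ ν * expSeries v) = (C 2 * tanhS) ^ ν * expSeries v := by ring
      _ = _ := by rw [← X_mul_expSeries_sCoeff]; ring
  have h2 := congrArg (coeff i) h1
  rw [coeff_C_mul] at h2
  rw [h2, schur_eq_coeff]
  conv_rhs => rw [← Nat.sub_add_cancel h, add_comm, coeff_X_pow_mul']
  simp

section Tau

variable {N : ℕ} (A : Fin (N - 1) → ℂ)

/-- Since `(2 / κ) tanh (κ / 2) = exp (∑ s_j κ ^ j)`, the generating function of `τ^{(n)}` is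
`(-1)^n ∑_ν (tanh (p / 2) tanh (κ / 2))^ν exp (θ⁺(p)) exp (θ⁻(κ))`. -/
lemma tau_eq_sum (n : ℕ) (x y t : ℝ) {i j L : ℕ} (hL : min i j < L) :
    tau A n i j x y t = (-1) ^ n * ∑ ν ∈ Finset.range L,
      coeff i (tanhS ^ ν * expSeries (xPlus A n x y t))
        * coeff j (tanhS ^ ν * expSeries (xMinus A n x y t)) := by
  rw [tau]
  congr 1
  have hsub : Finset.range (min i j + 1) ⊆ Finset.range L := by
    intro ν; simp only [Finset.mem_range]; omega
  rw [← Finset.sum_subset hsub]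
  · refine Finset.sum_congr rfl fun ν hν => ?_
    rw [Finset.mem_range, Nat.lt_succ_iff, le_min_iff] at hν
    rw [schur_add_nsmul_sCoeff _ hν.1, schur_add_nsmul_sCoeff _ hν.2]
    have h4 : (4 : ℂ) ^ ν = 2 ^ ν * 2 ^ ν := by rw [← mul_pow]; norm_num
    have h2 : (2 : ℂ) ^ ν ≠ 0 := pow_ne_zero _ two_ne_zero
    rw [h4]
    field_simp
  · intro ν _ hν
    rw [Finset.mem_range, not_lt] at hν
    rcases min_lt_iff.1 (Nat.lt_of_succ_le hν) with h | h
    · rw [coeff_tanhS_pow_mul _ h, zero_mul]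
    · rw [coeff_tanhS_pow_mul _ h, mul_zero]

lemma xPlus_one (x y t : ℝ) : xPlus A 1 x y t = fun m => unitOne m + xPlus A 0 x y t m := by
  funext m
  by_cases h1 : m = 1
  · subst h1; simp [xPlus, unitOne]; ring
  · by_cases hm : Odd m <;> simp [xPlus, unitOne, h1, hm]

lemma xMinus_one (x y t : ℝ) : xMinus A 1 x y t = fun m => -unitOne m + xMinus A 0 x y t m := by
  funext m
  by_cases h1 : m = 1
  · subst h1; simp [xMinus, unitOne]; ring
  · by_cases hm : Odd m <;> simp [xMinus, unitOne, h1, hm]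

lemma conj_xMinus_zero (x y t : ℝ) (m : ℕ) :
    (starRingEnd ℂ) (xMinus A 0 x y t m) = xPlus A 0 x y t m := by
  by_cases hm : Odd m
  · simp [xPlus, xMinus, hm, map_ofNat]
  · simp [xPlus, xMinus, hm]

/-- The difference `τ^{(0)} - τ^{(1)}` has rank one: its generating function telescopes because
`exp κ = (1 + tanh (κ / 2)) / (1 - tanh (κ / 2))`. -/
lemma tau_zero_sub_tau_one (i j : ℕ) (x y t : ℝ) :
    tau A 0 i j x y t - tau A 1 i j x y t
      = 1 / 2 * (coeff i ((coshS + 1 + sinhS) * expSeries (xPlus A 0 x y t))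
        * coeff j ((coshS + 1 - sinhS) * expSeries (xMinus A 0 x y t))) := by
  have hL : min i j < i + j + 1 := by omega
  rw [tau_eq_sum A 0 x y t hL, tau_eq_sum A 1 x y t hL, xPlus_one, xMinus_one, expSeries_add,
    expSeries_add (fun m => -unitOne m), expSeries_unitOne, expSeries_neg_unitOne]
  set E := expSeries (xPlus A 0 x y t)
  set E' := expSeries (xMinus A 0 x y t)
  set f := (coshS + 1 + sinhS) * E with hf
  set f' := (coshS + 1 - sinhS) * E' with hf'
  have e1 : C 2 * E = f - tanhS * f := by
    have h2 : (C 2 : PowerSeries ℂ) = 2  := map_ofNat C 2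
    rw [h2, hf]
    linear_combination -E * coshS_add_one_mul_sub + E * (1 - tanhS) * tanhS_mul
  have e2 : C 2 * ((coshS + sinhS) * E) = f + tanhS * f := by
    have h2 : (C 2 : PowerSeries ℂ) = 2  := map_ofNat C 2
    rw [h2, hf]
    linear_combination -E * coshS_add_one_mul_add + E * (tanhS - 1) * tanhS_mul
  have e3 : C 2 * E' = f' + tanhS * f' := by
    have h2 : (C 2 : PowerSeries ℂ) = 2  := map_ofNat C 2
    rw [h2, hf']
    linear_combination -E' * coshS_add_one_mul_sub - E' * (1 + tanhS) * tanhS_mul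
  have e4 : C 2 * ((coshS - sinhS) * E') = f' - tanhS * f' := by
    have h2 : (C 2 : PowerSeries ℂ) = 2  := map_ofNat C 2
    rw [h2, hf']
    linear_combination -E' * coshS_add_one_mul_add + E' * (1 + tanhS) * tanhS_mul
  have co : ∀ (k ν : ℕ) (F G H : PowerSeries ℂ), C 2 * F = G + H →
      coeff k (tanhS ^ ν * F) = 1 / 2 * (coeff k (tanhS ^ ν * G) + coeff k (tanhS ^ ν * H)) := by
    intro k ν F G H h
    rw [← map_add, ← mul_add, ← h, mul_left_comm, coeff_C_mul]
    ring
  have shift : ∀ (k ν : ℕ) (G : PowerSeries ℂ),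
      coeff k (tanhS ^ ν * (tanhS * G)) = coeff k (tanhS ^ (ν + 1) * G) := by
    intro k ν G
    rw [← mul_assoc, ← pow_succ]
  have neg : ∀ (k ν : ℕ) (G : PowerSeries ℂ),
      coeff k (tanhS ^ ν * (-(tanhS * G))) = -coeff k (tanhS ^ (ν + 1) * G) := by
    intro k ν G
    rw [mul_neg, map_neg, shift]
  have tel : ∀ ν, coeff i (tanhS ^ ν * E) * coeff j (tanhS ^ ν * E')
      + coeff i (tanhS ^ ν * ((coshS + sinhS) * E)) * coeff j (tanhS ^ ν * ((coshS - sinhS) * E'))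
      = 1 / 2 * (coeff i (tanhS ^ ν * f) * coeff j (tanhS ^ ν * f'))
        - 1 / 2 * (coeff i (tanhS ^ (ν + 1) * f) * coeff j (tanhS ^ (ν + 1) * f')) := by
    intro ν
    rw [co i ν E f (-(tanhS * f)) (by rw [e1]; ring), co i ν ((coshS + sinhS) * E) f (tanhS * f) e2,
      co j ν E' f' (tanhS * f') e3,
      co j ν ((coshS - sinhS) * E') f' (-(tanhS * f')) (by rw [e4]; ring)]
    simp only [shift, neg]
    ring
  rw [pow_zero, one_mul, pow_one, neg_one_mul, sub_neg_eq_add, ← Finset.sum_add_distrib,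
    Finset.sum_congr rfl fun ν _ => tel ν, Finset.sum_range_sub']
  rw [coeff_tanhS_pow_mul f (show i < i + j + 1 by omega)]
  simp

/-- The kernel `τ^{(0)}` solves a Sylvester equation: multiplying its generating function by
`cosh p + cosh κ = 2 cosh² (p / 2) cosh² (κ / 2) (1 - tanh² (p / 2) tanh² (κ / 2))` leaves a
kernel of rank two. -/
lemma sylvester_tau (i j : ℕ) (x y t : ℝ) :
    ∑ p ∈ Finset.HasAntidiagonal.antidiagonal i, coeff p.1 coshS * tau A 0 p.2 j x y t
      + ∑ p ∈ Finset.HasAntidiagonal.antidiagonal j, coeff p.1 coshS * tau A 0 i p.2 x y t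
      = 1 / 4 * (coeff i ((coshS + 1 + sinhS) * expSeries (xPlus A 0 x y t))
          * coeff j ((coshS + 1 + sinhS) * expSeries (xMinus A 0 x y t))
        + coeff i ((coshS + 1 - sinhS) * expSeries (xPlus A 0 x y t))
          * coeff j ((coshS + 1 - sinhS) * expSeries (xMinus A 0 x y t))) := by
  set E := expSeries (xPlus A 0 x y t)
  set E' := expSeries (xMinus A 0 x y t)
  set e := (coshS + 1) * E with he
  set e' := (coshS + 1) * E' with he'
  have h1 : ∑ p ∈ Finset.HasAntidiagonal.antidiagonal i, coeff p.1 coshS * tau A 0 p.2 j x y t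
      = ∑ ν ∈ Finset.range (i + j + 1),
        coeff i (coshS * (tanhS ^ ν * E)) * coeff j (tanhS ^ ν * E') := by
    simp only [coeff_mul i coshS, Finset.sum_mul]
    rw [Finset.sum_comm]
    refine Finset.sum_congr rfl fun p hp => ?_
    rw [Finset.HasAntidiagonal.mem_antidiagonal] at hp
    rw [tau_eq_sum A 0 x y t (show min p.2 j < i + j + 1 by omega), pow_zero, one_mul,
      Finset.mul_sum]
    exact Finset.sum_congr rfl fun ν _ => by ring
  have h2 : ∑ p ∈ Finset.HasAntidiagonal.antidiagonal j, coeff p.1 coshS * tau A 0 i p.2 x y t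
      = ∑ ν ∈ Finset.range (i + j + 1),
        coeff i (tanhS ^ ν * E) * coeff j (coshS * (tanhS ^ ν * E')) := by
    simp only [coeff_mul j coshS, Finset.mul_sum]
    rw [Finset.sum_comm]
    refine Finset.sum_congr rfl fun p hp => ?_
    rw [Finset.HasAntidiagonal.mem_antidiagonal] at hp
    rw [tau_eq_sum A 0 x y t (show min i p.2 < i + j + 1 by omega), pow_zero, one_mul,
      Finset.mul_sum]
    exact Finset.sum_congr rfl fun ν _ => by ring
  have h22 : (C 2 : PowerSeries ℂ) = 2 := map_ofNat C 2
  have co1 : ∀ (k ν : ℕ) (F : PowerSeries ℂ), coeff k (tanhS ^ ν * F) = 1 / 2 *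
      (coeff k (tanhS ^ ν * ((coshS + 1) * F))
        - coeff k (tanhS ^ (ν + 2) * ((coshS + 1) * F))) := by
    intro k ν F
    rw [← map_sub]
    have : tanhS ^ ν * ((coshS + 1) * F) - tanhS ^ (ν + 2) * ((coshS + 1) * F)
        = C 2 * (tanhS ^ ν * F) := by
      rw [h22]
      linear_combination tanhS ^ ν * F * coshS_add_one_mul_sub
    rw [this, coeff_C_mul]
    ring
  have co2 : ∀ (k ν : ℕ) (F : PowerSeries ℂ), coeff k (coshS * (tanhS ^ ν * F)) = 1 / 2 *
      (coeff k (tanhS ^ ν * ((coshS + 1) * F))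
        + coeff k (tanhS ^ (ν + 2) * ((coshS + 1) * F))) := by
    intro k ν F
    rw [← map_add]
    have : tanhS ^ ν * ((coshS + 1) * F) + tanhS ^ (ν + 2) * ((coshS + 1) * F)
        = C 2 * (coshS * (tanhS ^ ν * F)) := by
      rw [h22]
      linear_combination tanhS ^ ν * F * coshS_add_one_mul_add
    rw [this, coeff_C_mul]
    ring
  have tel : ∀ ν, coeff i (coshS * (tanhS ^ ν * E)) * coeff j (tanhS ^ ν * E')
      + coeff i (tanhS ^ ν * E) * coeff j (coshS * (tanhS ^ ν * E'))
      = 1 / 2 * (coeff i (tanhS ^ ν * e) * coeff j (tanhS ^ ν * e')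
          + coeff i (tanhS ^ (ν + 1) * e) * coeff j (tanhS ^ (ν + 1) * e'))
        - 1 / 2 * (coeff i (tanhS ^ (ν + 1) * e) * coeff j (tanhS ^ (ν + 1) * e')
          + coeff i (tanhS ^ (ν + 1 + 1) * e) * coeff j (tanhS ^ (ν + 1 + 1) * e')) := by
    intro ν
    rw [co2 i ν E, co1 i ν E, co2 j ν E', co1 j ν E']
    ring
  have s1 : ∀ F : PowerSeries ℂ,
      (coshS + 1 + sinhS) * F = tanhS ^ 0 * ((coshS + 1) * F) + tanhS ^ 1 * ((coshS + 1) * F) := by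
    intro F
    linear_combination -F * tanhS_mul
  have s2 : ∀ F : PowerSeries ℂ,
      (coshS + 1 - sinhS) * F = tanhS ^ 0 * ((coshS + 1) * F) - tanhS ^ 1 * ((coshS + 1) * F) := by
    intro F
    linear_combination F * tanhS_mul
  rw [h1, h2, ← Finset.sum_add_distrib, Finset.sum_congr rfl fun ν _ => tel ν,
    Finset.sum_range_sub', coeff_tanhS_pow_mul e (show i < i + j + 1 by omega),
    coeff_tanhS_pow_mul e (show i < i + j + 1 + 1 by omega), s1, s1, s2, s2]
  simp only [map_add, map_sub]
  ring

/-! ### Restriction to odd indices -/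

variable (N) in
/-- Multiplication by the even series `cosh κ`, acting from the right on the rows of the first `N`
odd Taylor coefficients. -/
def coshMat : Matrix (Fin N) (Fin N) ℂ :=
  Matrix.of fun a b => if a ≤ b then coeff (2 * ((b : ℕ) - (a : ℕ))) coshS else 0

lemma sum_antidiagonal_coshS (f : ℕ → ℂ) (j : Fin N) :
    ∑ p ∈ Finset.HasAntidiagonal.antidiagonal (2 * (j : ℕ) + 1), coeff p.1 coshS * f p.2
      = ∑ b : Fin N, f (2 * (b : ℕ) + 1) * coshMat N b j := by
  have h1 : ∑ b : Fin N, f (2 * (b : ℕ) + 1) * coshMat N b j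
      = ∑ b ∈ Finset.univ.filter (fun b : Fin N => b ≤ j),
        coeff (2 * ((j : ℕ) - (b : ℕ))) coshS * f (2 * (b : ℕ) + 1) := by
    rw [Finset.sum_filter]
    refine Finset.sum_congr rfl fun b _ => ?_
    by_cases hb : b ≤ j <;> simp [coshMat, hb, mul_comm]
  rw [h1]
  symm
  refine Finset.sum_of_injOn (fun b : Fin N => (2 * ((j : ℕ) - (b : ℕ)), 2 * (b : ℕ) + 1))
    ?_ ?_ ?_ ?_
  · intro a _ b _ hab
    simp only [Prod.mk.injEq] at hab
    exact Fin.ext (by omega)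
  · intro b hb
    have hb' : (b : ℕ) ≤ j := (Finset.mem_filter.1 hb).2
    simp only [Finset.mem_coe, Finset.HasAntidiagonal.mem_antidiagonal]
    omega
  · rintro ⟨p, r⟩ hp hnot
    rw [Finset.HasAntidiagonal.mem_antidiagonal] at hp
    rcases Nat.even_or_odd p with hev | hodd
    · exfalso
      apply hnot
      obtain ⟨m, hm⟩ := hev
      simp only at hp
      refine ⟨⟨(j : ℕ) - m, by omega⟩, ?_, ?_⟩
      · exact Finset.mem_coe.2 (Finset.mem_filter.2 ⟨Finset.mem_univ _, Nat.sub_le _ _⟩)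
      · simp only [Prod.mk.injEq]
        omega
    · simp only
      rw [coeff_coshS_of_odd hodd, zero_mul]
  · intro b _
    rfl

/-- The matrix `(τ^{(n)}_{2i-1,2j-1})` whose determinant is `σ_n`. -/
def tauMat (n : ℕ) (x y t : ℝ) : Matrix (Fin N) (Fin N) ℂ :=
  Matrix.of fun i j : Fin N => tau A n (2 * (i : ℕ) + 1) (2 * (j : ℕ) + 1) x y t

lemma sigma_eq_det (n : ℕ) (x y t : ℝ) : sigma A n x y t = (tauMat A n x y t).det := rfl

/-- The odd Taylor coefficients in `κ` of the two components of `sinh κ · Φ`, where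
`λ = -i cosh κ`. -/
def oddCoeffs (x y t : ℝ) : Matrix (Fin 2) (Fin N) ℂ :=
  Matrix.of ![fun j => Complex.exp (-(Complex.I * y))
      * coeff (2 * (j : ℕ) + 1) ((coshS + 1 + sinhS) * expSeries (xMinus A 0 x y t)),
    fun j => Complex.I * Complex.exp (Complex.I * y)
      * coeff (2 * (j : ℕ) + 1) ((coshS + 1 - sinhS) * expSeries (xMinus A 0 x y t))]

lemma conj_coeff_add (x y t : ℝ) (k : ℕ) :
    (starRingEnd ℂ) (coeff k ((coshS + 1 + sinhS) * expSeries (xMinus A 0 x y t)))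
      = coeff k ((coshS + 1 + sinhS) * expSeries (xPlus A 0 x y t)) := by
  have h : ∀ v, (coshS + 1 + sinhS) * expSeries v
      = expSeries (fun m => unitOne m + v m) + expSeries v := fun v => by
    rw [expSeries_add, expSeries_unitOne]; ring
  rw [h, h, map_add, map_add, map_add, ← schur_eq_coeff, ← schur_eq_coeff, ← schur_conj,
    ← schur_conj, ← schur_eq_coeff, ← schur_eq_coeff]
  congr 2 <;> funext m <;> simp only [map_add, conj_xMinus_zero]
  congr 1
  by_cases hm : m = 1 <;> simp [unitOne, hm]

lemma conj_coeff_sub (x y t : ℝ) (k : ℕ) :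
    (starRingEnd ℂ) (coeff k ((coshS + 1 - sinhS) * expSeries (xMinus A 0 x y t)))
      = coeff k ((coshS + 1 - sinhS) * expSeries (xPlus A 0 x y t)) := by
  have h : ∀ v, (coshS + 1 - sinhS) * expSeries v
      = expSeries (fun m => -unitOne m + v m) + expSeries v := fun v => by
    rw [expSeries_add (fun m => -unitOne m), expSeries_neg_unitOne]; ring
  rw [h, h, map_add, map_add, map_add, ← schur_eq_coeff, ← schur_eq_coeff, ← schur_conj,
    ← schur_conj, ← schur_eq_coeff, ← schur_eq_coeff]
  congr 2 <;> funext m <;> simp only [map_add, map_neg, conj_xMinus_zero]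
  congr 2
  by_cases hm : m = 1 <;> simp [unitOne, hm]

lemma exp_mul_exp_neg_I (y : ℝ) :
    Complex.exp (Complex.I * y) * Complex.exp (-(Complex.I * y)) = 1 := by
  rw [← Complex.exp_add, add_neg_cancel, Complex.exp_zero]

lemma conj_exp_I (y : ℝ) :
    (starRingEnd ℂ) (Complex.exp (Complex.I * y)) = Complex.exp (-(Complex.I * y)) := by
  rw [← Complex.exp_conj]; simp

lemma conj_exp_neg_I (y : ℝ) :
    (starRingEnd ℂ) (Complex.exp (-(Complex.I * y))) = Complex.exp (Complex.I * y) := by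
  rw [← Complex.exp_conj]; simp

/-- The Sylvester equation of `(τ^{(0)}_{2i-1,2j-1})`. -/
lemma sylvester_tauMat (x y t : ℝ) :
    (coshMat N).transpose * tauMat A 0 x y t + tauMat A 0 x y t * coshMat N
      = (1 / 4 : ℂ) • ((oddCoeffs A x y t).conjTranspose * oddCoeffs A x y t) := by
  ext i j
  have h := sylvester_tau A (2 * (i : ℕ) + 1) (2 * (j : ℕ) + 1) x y t
  rw [sum_antidiagonal_coshS (fun k => tau A 0 k (2 * (j : ℕ) + 1) x y t),
    sum_antidiagonal_coshS (fun k => tau A 0 (2 * (i : ℕ) + 1) k x y t)] at h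
  have e := exp_mul_exp_neg_I y
  rw [Matrix.add_apply, Matrix.mul_apply, Matrix.mul_apply, Matrix.smul_apply, Matrix.mul_apply,
    Fin.sum_univ_two]
  simp only [Matrix.transpose_apply, Matrix.conjTranspose_apply, tauMat, oddCoeffs,
    Matrix.of_apply, Matrix.cons_val_zero, Matrix.cons_val_one, ← starRingEnd_apply, map_mul,
    conj_coeff_add, conj_coeff_sub, conj_exp_I, conj_exp_neg_I, Complex.conj_I, smul_eq_mul]
  rw [Finset.sum_congr rfl fun b _ => mul_comm (coshMat N b i) _]
  refine h.trans ?_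
  set a := coeff (2 * (i : ℕ) + 1) ((coshS + 1 + sinhS) * expSeries (xPlus A 0 x y t))
  set b := coeff (2 * (j : ℕ) + 1) ((coshS + 1 + sinhS) * expSeries (xMinus A 0 x y t))
  set a' := coeff (2 * (i : ℕ) + 1) ((coshS + 1 - sinhS) * expSeries (xPlus A 0 x y t))
  set b' := coeff (2 * (j : ℕ) + 1) ((coshS + 1 - sinhS) * expSeries (xMinus A 0 x y t))
  linear_combination (-(1 / 4 : ℂ) * (a * b + a' * b')) * e
    + (1 / 4 : ℂ) * a' * b' * Complex.exp (Complex.I * y) * Complex.exp (-(Complex.I * y))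
      * Complex.I_mul_I

/-- The rank one difference of the two `τ`-matrices. -/
lemma tauMat_sub (x y t : ℝ) (i j : Fin N) :
    tauMat A 0 x y t i j - tauMat A 1 x y t i j
      = -(Complex.I / 2) * Complex.exp (-(2 * Complex.I * y))
        * ((starRingEnd ℂ) (oddCoeffs A x y t 0 i) * oddCoeffs A x y t 1 j) := by
  have e := exp_mul_exp_neg_I y
  have e2 : Complex.exp (-(2 * Complex.I * y)) = Complex.exp (-(Complex.I * y)) ^ 2 := by
    rw [← Complex.exp_nat_mul]; congr 1; push_cast; ring
  simp only [tauMat, oddCoeffs, Matrix.of_apply, tau_zero_sub_tau_one, Matrix.cons_val_zero,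
    Matrix.cons_val_one, map_mul, conj_exp_neg_I, conj_coeff_add, e2]
  set a := coeff (2 * (i : ℕ) + 1) ((coshS + 1 + sinhS) * expSeries (xPlus A 0 x y t))
  set b' := coeff (2 * (j : ℕ) + 1) ((coshS + 1 - sinhS) * expSeries (xMinus A 0 x y t))
  set u := Complex.exp (Complex.I * y)
  set v := Complex.exp (-(Complex.I * y))
  linear_combination (-(1 / 2 : ℂ) * a * b' * (u * v + 1)) * e
    + (1 / 2 : ℂ) * v ^ 2 * u ^ 2 * a * b' * Complex.I_mul_I

end Tau

end KPLump

namespace KPLump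

open PowerSeries

/-! ### The Taylor coefficients of `Φ` at `λ = -i` -/

/-- An even entire function is an entire function of `z²`. -/
lemma exists_differentiable_comp_sq {f : ℂ → ℂ} (hf : Differentiable ℂ f)
    (heven : ∀ z, f (-z) = f z) :
    ∃ g : ℂ → ℂ, Differentiable ℂ g ∧ ∀ z, g (z ^ 2) = f z := by
  set r : ℂ → ℂ := fun w => w ^ (2⁻¹ : ℂ) with hr
  have hr2 : ∀ w, r w ^ 2 = w := fun w => by
    simp [hr]
  have hroot : ∀ {z w : ℂ}, z ^ 2 = w → f (r w) = f z := by
    intro z w h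
    rcases sq_eq_sq_iff_eq_or_eq_neg.1 ((hr2 w).trans h.symm) with h | h
    · rw [h]
    · rw [h, heven]
  have hslit : ∀ w ∈ Complex.slitPlane, DifferentiableAt ℂ r w := fun w hw =>
    (differentiableAt_id.cpow_const hw)
  have hdiff : ∀ w, w ≠ 0 → DifferentiableAt ℂ (fun w => f (r w)) w := by
    intro w hw
    rcases Complex.mem_slitPlane_or_neg_mem_slitPlane hw with h | h
    · exact (hf _).comp w (hslit w h)
    · -- on the negative axis the other branch `i √(-w)` of the square root is differentiable
      have h1 : (fun w => f (r w)) = fun w => f (Complex.I * r (-w)) := by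
        funext w
        refine hroot ?_
        rw [mul_pow, hr2, Complex.I_sq]
        ring
      rw [h1]
      refine (hf _).comp w (DifferentiableAt.const_mul ?_ _)
      exact DifferentiableAt.comp w (hslit (-w) h) differentiableAt_id.neg
  refine ⟨fun w => f (r w), fun w => ?_, fun z => hroot rfl⟩
  by_cases hw : w = 0
  · subst hw
    refine (Complex.analyticAt_of_differentiable_on_punctured_nhds_of_continuousAt ?_
      ?_).differentiableAt
    · filter_upwards [self_mem_nhdsWithin] with w hw using hdiff w hw
    · refine ContinuousAt.comp (f := r) hf.continuous.continuousAt ?_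
      have hn : ∀ w, ‖r w‖ ^ 2 = ‖w‖ := fun w => by rw [← norm_pow, hr2]
      have hr0 : r 0 = 0 := by simp [hr]
      rw [ContinuousAt, hr0, tendsto_zero_iff_norm_tendsto_zero]
      have h1 : (fun w => ‖r w‖) = fun w => Real.sqrt ‖w‖ := by
        funext w
        have h2 := Real.sqrt_sq (norm_nonneg (r w))
        rw [hn] at h2
        exact h2.symm
      rw [h1]
      have : ContinuousAt (fun w : ℂ => Real.sqrt ‖w‖) 0 := by fun_prop
      simpa [ContinuousAt] using this
  · exact hdiff w hw

lemma xi_sq (lam : ℂ) : xi lam ^ 2 = lam ^ 2 + 1 := by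
  simp [xi]

lemma dslope_sin_neg (z : ℂ) : dslope Complex.sin 0 (-z) = dslope Complex.sin 0 z := by
  by_cases hz : z = 0
  · simp [hz]
  · rw [dslope_of_ne _ (neg_ne_zero.2 hz), dslope_of_ne _ hz, slope_def_field, slope_def_field]
    simp [neg_div_neg_eq]

lemma mul_dslope_sin (z : ℂ) : z * dslope Complex.sin 0 z = Complex.sin z := by
  simpa using sub_smul_dslope Complex.sin 0 z

lemma differentiable_dslope_sin : Differentiable ℂ (dslope Complex.sin 0) := by
  have h := (Complex.differentiableOn_dslope (f := Complex.sin) (c := 0)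
    (s := Set.univ) Filter.univ_mem).2 Complex.differentiable_sin.differentiableOn
  exact differentiableOn_univ.1 h

lemma analyticAt_omega {a : ℂ → ℂ} (ha : AnalyticAt ℂ a (-Complex.I)) (x y t : ℝ) :
    AnalyticAt ℂ (fun lam => omega a lam x y t) (-Complex.I) := by
  unfold omega
  fun_prop

/-- Although `ξ` branches at `λ = -i`, the vector `Φ` is even in `ξ` and hence analytic. -/
lemma analyticAt_phi {a : ℂ → ℂ} (ha : AnalyticAt ℂ a (-Complex.I)) (x y t : ℝ) (c : Fin 2) :
    AnalyticAt ℂ (fun lam => phi a lam x y t c) (-Complex.I) := by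
  obtain ⟨Cs, hCs, hCs2⟩ := exists_differentiable_comp_sq Complex.differentiable_cos
    Complex.cos_neg
  obtain ⟨Ss, hSs, hSs2⟩ := exists_differentiable_comp_sq differentiable_dslope_sin dslope_sin_neg
  have ho := analyticAt_omega ha x y t
  have harg : AnalyticAt ℂ (fun lam : ℂ => (lam ^ 2 + 1) * omega a lam x y t ^ 2) (-Complex.I) := by
    fun_prop
  have hsq : ∀ lam, (xi lam * omega a lam x y t) ^ 2 = (lam ^ 2 + 1) * omega a lam x y t ^ 2 :=
    fun lam => by rw [mul_pow, xi_sq]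
  have hcos : AnalyticAt ℂ (fun lam => Complex.cos (xi lam * omega a lam x y t)) (-Complex.I) := by
    have h1 : (fun lam => Complex.cos (xi lam * omega a lam x y t))
        = fun lam => Cs ((lam ^ 2 + 1) * omega a lam x y t ^ 2) := by
      funext lam
      rw [← hsq, hCs2]
    rw [h1]
    exact (hCs.analyticAt _).comp harg
  have hsin : AnalyticAt ℂ (fun lam => sinOverXi a lam x y t) (-Complex.I) := by
    have h1 : (fun lam => sinOverXi a lam x y t)
        = fun lam => omega a lam x y t * Ss ((lam ^ 2 + 1) * omega a lam x y t ^ 2) := by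
      funext lam
      rw [sinOverXi, ← hsq, hSs2]
    rw [h1]
    exact ho.mul ((hSs.analyticAt _).comp harg)
  fin_cases c
  · simp only [phi, Fin.zero_eta, Matrix.cons_val_zero]
    fun_prop
  · simp only [phi, Fin.mk_one, Matrix.cons_val_one, Matrix.cons_val_zero]
    fun_prop

/-- The phase `θ(κ) = sinh κ · ω(-i cosh κ)`. -/
def theta (a : ℂ → ℂ) (x y t : ℝ) (κ : ℂ) : ℂ :=
  Complex.sinh κ * omega a (-Complex.I * Complex.cosh κ) x y t

lemma theta_neg (a : ℂ → ℂ) (x y t : ℝ) (κ : ℂ) : theta a x y t (-κ) = -theta a x y t κ := by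
  simp [theta]

lemma xi_cosh_sq (κ : ℂ) :
    xi (-Complex.I * Complex.cosh κ) ^ 2 = (Complex.sinh κ * Complex.I) ^ 2 := by
  rw [xi_sq, mul_pow, mul_pow, Complex.cosh_sq, neg_sq, Complex.I_sq]
  ring

lemma cos_xi_mul_omega (a : ℂ → ℂ) (x y t : ℝ) (κ : ℂ) :
    Complex.cos (xi (-Complex.I * Complex.cosh κ) * omega a (-Complex.I * Complex.cosh κ) x y t)
      = Complex.cosh (theta a x y t κ) := by
  have h : Complex.cos (Complex.sinh κ * Complex.I * omega a (-Complex.I * Complex.cosh κ) x y t)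
      = Complex.cosh (theta a x y t κ) := by
    rw [← Complex.cos_mul_I (theta a x y t κ), theta]
    congr 1
    ring
  rw [← h]
  rcases sq_eq_sq_iff_eq_or_eq_neg.1 (xi_cosh_sq κ) with h | h
  · rw [h]
  · rw [h, neg_mul, Complex.cos_neg]

lemma sinh_mul_sinOverXi (a : ℂ → ℂ) (x y t : ℝ) (κ : ℂ) :
    Complex.sinh κ * sinOverXi a (-Complex.I * Complex.cosh κ) x y t
      = Complex.sinh (theta a x y t κ) := by
  have h1 : dslope Complex.sin 0
      (xi (-Complex.I * Complex.cosh κ) * omega a (-Complex.I * Complex.cosh κ) x y t)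
      = dslope Complex.sin 0 (theta a x y t κ * Complex.I) := by
    rcases sq_eq_sq_iff_eq_or_eq_neg.1 (xi_cosh_sq κ) with h | h
    · rw [h, theta]; congr 1; ring
    · rw [h, neg_mul, dslope_sin_neg, theta]; congr 1; ring
  have h2 := mul_dslope_sin (theta a x y t κ * Complex.I)
  rw [Complex.sin_mul_I] at h2
  rw [sinOverXi, h1, ← mul_assoc, ← theta]
  linear_combination -Complex.I * h2
    + (theta a x y t κ * dslope Complex.sin 0 (theta a x y t κ * Complex.I)
      - Complex.sinh (theta a x y t κ)) * Complex.I_mul_I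

lemma sinh_mul_phi_zero (a : ℂ → ℂ) (x y t : ℝ) (κ : ℂ) :
    Complex.sinh κ * phi a (-Complex.I * Complex.cosh κ) x y t 0
      = Complex.exp (-(Complex.I * y)) * ((Complex.cosh κ + 1) * Complex.sinh (theta a x y t κ)
        + Complex.sinh κ * Complex.cosh (theta a x y t κ)) := by
  simp only [phi, Matrix.cons_val_zero, cos_xi_mul_omega]
  rw [← sinh_mul_sinOverXi]
  linear_combination (-Complex.sinh κ * Complex.exp (-(Complex.I * y)) * Complex.cosh κ
    * sinOverXi a (-Complex.I * Complex.cosh κ) x y t) * Complex.I_mul_I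

lemma sinh_mul_phi_one (a : ℂ → ℂ) (x y t : ℝ) (κ : ℂ) :
    Complex.sinh κ * phi a (-Complex.I * Complex.cosh κ) x y t 1
      = Complex.I * Complex.exp (Complex.I * y)
        * ((Complex.cosh κ + 1) * Complex.sinh (theta a x y t κ)
          - Complex.sinh κ * Complex.cosh (theta a x y t κ)) := by
  simp only [phi, Matrix.cons_val_one, Matrix.cons_val_zero, cos_xi_mul_omega]
  rw [← sinh_mul_sinOverXi]
  linear_combination (-Complex.sinh κ * Complex.exp (Complex.I * y) * Complex.cosh κ
    * sinOverXi a (-Complex.I * Complex.cosh κ) x y t * Complex.I) * Complex.I_mul_I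

lemma coeff_taylor_exp_mul (c : ℂ) (n : ℕ) :
    coeff n (taylor fun z => Complex.exp (c * z)) = c ^ n / (n.factorial : ℂ) := by
  rw [coeff_taylor, iteratedDeriv_cexp_const_mul]
  simp

lemma coeff_taylor_sinh_mul (c : ℂ) {n : ℕ} (hn : Odd n) :
    coeff n (taylor fun z => Complex.sinh (c * z)) = c ^ n / (n.factorial : ℂ) := by
  have h1 : AnalyticAt ℂ (fun z => Complex.sinh (c * z)) 0 :=
    (show Differentiable ℂ fun z => Complex.sinh (c * z) by fun_prop).analyticAt 0
  have h2 : AnalyticAt ℂ (fun z => Complex.cosh (c * z)) 0 :=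
    (show Differentiable ℂ fun z => Complex.cosh (c * z) by fun_prop).analyticAt 0
  have h3 := taylor_add h2 h1
  simp only [Complex.cosh_add_sinh] at h3
  have h4 := congrArg (coeff n) h3
  rw [map_add, coeff_taylor_exp_mul,
    coeff_taylor_of_even (f := fun z => Complex.cosh (c * z)) (by simp) hn, zero_add] at h4
  exact h4.symm

lemma analyticAt_comp_cosh {f : ℂ → ℂ} (hf : AnalyticAt ℂ f (-Complex.I)) :
    AnalyticAt ℂ (fun κ => f (-Complex.I * Complex.cosh κ)) 0 := by
  have h : AnalyticAt ℂ (fun κ => -Complex.I * Complex.cosh κ) 0 :=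
    analyticAt_const.mul (analyticAt_cosh 0)
  refine AnalyticAt.comp (g := f) ?_ h
  simpa using hf

lemma aHat_eq_coeff (a : ℂ → ℂ) (k : ℕ) :
    aHat a k = coeff k
      (taylor fun κ => Complex.exp κ * a (-Complex.I * Complex.cosh κ)) := by
  rw [aHat, coeff_taylor]

/-- The odd coefficients `â_k` are those of `sinh κ · a(-i cosh κ)`. -/
lemma aHat_of_odd {a : ℂ → ℂ} (ha : AnalyticAt ℂ a (-Complex.I)) {k : ℕ} (hk : Odd k) :
    aHat a k = coeff k
      (taylor fun κ => Complex.sinh κ * a (-Complex.I * Complex.cosh κ)) := by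
  have hb := analyticAt_comp_cosh ha
  have h : taylor (fun κ => Complex.exp κ * a (-Complex.I * Complex.cosh κ))
      = taylor (fun κ => Complex.cosh κ * a (-Complex.I * Complex.cosh κ))
        + taylor (fun κ => Complex.sinh κ * a (-Complex.I * Complex.cosh κ)) := by
    rw [← taylor_add ((analyticAt_cosh 0).fun_mul hb) ((analyticAt_sinh 0).fun_mul hb)]
    congr 1
    funext κ
    rw [← add_mul, Complex.cosh_add_sinh]
  rw [aHat_eq_coeff, h, map_add, coeff_taylor_of_even _ hk, zero_add]
  simp

lemma analyticAt_theta {a : ℂ → ℂ} (ha : AnalyticAt ℂ a (-Complex.I)) (x y t : ℝ) :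
    AnalyticAt ℂ (theta a x y t) 0 :=
  (analyticAt_sinh 0).mul (analyticAt_comp_cosh (analyticAt_omega ha x y t))

/-- With `λ = -i cosh κ`, the Taylor coefficients of `θ` are the `x_j^-(0)`, as long as they are
seen by the first `N` odd orders. -/
lemma coeff_theta {N : ℕ} {A : Fin (N - 1) → ℂ} {a : ℂ → ℂ} (ha : IsPhase A a) (x y t : ℝ)
    {k : ℕ} (hk : k < 2 * N) :
    coeff k (taylor (theta a x y t)) = xMinus A 0 x y t k := by
  rcases Nat.even_or_odd k with hev | hodd
  · rw [coeff_taylor_of_odd (theta_neg a x y t) hev, xMinus, if_neg (by simpa using hev)]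
  obtain ⟨c, hc⟩ : ∃ c : ℂ, c = x + 3 * t := ⟨_, rfl⟩
  have hsplit : theta a x y t = fun κ => (c * Complex.sinh (1 * κ)
      + -(Complex.I * y) * Complex.sinh (2 * κ)) + (t * Complex.sinh (3 * κ)
      + Complex.sinh κ * a (-Complex.I * Complex.cosh κ)) := by
    funext κ
    rw [theta, omega, hc, one_mul, Complex.sinh_two_mul, Complex.sinh_three_mul]
    linear_combination (-4 * Complex.sinh κ * Complex.cosh κ ^ 2 * t) * Complex.I_mul_I
      + 4 * Complex.sinh κ * t * Complex.cosh_sq κ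
  have hs : ∀ c : ℂ, AnalyticAt ℂ (fun κ => Complex.sinh (c * κ)) 0 := fun c =>
    (show Differentiable ℂ fun z => Complex.sinh (c * z) by fun_prop).analyticAt 0
  have hb := analyticAt_comp_cosh ha.analytic
  have hsb := (analyticAt_sinh 0).fun_mul hb
  rw [hsplit, taylor_add ((analyticAt_const.fun_mul (hs 1)).fun_add
      (analyticAt_const.fun_mul (hs 2))) ((analyticAt_const.fun_mul (hs 3)).fun_add hsb),
    taylor_add (analyticAt_const.fun_mul (hs 1)) (analyticAt_const.fun_mul (hs 2)),
    taylor_add (analyticAt_const.fun_mul (hs 3)) hsb,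
    taylor_const_mul _ (hs 1), taylor_const_mul _ (hs 2), taylor_const_mul _ (hs 3)]
  simp only [map_add, coeff_C_mul, coeff_taylor_sinh_mul _ hodd, ← aHat_of_odd ha.analytic hodd]
  have haP : aHat a k = (starRingEnd ℂ) (aParam A k) := by
    rw [aParam, map_sum]
    obtain ⟨m, rfl⟩ := hodd
    cases m with
    | zero =>
      change aHat a 1 = _
      rw [ha.normalized, Finset.sum_eq_zero]
      intro b _
      rw [if_neg (by omega), map_zero]
    | succ m =>
      rw [Finset.sum_eq_single_of_mem (⟨m, by omega⟩ : Fin (N - 1)) (Finset.mem_univ _)]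
      · rw [if_pos (by simp only; ring), ha.params, Complex.conj_conj]
        congr 1
      · intro b _ hb
        rw [if_neg, map_zero]
        intro h
        exact hb (Fin.ext (by simp only; omega))
  rw [haP, xMinus, if_pos hodd]
  simp only [one_pow, Nat.cast_zero, ite_self, sub_zero, hc]
  ring

/-! ### From `λ` to `κ` -/

/-- Taylor's formula for a composition with a function that vanishes at `0`. -/
lemma taylor_comp {G η : ℂ → ℂ} (hη : AnalyticAt ℂ η 0) (h0 : η 0 = 0) (L : ℕ)
    (hG : AnalyticAt ℂ G 0) :
    ∃ R : PowerSeries ℂ, taylor (fun z => G (η z))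
      = ∑ l ∈ Finset.range L, C (coeff l (taylor G)) * taylor η ^ l + taylor η ^ L * R := by
  induction L generalizing G with
  | zero => exact ⟨taylor (fun z => G (η z)), by simp⟩
  | succ L ih =>
    have hd : AnalyticAt ℂ (dslope G 0) 0 := by
      obtain ⟨p, hp⟩ := hG
      exact hp.has_fpower_series_dslope_fslope.analyticAt
    have hsl : ∀ z, G z = G 0 + z * dslope G 0 z := fun z => by
      have := sub_smul_dslope G 0 z
      rw [sub_zero, smul_eq_mul] at this
      rw [this]; ring
    obtain ⟨R, hR⟩ := ih hd
    have hdη : AnalyticAt ℂ (fun z => dslope G 0 (η z)) 0 :=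
      AnalyticAt.comp (g := dslope G 0) (by rwa [h0]) hη
    have h1 : taylor (fun z => G (η z))
        = C (G 0) + taylor η * taylor (fun z => dslope G 0 (η z)) := by
      rw [← taylor_mul hη hdη, ← taylor_const, ← taylor_add analyticAt_const (hη.fun_mul hdη)]
      exact congrArg taylor (funext fun z => hsl (η z))
    have h2 : taylor G = C (G 0) + taylor (dslope G 0) * X := by
      rw [← taylor_id, ← taylor_mul hd (f := dslope G 0) (g := fun z => z) analyticAt_id,
        ← taylor_const, ← taylor_add analyticAt_const (hd.fun_mul (g := fun z => z) analyticAt_id)]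
      exact congrArg taylor (funext fun z => (hsl z).trans (by rw [mul_comm]))
    have h3 : ∀ l, coeff (l + 1) (taylor G) = coeff l (taylor (dslope G 0)) := fun l => by
      rw [h2, map_add, coeff_C, if_neg (Nat.succ_ne_zero l), zero_add, coeff_succ_mul_X]
    refine ⟨R, ?_⟩
    rw [h1, hR, Finset.sum_range_succ', pow_zero, mul_one, coeff_zero_eq_constantCoeff_apply,
      constantCoeff_taylor, mul_add, Finset.mul_sum]
    have h4 : ∀ l ∈ Finset.range L, taylor η * (C (coeff l (taylor (dslope G 0))) * taylor η ^ l)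
        = C (coeff (l + 1) (taylor G)) * taylor η ^ (l + 1) := fun l _ => by
      rw [h3]; ring
    rw [Finset.sum_congr rfl h4]
    ring

/-- The series of the local parameter `λ + i = -i (cosh κ - 1)`. -/
def etaS : PowerSeries ℂ := C (-Complex.I) * (coshS - 1)

lemma taylor_eta : taylor (fun κ => -Complex.I * (Complex.cosh κ - 1)) = etaS := by
  have h : AnalyticAt ℂ (fun κ => Complex.cosh κ + -1) 0 := (analyticAt_cosh 0).add analyticAt_const
  have h2 := taylor_const_mul (-Complex.I) h
  rw [taylor_add (analyticAt_cosh 0) analyticAt_const, taylor_const] at h2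
  simpa [etaS, coshS, sub_eq_add_neg] using h2

lemma exists_etaS_eq : ∃ W : PowerSeries ℂ, etaS = X ^ 2 * W ∧ constantCoeff W ≠ 0 := by
  have h0 : coeff 0 etaS = 0 := by simp [etaS, constantCoeff_coshS]
  have h1 : coeff 1 etaS = 0 := by
    simp [etaS, coeff_coshS_of_odd odd_one, coeff_one]
  have h2 : coeff 2 etaS = -Complex.I / 2 := by
    have : coeff 2 coshS = 1 / 2 := by
      rw [coshS, coeff_taylor, iteratedDeriv_succ, iteratedDeriv_one, Complex.deriv_cosh,
        Complex.deriv_sinh]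
      simp
    rw [etaS, coeff_C_mul, map_sub, this, coeff_one]
    simp; ring
  obtain ⟨W, hW⟩ : X ^ 2 ∣ etaS := X_pow_dvd_iff.2 fun m hm => by
    interval_cases m
    · exact h0
    · exact h1
  refine ⟨W, hW, ?_⟩
  rw [hW] at h2
  have h3 := coeff_X_pow_mul W 2 0
  rw [zero_add] at h3
  rw [← coeff_zero_eq_constantCoeff_apply, ← h3, h2]
  simp

lemma exists_sinhS_eq : ∃ V : PowerSeries ℂ, sinhS = X * V ∧ constantCoeff V ≠ 0 := by
  obtain ⟨V, hV⟩ : X ∣ sinhS := X_dvd_iff.2 constantCoeff_sinhS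
  refine ⟨V, hV, ?_⟩
  have h4 : coeff 1 sinhS = 1 := by
    rw [sinhS, coeff_taylor, iteratedDeriv_one, Complex.deriv_sinh]; simp
  rw [hV] at h4
  have h3 := coeff_X_pow_mul V 1 0
  rw [zero_add, pow_one] at h3
  rw [← coeff_zero_eq_constantCoeff_apply, ← h3, h4]
  exact one_ne_zero

/-- The change of basis from powers of `λ + i` to odd powers of `κ`: the odd Taylor coefficients
of `sinh κ (λ + i)^l`. -/
def kappaBasis (N : ℕ) : Matrix (Fin N) (Fin N) ℂ :=
  Matrix.of fun l j => coeff (2 * (j : ℕ) + 1) (sinhS * etaS ^ (l : ℕ))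

lemma coeff_sinhS_mul_etaS_pow_mul (R : PowerSeries ℂ) {l k : ℕ} (h : k < 2 * l + 1) :
    coeff k (sinhS * (etaS ^ l * R)) = 0 := by
  obtain ⟨W, hW, -⟩ := exists_etaS_eq
  obtain ⟨V, hV, -⟩ := exists_sinhS_eq
  refine X_pow_dvd_iff.1 (show X ^ (2 * l + 1) ∣ _ from ⟨V * W ^ l * R, ?_⟩) k h
  rw [hW, hV]
  ring

lemma det_kappaBasis_ne_zero (N : ℕ) : (kappaBasis N).det ≠ 0 := by
  rw [Matrix.det_of_isUpperTriangular]
  · refine Finset.prod_ne_zero_iff.2 fun l _ => ?_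
    obtain ⟨W, hW, hW0⟩ := exists_etaS_eq
    obtain ⟨V, hV, hV0⟩ := exists_sinhS_eq
    have h1 : sinhS * etaS ^ (l : ℕ) = X ^ (2 * (l : ℕ) + 1) * (V * W ^ (l : ℕ)) := by
      rw [hW, hV]; ring
    have h3 := coeff_X_pow_mul (V * W ^ (l : ℕ)) (2 * (l : ℕ) + 1) 0
    rw [zero_add] at h3
    rw [kappaBasis, Matrix.of_apply, h1, h3, coeff_zero_eq_constantCoeff_apply, map_mul, map_pow]
    exact mul_ne_zero hV0 (pow_ne_zero _ hW0)
  · intro l j hlj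
    have hlj' : (j : ℕ) < l := hlj
    have := coeff_sinhS_mul_etaS_pow_mul 1 (show 2 * (j : ℕ) + 1 < 2 * (l : ℕ) + 1 by omega)
    rwa [mul_one] at this

/-- The upper triangular Jordan block with eigenvalue `-i`: multiplication by `λ` on Taylor
coefficients at `λ = -i`. -/
def jordan (N : ℕ) : Matrix (Fin N) (Fin N) ℂ :=
  Matrix.of fun l k =>
    (if l = k then -Complex.I else 0) + (if (l : ℕ) + 1 = k then 1 else 0)

lemma sum_jordan_mul {N : ℕ} (f : ℕ → ℂ) (hf : f N = 0) (l : Fin N) :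
    ∑ k : Fin N, jordan N l k * f k = -Complex.I * f l + f (l + 1) := by
  simp only [jordan, Matrix.of_apply, add_mul, Finset.sum_add_distrib, ite_mul, zero_mul, one_mul,
    Finset.sum_ite_eq, Finset.mem_univ, if_true]
  congr 1
  by_cases h : (l : ℕ) + 1 < N
  · rw [Finset.sum_eq_single_of_mem (⟨l + 1, h⟩ : Fin N) (Finset.mem_univ _)]
    · simp
    · intro b _ hb
      rw [if_neg]
      intro h2
      exact hb (Fin.ext h2.symm)
  · have hN : (l : ℕ) + 1 = N := by omega
    rw [hN, hf]
    refine Finset.sum_eq_zero fun b _ => ?_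
    rw [if_neg (by omega)]

/-- In the odd powers of `κ`, multiplication by `λ` is multiplication by `-i cosh κ`. -/
lemma jordan_mul_kappaBasis (N : ℕ) :
    jordan N * kappaBasis N = kappaBasis N * (-Complex.I • coshMat N) := by
  ext l j
  rw [Matrix.mul_smul, Matrix.smul_apply, Matrix.mul_apply, Matrix.mul_apply]
  have h1 := sum_antidiagonal_coshS (fun k => coeff k (sinhS * etaS ^ (l : ℕ))) j
  rw [← coeff_mul] at h1
  have h2 := sum_jordan_mul (fun k => coeff (2 * (j : ℕ) + 1) (sinhS * etaS ^ k))
    (by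
      have := coeff_sinhS_mul_etaS_pow_mul 1 (show 2 * (j : ℕ) + 1 < 2 * N + 1 by omega)
      rwa [mul_one] at this) l
  refine h2.trans ?_
  refine Eq.trans ?_ (congrArg (fun z => -Complex.I • z) h1)
  rw [smul_eq_mul, ← coeff_C_mul, ← coeff_C_mul, ← map_add]
  congr 1
  rw [pow_succ, etaS]
  ring

/-- The Taylor coefficients of `Φ` at `λ = -i` are related to the odd coefficients in `κ` by the
change of basis. -/
lemma matY_mul_kappaBasis {N : ℕ} {A : Fin (N - 1) → ℂ} {a : ℂ → ℂ} (ha : IsPhase A a)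
    (x y t : ℝ) : matY N a x y t * kappaBasis N = oddCoeffs A x y t := by
  have hexp : ∀ {k : ℕ}, k < 2 * N → coeff k (taylor fun κ => Complex.exp (theta a x y t κ))
      = coeff k (expSeries (xMinus A 0 x y t)) := by
    intro k hk
    rw [taylor_exp_comp (analyticAt_theta ha.analytic x y t) (by simp [theta])]
    exact schur_congr k fun m hm => coeff_theta ha x y t (by omega)
  have hth := analyticAt_theta ha.analytic x y t
  have hE : AnalyticAt ℂ (fun κ => Complex.exp (theta a x y t κ)) 0 := hth.cexp
  have hmulE : ∀ (F : PowerSeries ℂ) (j : Fin N),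
      coeff (2 * (j : ℕ) + 1) (F * taylor fun κ => Complex.exp (theta a x y t κ))
        = coeff (2 * (j : ℕ) + 1) (F * expSeries (xMinus A 0 x y t)) := by
    intro F j
    rw [coeff_mul, coeff_mul]
    refine Finset.sum_congr rfl fun p hp => ?_
    rw [Finset.HasAntidiagonal.mem_antidiagonal] at hp
    rw [hexp (by omega)]
  -- the odd part of an exponential
  have hodd : ∀ (j : Fin N) (s : ℂ), coeff (2 * (j : ℕ) + 1)
      (taylor fun κ => (Complex.cosh κ + 1) * Complex.sinh (theta a x y t κ)
        + s * Complex.sinh κ * Complex.cosh (theta a x y t κ))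
      = coeff (2 * (j : ℕ) + 1) ((coshS + 1 + C s * sinhS) * expSeries (xMinus A 0 x y t)) := by
    intro j s
    have hch : AnalyticAt ℂ (fun κ => Complex.cosh (theta a x y t κ)) 0 :=
      (analyticAt_cosh _).fun_comp hth
    have hsh : AnalyticAt ℂ (fun κ => Complex.sinh (theta a x y t κ)) 0 :=
      (analyticAt_sinh _).fun_comp hth
    have hc1 : AnalyticAt ℂ (fun κ => Complex.cosh κ + 1) 0 :=
      (analyticAt_cosh 0).fun_add analyticAt_const
    have hs1 : AnalyticAt ℂ (fun κ => s * Complex.sinh κ) 0 :=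
      analyticAt_const.fun_mul (analyticAt_sinh 0)
    have e1 : coshS + 1 + C s * sinhS
        = taylor (fun κ => (Complex.cosh κ + 1) + s * Complex.sinh κ) := by
      rw [taylor_add hc1 hs1, taylor_add (analyticAt_cosh 0) analyticAt_const, taylor_const,
        taylor_const_mul _ (analyticAt_sinh 0), map_one, coshS, sinhS]
    rw [← hmulE, e1, ← taylor_mul (hc1.fun_add hs1) hE]
    have e2 : (fun κ => ((Complex.cosh κ + 1) + s * Complex.sinh κ)
        * Complex.exp (theta a x y t κ))
        = fun κ => ((Complex.cosh κ + 1) * Complex.sinh (theta a x y t κ)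
          + s * Complex.sinh κ * Complex.cosh (theta a x y t κ))
          + ((Complex.cosh κ + 1) * Complex.cosh (theta a x y t κ)
          + s * Complex.sinh κ * Complex.sinh (theta a x y t κ)) := by
      funext κ
      rw [← Complex.cosh_add_sinh (theta a x y t κ)]
      ring
    rw [e2, taylor_add ((hc1.fun_mul hsh).fun_add (hs1.fun_mul hch))
      ((hc1.fun_mul hch).fun_add (hs1.fun_mul hsh)), map_add,
      coeff_taylor_of_even (f := fun κ => (Complex.cosh κ + 1) * Complex.cosh (theta a x y t κ)
          + s * Complex.sinh κ * Complex.sinh (theta a x y t κ)) _ ⟨j, rfl⟩, add_zero]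
    intro κ
    simp only [theta_neg, Complex.cosh_neg, Complex.sinh_neg]
    ring
  have hη : AnalyticAt ℂ (fun κ => -Complex.I * (Complex.cosh κ - 1)) 0 :=
    analyticAt_const.fun_mul ((analyticAt_cosh 0).fun_sub analyticAt_const)
  have hcomp : ∀ (c : Fin 2) (j : Fin N), (matY N a x y t * kappaBasis N) c j
      = coeff (2 * (j : ℕ) + 1)
        (taylor fun κ => Complex.sinh κ * phi a (-Complex.I * Complex.cosh κ) x y t c) := by
    intro c j
    set G : ℂ → ℂ := fun z => phi a (z + -Complex.I) x y t c with hG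
    have hGan : AnalyticAt ℂ G 0 := by
      refine AnalyticAt.comp (g := fun lam => phi a lam x y t c) (f := fun z => z + -Complex.I)
        ?_ (by fun_prop)
      simpa using analyticAt_phi ha.analytic x y t c
    have hcG : ∀ l, coeff l (taylor G) = phiCoeff a l x y t c := by
      intro l
      rw [coeff_taylor, hG, phiCoeff,
        iteratedDeriv_comp_add_const l (fun lam => phi a lam x y t c) (-Complex.I)]
      simp
    obtain ⟨R, hR⟩ := taylor_comp hη (by simp) N hGan
    have e3 : (fun κ => G (-Complex.I * (Complex.cosh κ - 1)))
        = fun κ => phi a (-Complex.I * Complex.cosh κ) x y t c := by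
      funext κ
      simp only [hG]
      congr 1
      ring
    rw [e3, taylor_eta] at hR
    rw [taylor_mul (analyticAt_sinh 0)
      (analyticAt_comp_cosh (analyticAt_phi ha.analytic x y t c)), hR, mul_add, map_add,
      ← sinhS, coeff_sinhS_mul_etaS_pow_mul R (show 2 * (j : ℕ) + 1 < 2 * N + 1 by omega), add_zero,
      Finset.mul_sum, map_sum, Matrix.mul_apply,
      Finset.sum_range fun l => coeff (2 * (j : ℕ) + 1)
        (sinhS * (C (coeff l (taylor G)) * etaS ^ l))]
    refine Finset.sum_congr rfl fun l _ => ?_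
    rw [mul_left_comm, coeff_C_mul, hcG]
    rfl
  have hos : ∀ s : ℂ, AnalyticAt ℂ (fun κ => (Complex.cosh κ + 1) * Complex.sinh (theta a x y t κ)
      + s * Complex.sinh κ * Complex.cosh (theta a x y t κ)) 0 := fun s =>
    (((analyticAt_cosh 0).fun_add analyticAt_const).fun_mul
      ((analyticAt_sinh _).fun_comp hth)).fun_add
      ((analyticAt_const.fun_mul (analyticAt_sinh 0)).fun_mul ((analyticAt_cosh _).fun_comp hth))
  ext c j
  rw [hcomp]
  fin_cases c
  · have e4 := hodd j 1
    simp only [Fin.zero_eta, sinh_mul_phi_zero, oddCoeffs, Matrix.of_apply, Matrix.cons_val_zero]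
    have e5 := taylor_const_mul (Complex.exp (-(Complex.I * y))) (hos 1)
    simp only [one_mul, map_one] at e4 e5
    rw [e5, coeff_C_mul, e4]
  · have e4 := hodd j (-1)
    simp only [Fin.mk_one, sinh_mul_phi_one, oddCoeffs, Matrix.of_apply,
      Matrix.cons_val_one, Matrix.cons_val_zero]
    have e5 := taylor_const_mul (Complex.I * Complex.exp (Complex.I * y)) (hos (-1))
    simp only [map_neg, map_one, neg_mul, ← sub_eq_add_neg, one_mul] at e4 e5
    rw [e5, coeff_C_mul, e4]

/-- Every choice of parameters comes from a phase, which may be taken polynomial in `λ + i`. -/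
lemma exists_isPhase {N : ℕ} (A : Fin (N - 1) → ℂ) : ∃ a : ℂ → ℂ, IsPhase A a := by
  set target : Fin N → ℂ := fun j => (starRingEnd ℂ) (aParam A (2 * (j : ℕ) + 1)) with htarget
  set α : Fin N → ℂ := Matrix.vecMul target (kappaBasis N)⁻¹ with hα
  have hu : IsUnit (kappaBasis N).det := isUnit_iff_ne_zero.2 (det_kappaBasis_ne_zero N)
  have hαB : Matrix.vecMul α (kappaBasis N) = target := by
    rw [hα, Matrix.vecMul_vecMul, Matrix.nonsing_inv_mul _ hu, Matrix.vecMul_one]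
  set a : ℂ → ℂ := fun lam => ∑ l : Fin N, α l * (lam + Complex.I) ^ (l : ℕ) with ha
  have han : AnalyticAt ℂ a (-Complex.I) := by
    rw [ha]; fun_prop
  have hη : AnalyticAt ℂ (fun κ => -Complex.I * (Complex.cosh κ - 1)) 0 :=
    analyticAt_const.fun_mul ((analyticAt_cosh 0).fun_sub analyticAt_const)
  have hodd : ∀ j : Fin N, aHat a (2 * (j : ℕ) + 1) = target j := by
    intro j
    have e1 : taylor (fun κ => Complex.sinh κ * a (-Complex.I * Complex.cosh κ))
        = ∑ l : Fin N, C (α l) * (sinhS * etaS ^ (l : ℕ)) := by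
      rw [taylor_mul (analyticAt_sinh 0) (analyticAt_comp_cosh han), ← sinhS]
      have e2 : (fun κ => a (-Complex.I * Complex.cosh κ))
          = fun κ => ∑ l : Fin N, α l * (-Complex.I * (Complex.cosh κ - 1)) ^ (l : ℕ) := by
        funext κ
        simp only [ha]
        refine Finset.sum_congr rfl fun l _ => ?_
        congr 2
        ring
      have e3 : ∀ s : Finset (Fin N),
          taylor (fun κ => ∑ l ∈ s, α l * (-Complex.I * (Complex.cosh κ - 1)) ^ (l : ℕ))
            = ∑ l ∈ s, C (α l) * etaS ^ (l : ℕ) := by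
        intro s
        induction s using Finset.induction_on with
        | empty => simpa using taylor_const 0
        | insert b s hb ih =>
          simp only [Finset.sum_insert hb]
          rw [taylor_add, taylor_const_mul, taylor_pow, taylor_eta, ih]
          · exact hη
          · exact hη.fun_pow _
          · exact analyticAt_const.fun_mul (hη.fun_pow _)
          · exact Finset.analyticAt_fun_sum s fun l _ => analyticAt_const.fun_mul (hη.fun_pow _)
      rw [e2, e3, Finset.mul_sum]
      exact Finset.sum_congr rfl fun l _ => by ring
    rw [aHat_of_odd han ⟨j, rfl⟩, e1, map_sum, ← hαB]
    exact Finset.sum_congr rfl fun l _ => by rw [coeff_C_mul]; rfl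
  refine ⟨a, han, ?_, fun k => ?_⟩
  · rcases Nat.eq_zero_or_pos N with hN | hN
    · subst hN
      have : a = fun _ => 0 := by funext z; simp [ha]
      have h2 : aHat a 1 = 0 := by
        rw [aHat, this]; simp
      exact h2
    · have h := hodd ⟨0, hN⟩
      simp only [mul_zero, zero_add] at h
      rw [h, htarget]
      simp only [aParam]
      rw [Finset.sum_eq_zero, map_zero]
      intro b _
      rw [if_neg (by omega)]
  · have h := hodd ⟨k + 1, by omega⟩
    have e : 2 * ((k : ℕ) + 1) + 1 = 2 * (k : ℕ) + 3 := by ring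
    simp only [e, htarget] at h
    rw [h, Complex.conj_conj, aParam, Finset.sum_eq_single_of_mem k (Finset.mem_univ _)]
    · rw [if_pos rfl]
    · intro b _ hb
      rw [if_neg]
      intro h
      exact hb (Fin.ext (by omega))

end KPLump

namespace KPLump

open Matrix

/-! ### Entrywise differentiation of matrices -/

section MatrixCalculus

variable {m n p : Type*}

/-- Entrywise derivative of a path of matrices. -/
def HasMDerivAt (F : ℝ → Matrix m n ℂ) (F' : Matrix m n ℂ) (s : ℝ) : Prop :=
  ∀ i j, HasDerivAt (fun s => F s i j) (F' i j) s

lemma HasMDerivAt.mul [Fintype n] {F : ℝ → Matrix m n ℂ} {G : ℝ → Matrix n p ℂ}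
    {F' : Matrix m n ℂ} {G' : Matrix n p ℂ} {s : ℝ} (hF : HasMDerivAt F F' s)
    (hG : HasMDerivAt G G' s) : HasMDerivAt (fun s => F s * G s) (F' * G s + F s * G') s := by
  intro i j
  have h : HasDerivAt (fun s => ∑ k, F s i k * G s k j)
      (∑ k, (F' i k * G s k j + F s i k * G' k j)) s :=
    HasDerivAt.fun_sum fun k _ => (hF i k).mul (hG k j)
  refine h.congr_deriv ?_
  rw [Finset.sum_add_distrib, Matrix.add_apply, Matrix.mul_apply, Matrix.mul_apply]

lemma HasMDerivAt.add {F G : ℝ → Matrix m n ℂ} {F' G' : Matrix m n ℂ} {s : ℝ}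
    (hF : HasMDerivAt F F' s) (hG : HasMDerivAt G G' s) :
    HasMDerivAt (fun s => F s + G s) (F' + G') s := fun i j => (hF i j).add (hG i j)

lemma HasMDerivAt.sub {F G : ℝ → Matrix m n ℂ} {F' G' : Matrix m n ℂ} {s : ℝ}
    (hF : HasMDerivAt F F' s) (hG : HasMDerivAt G G' s) :
    HasMDerivAt (fun s => F s - G s) (F' - G') s := fun i j => (hF i j).sub (hG i j)

lemma hasMDerivAt_const (F : Matrix m n ℂ) (s : ℝ) : HasMDerivAt (fun _ => F) 0 s :=
  fun i j => hasDerivAt_const s (F i j)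

lemma HasMDerivAt.mul_const [Fintype n] {F : ℝ → Matrix m n ℂ} {F' : Matrix m n ℂ} {s : ℝ}
    (hF : HasMDerivAt F F' s) (G : Matrix n p ℂ) :
    HasMDerivAt (fun s => F s * G) (F' * G) s := by
  simpa using hF.mul (hasMDerivAt_const G s)

lemma HasMDerivAt.const_mul [Fintype n] {F : ℝ → Matrix n p ℂ} {F' : Matrix n p ℂ} {s : ℝ}
    (G : Matrix m n ℂ) (hF : HasMDerivAt F F' s) :
    HasMDerivAt (fun s => G * F s) (G * F') s := by
  simpa using (hasMDerivAt_const G s).mul hF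

lemma HasMDerivAt.conjTranspose {F : ℝ → Matrix m n ℂ} {F' : Matrix m n ℂ} {s : ℝ}
    (hF : HasMDerivAt F F' s) : HasMDerivAt (fun s => (F s)ᴴ) F'ᴴ s :=
  fun i j => (hF j i).star

lemma HasMDerivAt.unique {F : ℝ → Matrix m n ℂ} {F' F'' : Matrix m n ℂ} {s : ℝ}
    (h : HasMDerivAt F F' s) (h' : HasMDerivAt F F'' s) : F' = F'' :=
  Matrix.ext fun i j => (h i j).unique (h' i j)

lemma HasMDerivAt.congr_deriv {F : ℝ → Matrix m n ℂ} {F' F'' : Matrix m n ℂ} {s : ℝ}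
    (h : HasMDerivAt F F' s) (h' : F' = F'') : HasMDerivAt F F'' s := h' ▸ h

variable {E : Type*} [NormedAddCommGroup E] [NormedSpace ℝ E]

lemma contDiff_matrix_mul [Fintype n] {F : E → Matrix m n ℂ} {G : E → Matrix n p ℂ}
    (hF : ∀ i j, ContDiff ℝ ∞ fun e => F e i j) (hG : ∀ i j, ContDiff ℝ ∞ fun e => G e i j) :
    ∀ i j, ContDiff ℝ ∞ fun e => (F e * G e) i j := by
  intro i j
  simp only [Matrix.mul_apply]
  exact ContDiff.sum fun k _ => (hF i k).mul (hG k j)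

lemma contDiff_conj {f : E → ℂ} (hf : ContDiff ℝ ∞ f) :
    ContDiff ℝ ∞ fun e => (starRingEnd ℂ) (f e) :=
  Complex.conjCLE.contDiff.comp hf

variable [Fintype n] [DecidableEq n]

lemma contDiff_det {M : E → Matrix n n ℂ} (hM : ∀ i j, ContDiff ℝ ∞ fun e => M e i j) :
    ContDiff ℝ ∞ fun e => (M e).det := by
  simp only [Matrix.det_apply, zsmul_eq_mul, Units.smul_def]
  exact ContDiff.sum fun σ _ => contDiff_const.mul (contDiff_prod fun i _ => hM _ _)

lemma contDiff_matrix_inv {M : E → Matrix n n ℂ} (hM : ∀ i j, ContDiff ℝ ∞ fun e => M e i j)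
    (hd : ∀ e, (M e).det ≠ 0) : ∀ i j, ContDiff ℝ ∞ fun e => (M e)⁻¹ i j := by
  intro i j
  have h : (fun e => (M e)⁻¹ i j) = fun e => ((M e).det)⁻¹ * (M e).adjugate i j := by
    funext e
    rw [Matrix.inv_def, Matrix.smul_apply, smul_eq_mul, Ring.inverse_eq_inv']
  rw [h]
  refine ((contDiff_det hM).inv hd).mul ?_
  simp only [Matrix.adjugate_apply]
  refine contDiff_det fun k l => ?_
  by_cases hk : k = j
  · subst hk
    simp only [Matrix.updateRow_self]
    exact contDiff_const
  · simp only [Matrix.updateRow_ne hk]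
    exact hM k l

lemma hasMDerivAt_of_contDiff {M : ℝ → Matrix m p ℂ}
    (hM : ∀ i j, ContDiff ℝ ∞ fun e => M e i j) (s : ℝ) : ∃ M', HasMDerivAt M M' s :=
  ⟨Matrix.of fun i j => deriv (fun e => M e i j) s,
    fun i j => ((hM i j).differentiable (by simp) s).hasDerivAt⟩

lemma HasMDerivAt.inv {M : ℝ → Matrix n n ℂ} {M' : Matrix n n ℂ} {s : ℝ}
    (hM : ∀ i j, ContDiff ℝ ∞ fun e => M e i j) (hd : ∀ e, (M e).det ≠ 0)
    (h : HasMDerivAt M M' s) :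
    HasMDerivAt (fun s => (M s)⁻¹) (-((M s)⁻¹ * M' * (M s)⁻¹)) s := by
  obtain ⟨P', hP⟩ := hasMDerivAt_of_contDiff (contDiff_matrix_inv hM hd) s
  have hu : ∀ e, IsUnit (M e).det := fun e => isUnit_iff_ne_zero.2 (hd e)
  have h1 : HasMDerivAt (fun _ : ℝ => (1 : Matrix n n ℂ)) (P' * M s + (M s)⁻¹ * M') s := by
    have := hP.mul h
    simpa only [Matrix.nonsing_inv_mul _ (hu _)] using this
  have h2 := h1.unique (hasMDerivAt_const 1 s)
  refine hP.congr_deriv ?_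
  have h3 := congrArg (fun Z => Z * (M s)⁻¹) h2
  simp only [Matrix.add_mul, Matrix.zero_mul] at h3
  rw [Matrix.mul_assoc P', Matrix.mul_nonsing_inv _ (hu s), Matrix.mul_one] at h3
  exact eq_neg_of_add_eq_zero_left h3

end MatrixCalculus

/-! ### Dressing -/

section Dressing

variable {N : ℕ}

/-- The spectra of `Λ` and `Λ†` are disjoint, so the Sylvester operator `Z ↦ Λ† Z - Z Λ` is
injective. -/
lemma sylvester_injective {Z : Matrix (Fin N) (Fin N) ℂ}
    (h : (jordan N)ᴴ * Z - Z * jordan N = 0) : Z = 0 := by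
  have key : ∀ s : ℕ, ∀ j k : Fin N, (j : ℕ) + k = s → Z j k = 0 := by
    intro s
    induction s using Nat.strong_induction_on with
    | _ s ih =>
      intro j k hs
      have h1 := congrFun (congrFun h j) k
      rw [Matrix.sub_apply, Matrix.mul_apply, Matrix.mul_apply, Matrix.zero_apply] at h1
      have e1 : ∑ l, (jordan N)ᴴ j l * Z l k = Complex.I * Z j k := by
        rw [Finset.sum_eq_single_of_mem j (Finset.mem_univ _)]
        · simp [jordan]
        · intro l _ hl
          by_cases hlj : (l : ℕ) + 1 = j
          · rw [ih ((l : ℕ) + k) (by omega) l k rfl, mul_zero]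
          · simp [jordan, hl, hlj]
      have e2 : ∑ l, Z j l * jordan N l k = -Complex.I * Z j k := by
        rw [Finset.sum_eq_single_of_mem k (Finset.mem_univ _)]
        · simp [jordan, mul_comm]
        · intro l _ hl
          by_cases hlk : (l : ℕ) + 1 = k
          · rw [ih ((j : ℕ) + l) (by omega) j l rfl, zero_mul]
          · simp [jordan, hl, hlk]
      rw [e1, e2] at h1
      have h2 : Complex.I * Z j k = 0 := by linear_combination h1 / 2
      exact (mul_eq_zero.1 h2).resolve_left Complex.I_ne_zero
  ext j k
  exact key _ j k rfl

lemma sylvester_unique {Z Z' R : Matrix (Fin N) (Fin N) ℂ}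
    (h : (jordan N)ᴴ * Z - Z * jordan N = R) (h' : (jordan N)ᴴ * Z' - Z' * jordan N = R) :
    Z = Z' := by
  rw [← sub_eq_zero]
  refine sylvester_injective ?_
  rw [Matrix.mul_sub, Matrix.sub_mul, ← sub_eq_zero_of_eq (h.trans h'.symm)]
  abel

/-- A solution of `Λ† M - M Λ = Y† Y` is anti-Hermitian. -/
lemma conjTranspose_of_sylvester {Y : Matrix (Fin 2) (Fin N) ℂ} {M : Matrix (Fin N) (Fin N) ℂ}
    (h : (jordan N)ᴴ * M - M * jordan N = Yᴴ * Y) : Mᴴ = -M := by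
  refine sylvester_unique (R := -(Yᴴ * Y)) ?_ ?_
  · have h1 := congrArg Matrix.conjTranspose h
    simp only [Matrix.conjTranspose_sub, Matrix.conjTranspose_mul,
      Matrix.conjTranspose_conjTranspose] at h1
    rw [← h1]
    abel
  · rw [← h, Matrix.mul_neg, Matrix.neg_mul]
    abel

open scoped ComplexOrder in
/-- The kernel of a solution `M` of the Sylvester equation is `Λ`-invariant and contained in the
kernel of `Y`; an eigenvector of the Jordan block is excluded if the first column of `Y` does not
vanish. -/
lemma det_ne_zero_of_sylvester {Y : Matrix (Fin 2) (Fin N) ℂ} {M : Matrix (Fin N) (Fin N) ℂ}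
    (h : (jordan N)ᴴ * M - M * jordan N = Yᴴ * Y)
    (hY : ∀ l : Fin N, (l : ℕ) = 0 → ∃ c, Y c l ≠ 0) : M.det ≠ 0 := by
  have hker : ∀ v, M *ᵥ v = 0 → Y *ᵥ v = 0 ∧ M *ᵥ (jordan N *ᵥ v) = 0 := by
    intro v hv
    have h1 := congrArg (fun Z => star v ⬝ᵥ (Z *ᵥ v)) h
    have hv2 : star v ᵥ* M = 0 := by
      have h2 := congrArg star hv
      rw [Matrix.star_mulVec, conjTranspose_of_sylvester h, Matrix.vecMul_neg, star_zero] at h2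
      exact neg_eq_zero.1 h2
    have hYv : Y *ᵥ v = 0 := by
      simp only [Matrix.sub_mulVec, ← Matrix.mulVec_mulVec, hv, Matrix.mulVec_zero, zero_sub,
        dotProduct_neg] at h1
      rw [Matrix.dotProduct_mulVec, hv2, zero_dotProduct, neg_zero, Matrix.dotProduct_mulVec,
        ← Matrix.star_mulVec] at h1
      exact dotProduct_star_self_eq_zero.1 h1.symm
    refine ⟨hYv, ?_⟩
    have h3 := congrArg (fun Z => Z *ᵥ v) h
    simp only [Matrix.sub_mulVec, ← Matrix.mulVec_mulVec, hv, hYv, Matrix.mulVec_zero, zero_sub,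
      neg_eq_zero] at h3
    exact h3
  have hsupp : ∀ k : ℕ, ∀ v : Fin N → ℂ, M *ᵥ v = 0 → (∀ l : Fin N, k ≤ l → v l = 0) → v = 0 := by
    intro k
    induction k with
    | zero => intro v _ h0; funext l; exact h0 l (Nat.zero_le _)
    | succ k ih =>
      intro v hv h0
      set v' : ℕ → ℂ := fun l => if hl : l < N then v ⟨l, hl⟩ else 0 with hv'
      have hvv : ∀ l : Fin N, v' l = v l := fun l => by simp [hv']
      have hsh : ∀ l : Fin N, (jordan N *ᵥ v + Complex.I • v) l = v' (l + 1) := by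
        intro l
        have := sum_jordan_mul v' (by simp [hv']) l
        simp only [hvv] at this
        rw [Pi.add_apply, Pi.smul_apply, smul_eq_mul, Matrix.mulVec, dotProduct, this]
        ring
      have h1 : jordan N *ᵥ v + Complex.I • v = 0 := by
        refine ih _ ?_ ?_
        · rw [Matrix.mulVec_add, Matrix.mulVec_smul, (hker v hv).2, hv, smul_zero, add_zero]
        · intro l hl
          rw [hsh l]
          by_cases hl2 : (l : ℕ) + 1 < N
          · have := h0 ⟨l + 1, hl2⟩ (by simpa using hl)
            simpa [hv', hl2] using this
          · simp [hv', hl2]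
      have h2 : ∀ l : Fin N, (l : ℕ) ≠ 0 → v l = 0 := by
        intro l hl
        have h3 := hsh ⟨l - 1, by omega⟩
        rw [h1] at h3
        simp only [Pi.zero_apply] at h3
        rw [Nat.sub_add_cancel (Nat.one_le_iff_ne_zero.2 hl), hvv] at h3
        exact h3.symm
      funext l
      by_cases hl : (l : ℕ) = 0
      · obtain ⟨c, hc⟩ := hY l hl
        have h4 := congrFun (hker v hv).1 c
        rw [Matrix.mulVec, dotProduct, Finset.sum_eq_single_of_mem l (Finset.mem_univ _)] at h4
        · exact (mul_eq_zero.1 h4).resolve_left hc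
        · intro b _ hb
          rw [h2 b fun h => hb (Fin.ext (h.trans hl.symm)), mul_zero]
      · exact h2 l hl
  intro hdet
  obtain ⟨v, hv0, hv⟩ := Matrix.exists_mulVec_eq_zero_iff.2 hdet
  exact hv0 (hsupp N v hv fun l hl => absurd l.2 (by omega))

/-- The matrices `Y M⁻¹ B Y†`. For `B = (λ - Λ†)⁻¹` this is `T - 1`, and for `B = (Λ†)^k` it is the
coefficient of `λ^{-k-1}` in the expansion of `T` at infinity. -/
def dressG (Y : Matrix (Fin 2) (Fin N) ℂ) (M B : Matrix (Fin N) (Fin N) ℂ) :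
    Matrix (Fin 2) (Fin 2) ℂ := Y * M⁻¹ * B * Yᴴ

/-- The coefficient of `λ²` in the polynomial part of `T L T⁻¹`, where
`L = L₀ + λ L₁ + λ² L₂ + λ³ L₃` and `T = 1 + G₀ / λ + G₁ / λ² + ⋯`. -/
def dressL2 (G0 L2 L3 : Matrix (Fin 2) (Fin 2) ℂ) : Matrix (Fin 2) (Fin 2) ℂ :=
  L2 + (G0 * L3 - L3 * G0)

/-- The coefficient of `λ` in the polynomial part of `T L T⁻¹`. -/
def dressL1 (G0 G1 L1 L2 L3 : Matrix (Fin 2) (Fin 2) ℂ) : Matrix (Fin 2) (Fin 2) ℂ :=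
  L1 + (G0 * L2 - dressL2 G0 L2 L3 * G0) + (G1 * L3 - L3 * G1)

/-- The constant coefficient of the polynomial part of `T L T⁻¹`. -/
def dressL0 (G0 G1 G2 L0 L1 L2 L3 : Matrix (Fin 2) (Fin 2) ℂ) : Matrix (Fin 2) (Fin 2) ℂ :=
  L0 + (G0 * L1 - dressL1 G0 G1 L1 L2 L3 * G0) + (G1 * L2 - dressL2 G0 L2 L3 * G1)
    + (G2 * L3 - L3 * G2)

/-- The derivative of `G_B = Y M⁻¹ B Y†` along the flow with coefficients `L_m`, where `F_m` stands
for `G_{(Λ†)^m B}` and `G_m` for `G_{(Λ†)^m}`. -/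
def dressDeriv (L0 L1 L2 L3 G0 G1 G2 F0 F1 F2 F3 : Matrix (Fin 2) (Fin 2) ℂ) :
    Matrix (Fin 2) (Fin 2) ℂ :=
  (dressL0 G0 G1 G2 L0 L1 L2 L3 * F0 - F0 * L0)
    + (dressL1 G0 G1 L1 L2 L3 * F1 - F1 * L1)
    + (dressL2 G0 L2 L3 * F2 - F2 * L2) + (L3 * F3 - F3 * L3)

variable {Y : ℝ → Matrix (Fin 2) (Fin N) ℂ} {M : ℝ → Matrix (Fin N) (Fin N) ℂ} {s : ℝ}
  {L0 L1 L2 L3 : Matrix (Fin 2) (Fin 2) ℂ}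

lemma hasMDerivAt_of_sylvester
    (hM : ∀ i j, ContDiff ℝ ∞ fun e => M e i j)
    (hS : ∀ e, (jordan N)ᴴ * M e - M e * jordan N = (Y e)ᴴ * Y e)
    (h0 : L0ᴴ = -L0) (h1 : L1ᴴ = -L1) (h2 : L2ᴴ = -L2) (h3 : L3ᴴ = -L3)
    (hY : HasMDerivAt Y (L0 * Y s + L1 * Y s * jordan N + L2 * Y s * jordan N * jordan N
      + L3 * Y s * jordan N * jordan N * jordan N) s) :
    HasMDerivAt M (-((Y s)ᴴ * L1 * Y s
      + ((jordan N)ᴴ * ((Y s)ᴴ * L2 * Y s) + (Y s)ᴴ * L2 * Y s * jordan N)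
      + ((jordan N)ᴴ * (jordan N)ᴴ * ((Y s)ᴴ * L3 * Y s)
        + (jordan N)ᴴ * ((Y s)ᴴ * L3 * Y s) * jordan N
        + (Y s)ᴴ * L3 * Y s * jordan N * jordan N))) s := by
  obtain ⟨M', hM'⟩ := hasMDerivAt_of_contDiff hM s
  refine hM'.congr_deriv ?_
  have e1 := (hM'.const_mul (jordan N)ᴴ).sub (hM'.mul_const (jordan N))
  simp only [hS] at e1
  have e2 := e1.unique (hY.conjTranspose.mul hY)
  refine sylvester_unique e2 ?_
  simp only [Matrix.conjTranspose_add, Matrix.conjTranspose_mul, h0, h1, h2, h3]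
  simp only [Matrix.mul_add, Matrix.add_mul, Matrix.mul_neg, Matrix.neg_mul, ← Matrix.mul_assoc]
  abel

/-- Differentiation of `Y M⁻¹ B Y†` along a flow of the linear system: if
`Y' = ∑ L_m Y Λ^m` with anti-Hermitian `L_m`, then the result is again of this form, with the
dressed coefficients. -/
lemma hasMDerivAt_dressG
    (hM : ∀ i j, ContDiff ℝ ∞ fun e => M e i j) (hd : ∀ e, (M e).det ≠ 0)
    (hS : ∀ e, (jordan N)ᴴ * M e - M e * jordan N = (Y e)ᴴ * Y e)
    (h0 : L0ᴴ = -L0) (h1 : L1ᴴ = -L1) (h2 : L2ᴴ = -L2) (h3 : L3ᴴ = -L3)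
    (hY : HasMDerivAt Y (L0 * Y s + L1 * Y s * jordan N + L2 * Y s * jordan N * jordan N
      + L3 * Y s * jordan N * jordan N * jordan N) s)
    {K B : Matrix (Fin N) (Fin N) ℂ} (hK : K = (jordan N)ᴴ) (hB : B * K = K * B)
    {G : ℕ → Matrix (Fin 2) (Fin 2) ℂ} (hG : ∀ k, G k = dressG (Y s) (M s) (K ^ k)) :
    HasMDerivAt (fun s => dressG (Y s) (M s) B)
      (dressDeriv L0 L1 L2 L3 (G 0) (G 1) (G 2) (dressG (Y s) (M s) B)
        (dressG (Y s) (M s) (K * B)) (dressG (Y s) (M s) (K * (K * B)))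
        (dressG (Y s) (M s) (K * (K * (K * B))))) s := by
  have hM' := hasMDerivAt_of_sylvester hM hS h0 h1 h2 h3 hY
  have hu : IsUnit (M s).det := isUnit_iff_ne_zero.2 (hd s)
  have hmain := ((hY.mul (hM'.inv hM hd)).mul_const B).mul hY.conjTranspose
  refine hmain.congr_deriv ?_
  -- the Sylvester equation, multiplied by `M⁻¹` on both sides
  have hR : jordan N * (M s)⁻¹ = (M s)⁻¹ * K - (M s)⁻¹ * (Y s)ᴴ * Y s * (M s)⁻¹ := by
    have e1 := congrArg (fun Z => (M s)⁻¹ * Z * (M s)⁻¹) (hS s)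
    simp only [Matrix.mul_sub, Matrix.sub_mul] at e1
    rw [Matrix.mul_assoc (M s)⁻¹ _ (M s)⁻¹, Matrix.mul_assoc _ (M s) (M s)⁻¹,
      Matrix.mul_nonsing_inv _ hu, Matrix.mul_one, ← Matrix.mul_assoc (M s)⁻¹ (M s),
      Matrix.nonsing_inv_mul _ hu, Matrix.one_mul, ← Matrix.mul_assoc (M s)⁻¹ (Y s)ᴴ] at e1
    rw [← e1, hK]
    abel
  have hR' : ∀ Z : Matrix (Fin 2) (Fin N) ℂ, Z * jordan N * (M s)⁻¹
      = Z * (M s)⁻¹ * K - Z * (M s)⁻¹ * (Y s)ᴴ * Y s * (M s)⁻¹ := by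
    intro Z
    rw [Matrix.mul_assoc Z, hR, Matrix.mul_sub]
    simp only [Matrix.mul_assoc]
  have hB' : ∀ Z : Matrix (Fin 2) (Fin N) ℂ, Z * B * K = Z * K * B := by
    intro Z
    rw [Matrix.mul_assoc, hB, Matrix.mul_assoc]
  simp only [Matrix.conjTranspose_add, Matrix.conjTranspose_mul, h0, h1, h2, h3, ← hK]
  simp only [hG, dressG, dressDeriv, dressL0, dressL1, dressL2, pow_zero, pow_one, pow_two,
    Matrix.mul_one]
  simp only [Matrix.mul_add, Matrix.add_mul, Matrix.sub_mul, Matrix.mul_neg,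
    Matrix.neg_mul, ← Matrix.mul_assoc, hR', hB']
  abel

/-- The Darboux equation for `T = 1 + F`, `F = Y M⁻¹ (λ - Λ†)⁻¹ Y†`: since
`Λ† (λ - Λ†)⁻¹ = λ (λ - Λ†)⁻¹ - 1`, it follows from the derivative of `F`. -/
lemma darboux_equation (lam : ℂ) (G0 G1 G2 F : Matrix (Fin 2) (Fin 2) ℂ) :
    dressDeriv L0 L1 L2 L3 G0 G1 G2 F (lam • F - G0) (lam • (lam • F - G0) - G1)
        (lam • (lam • (lam • F - G0) - G1) - G2)
      + (1 + F) * (L0 + lam • L1 + lam ^ 2 • L2 + lam ^ 3 • L3)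
      = (dressL0 G0 G1 G2 L0 L1 L2 L3 + lam • dressL1 G0 G1 L1 L2 L3
        + lam ^ 2 • dressL2 G0 L2 L3 + lam ^ 3 • L3) * (1 + F) := by
  simp only [dressDeriv, dressL0, dressL1, dressL2]
  simp only [Matrix.mul_add, Matrix.add_mul, Matrix.mul_sub, Matrix.sub_mul, Matrix.smul_mul,
    Matrix.mul_smul, smul_add, smul_sub, Matrix.mul_one, Matrix.one_mul, Matrix.mul_assoc]
  module

end Dressing

end KPLump

namespace KPLump

/-! ### Partial derivatives of smooth fields -/

section Fields

variable {E : Type*} [NormedAddCommGroup E] [NormedSpace ℝ E] {f : ℝ → ℝ → ℝ → E}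

/-- Chain rule for a field along a path in `ℝ³`. -/
lemma Smooth3.hasDerivAt_comp (hf : Smooth3 f) {γ : ℝ → ℝ × ℝ × ℝ} {γ' : ℝ × ℝ × ℝ} {s : ℝ}
    (hγ : HasDerivAt γ γ' s) :
    HasDerivAt (fun s => f (γ s).1 (γ s).2.1 (γ s).2.2)
      (fderiv ℝ (fun p : ℝ × ℝ × ℝ => f p.1 p.2.1 p.2.2) (γ s) γ') s :=
  ((ContDiff.differentiable hf (by simp)) (γ s)).hasFDerivAt.comp_hasDerivAt s hγ

lemma Smooth3.pdx_eq (hf : Smooth3 f) (x y t : ℝ) :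
    pdx f x y t = fderiv ℝ (fun p : ℝ × ℝ × ℝ => f p.1 p.2.1 p.2.2) (x, y, t) (1, 0, 0) :=
  (hf.hasDerivAt_comp ((hasDerivAt_id x).prodMk
    ((hasDerivAt_const x y).prodMk (hasDerivAt_const x t)))).deriv

lemma Smooth3.pdy_eq (hf : Smooth3 f) (x y t : ℝ) :
    pdy f x y t = fderiv ℝ (fun p : ℝ × ℝ × ℝ => f p.1 p.2.1 p.2.2) (x, y, t) (0, 1, 0) :=
  (hf.hasDerivAt_comp ((hasDerivAt_const y x).prodMk
    ((hasDerivAt_id y).prodMk (hasDerivAt_const y t)))).deriv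

lemma Smooth3.pdt_eq (hf : Smooth3 f) (x y t : ℝ) :
    pdt f x y t = fderiv ℝ (fun p : ℝ × ℝ × ℝ => f p.1 p.2.1 p.2.2) (x, y, t) (0, 0, 1) :=
  (hf.hasDerivAt_comp ((hasDerivAt_const t x).prodMk
    ((hasDerivAt_const t y).prodMk (hasDerivAt_id t)))).deriv

lemma Smooth3.hasDerivAt_x (hf : Smooth3 f) (x y t : ℝ) :
    HasDerivAt (fun s => f s y t) (pdx f x y t) x :=
  (hf.hasDerivAt_comp ((hasDerivAt_id x).prodMk
    ((hasDerivAt_const x y).prodMk (hasDerivAt_const x t)))).differentiableAt.hasDerivAt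

lemma Smooth3.hasDerivAt_y (hf : Smooth3 f) (x y t : ℝ) :
    HasDerivAt (fun s => f x s t) (pdy f x y t) y :=
  (hf.hasDerivAt_comp ((hasDerivAt_const y x).prodMk
    ((hasDerivAt_id y).prodMk (hasDerivAt_const y t)))).differentiableAt.hasDerivAt

lemma Smooth3.hasDerivAt_t (hf : Smooth3 f) (x y t : ℝ) :
    HasDerivAt (fun s => f x y s) (pdt f x y t) t :=
  (hf.hasDerivAt_comp ((hasDerivAt_const t x).prodMk
    ((hasDerivAt_const t y).prodMk (hasDerivAt_id t)))).differentiableAt.hasDerivAt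

lemma contDiff_fderiv_apply {F : ℝ × ℝ × ℝ → E} (hF : ContDiff ℝ ∞ F) (v : ℝ × ℝ × ℝ) :
    ContDiff ℝ ∞ fun p => fderiv ℝ F p v :=
  (hF.fderiv_right (by simp)).clm_apply contDiff_const

lemma Smooth3.pdx (hf : Smooth3 f) : Smooth3 (pdx f) := by
  have h : (fun p : ℝ × ℝ × ℝ => KPLump.pdx f p.1 p.2.1 p.2.2)
      = fun p => fderiv ℝ (fun p : ℝ × ℝ × ℝ => f p.1 p.2.1 p.2.2) p (1, 0, 0) :=
    funext fun p => hf.pdx_eq p.1 p.2.1 p.2.2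
  rw [Smooth3, h]
  exact contDiff_fderiv_apply hf _

lemma Smooth3.pdy (hf : Smooth3 f) : Smooth3 (pdy f) := by
  have h : (fun p : ℝ × ℝ × ℝ => KPLump.pdy f p.1 p.2.1 p.2.2)
      = fun p => fderiv ℝ (fun p : ℝ × ℝ × ℝ => f p.1 p.2.1 p.2.2) p (0, 1, 0) :=
    funext fun p => hf.pdy_eq p.1 p.2.1 p.2.2
  rw [Smooth3, h]
  exact contDiff_fderiv_apply hf _

lemma Smooth3.pdt (hf : Smooth3 f) : Smooth3 (pdt f) := by
  have h : (fun p : ℝ × ℝ × ℝ => KPLump.pdt f p.1 p.2.1 p.2.2)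
      = fun p => fderiv ℝ (fun p : ℝ × ℝ × ℝ => f p.1 p.2.1 p.2.2) p (0, 0, 1) :=
    funext fun p => hf.pdt_eq p.1 p.2.1 p.2.2
  rw [Smooth3, h]
  exact contDiff_fderiv_apply hf _

lemma Smooth3.pdx_pdy (hf : Smooth3 f) (x y t : ℝ) :
    KPLump.pdx (KPLump.pdy f) x y t = KPLump.pdy (KPLump.pdx f) x y t := by
  set F : ℝ × ℝ × ℝ → E := fun p => f p.1 p.2.1 p.2.2 with hF
  have hFs : ContDiff ℝ ∞ F := hf
  have h1 : (fun p : ℝ × ℝ × ℝ => KPLump.pdy f p.1 p.2.1 p.2.2)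
      = fun p => fderiv ℝ F p (0, 1, 0) := funext fun p => hf.pdy_eq p.1 p.2.1 p.2.2
  have h2 : (fun p : ℝ × ℝ × ℝ => KPLump.pdx f p.1 p.2.1 p.2.2)
      = fun p => fderiv ℝ F p (1, 0, 0) := funext fun p => hf.pdx_eq p.1 p.2.1 p.2.2
  have hd : DifferentiableAt ℝ (fderiv ℝ F) (x, y, t) :=
    ((hFs.fderiv_right (m := ∞) (by simp)).differentiable (by simp)) _
  rw [hf.pdy.pdx_eq, hf.pdx.pdy_eq, h1, h2, fderiv_clm_apply hd (by fun_prop),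
    fderiv_clm_apply hd (by fun_prop)]
  have hsymm : IsSymmSndFDerivAt ℝ F (x, y, t) :=
    (hFs.contDiffAt).isSymmSndFDerivAt (by
      rw [minSmoothness_of_isRCLikeNormedField]
      exact ENat.LEInfty.out)
  simpa using hsymm.eq (1, 0, 0) (0, 1, 0)

lemma Smooth3.const (c : E) : Smooth3 fun _ _ _ => c := contDiff_const

lemma Smooth3.mul {f g : ℝ → ℝ → ℝ → ℂ} (hf : Smooth3 f) (hg : Smooth3 g) :
    Smooth3 fun x y t => f x y t * g x y t := ContDiff.mul hf hg

lemma Smooth3.sub {f g : ℝ → ℝ → ℝ → ℂ} (hf : Smooth3 f) (hg : Smooth3 g) :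
    Smooth3 fun x y t => f x y t - g x y t := ContDiff.sub hf hg

lemma pdx_ofReal {u : ℝ → ℝ → ℝ → ℝ} (hu : Smooth3 u) :
    (pdx fun x y t => (u x y t : ℂ)) = fun x y t => ((pdx u x y t : ℝ) : ℂ) := by
  funext x y t
  exact (hu.hasDerivAt_x x y t).ofReal_comp.deriv

lemma pdy_ofReal {u : ℝ → ℝ → ℝ → ℝ} (hu : Smooth3 u) :
    (pdy fun x y t => (u x y t : ℂ)) = fun x y t => ((pdy u x y t : ℝ) : ℂ) := by
  funext x y t
  exact (hu.hasDerivAt_y x y t).ofReal_comp.deriv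

lemma pdt_ofReal {u : ℝ → ℝ → ℝ → ℝ} (hu : Smooth3 u) :
    (pdt fun x y t => (u x y t : ℂ)) = fun x y t => ((pdt u x y t : ℝ) : ℂ) := by
  funext x y t
  exact (hu.hasDerivAt_t x y t).ofReal_comp.deriv

end Fields

/-! ### From the AKNS flows to the KP equation -/

/-- The one-constraint: with `J = i (q_x r - q r_x)` the two flows give `u_y = J_x` and
`4 u_t - 12 u u_x - u_xxx = -3 J_y` for `u = q r`. -/
lemma IsAKNSSolution.isKPSolution {q r : ℝ → ℝ → ℝ → ℂ} (h : IsAKNSSolution q r)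
    {u : ℝ → ℝ → ℝ → ℝ} (hu : ∀ x y t, (u x y t : ℂ) = q x y t * r x y t) :
    IsKPSolution u := by
  have hq := h.smooth_q
  have hr := h.smooth_r
  have hus : Smooth3 u := by
    have h1 : (fun p : ℝ × ℝ × ℝ => u p.1 p.2.1 p.2.2)
        = fun p => Complex.reCLM (q p.1 p.2.1 p.2.2 * r p.1 p.2.1 p.2.2) := by
      funext p
      rw [← hu]
      simp
    rw [Smooth3, h1]
    exact Complex.reCLM.contDiff.comp (ContDiff.mul hq hr)
  refine ⟨hus, fun x y t => ?_⟩
  set J : ℝ → ℝ → ℝ → ℂ := fun x y t =>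
    Complex.I * (pdx q x y t * r x y t - q x y t * pdx r x y t) with hJ
  have hJs : Smooth3 J :=
    (Smooth3.const Complex.I).mul ((hq.pdx.mul hr).sub (hq.mul hr.pdx))
  have hI := Complex.I_mul_I
  have fq : pdy q = fun x y t =>
      Complex.I * (pdx (pdx q) x y t + 2 * (q x y t * q x y t * r x y t)) := by
    funext x y t
    linear_combination -Complex.I * h.flow2_q x y t + pdy q x y t * hI
  have fr : pdy r = fun x y t =>
      -Complex.I * (pdx (pdx r) x y t + 2 * (q x y t * (r x y t * r x y t))) := by
    funext x y t
    linear_combination -Complex.I * h.flow2_r x y t + pdy r x y t * hI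
  -- derivatives of the complex field `q r`
  have ux : (pdx fun x y t => (u x y t : ℂ))
      = fun x y t => pdx q x y t * r x y t + q x y t * pdx r x y t := by
    funext x y t
    simp only [pdx, hu]
    exact ((hq.hasDerivAt_x x y t).mul (hr.hasDerivAt_x x y t)).deriv
  have uxx : pdx (pdx fun x y t => (u x y t : ℂ))
      = fun x y t => pdx (pdx q) x y t * r x y t + 2 * (pdx q x y t * pdx r x y t)
        + q x y t * pdx (pdx r) x y t := by
    rw [ux]
    funext x y t
    have := ((hq.pdx.hasDerivAt_x x y t).fun_mul (hr.hasDerivAt_x x y t)).fun_add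
      ((hq.hasDerivAt_x x y t).fun_mul (hr.pdx.hasDerivAt_x x y t))
    exact (this.congr_deriv (by ring)).deriv
  have uxxx : pdx (pdx (pdx fun x y t => (u x y t : ℂ)))
      = fun x y t => pdx (pdx (pdx q)) x y t * r x y t
        + 3 * (pdx (pdx q) x y t * pdx r x y t) + 3 * (pdx q x y t * pdx (pdx r) x y t)
        + q x y t * pdx (pdx (pdx r)) x y t := by
    rw [uxx]
    funext x y t
    have := (((hq.pdx.pdx.hasDerivAt_x x y t).fun_mul (hr.hasDerivAt_x x y t)).fun_add
      (((hq.pdx.hasDerivAt_x x y t).fun_mul (hr.pdx.hasDerivAt_x x y t)).const_mul 2)).fun_add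
      ((hq.hasDerivAt_x x y t).fun_mul (hr.pdx.pdx.hasDerivAt_x x y t))
    exact (this.congr_deriv (by ring)).deriv
  have ut : (pdt fun x y t => (u x y t : ℂ))
      = fun x y t => pdt q x y t * r x y t + q x y t * pdt r x y t := by
    funext x y t
    simp only [pdt, hu]
    exact ((hq.hasDerivAt_t x y t).mul (hr.hasDerivAt_t x y t)).deriv
  have Jx : pdx J = fun x y t =>
      Complex.I * (pdx (pdx q) x y t * r x y t - q x y t * pdx (pdx r) x y t) := by
    funext x y t
    have := (((hq.pdx.hasDerivAt_x x y t).fun_mul (hr.hasDerivAt_x x y t)).fun_sub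
      ((hq.hasDerivAt_x x y t).fun_mul (hr.pdx.hasDerivAt_x x y t))).const_mul Complex.I
    exact (this.congr_deriv (by ring)).deriv
  have uy : (pdy fun x y t => (u x y t : ℂ)) = pdx J := by
    rw [Jx]
    funext x y t
    simp only [pdy, hu]
    refine ((hq.hasDerivAt_y x y t).mul (hr.hasDerivAt_y x y t)).deriv.trans ?_
    rw [fq, fr]
    ring
  have qxy : ∀ x y t, pdy (pdx q) x y t = Complex.I * (pdx (pdx (pdx q)) x y t
      + 2 * (2 * (q x y t * pdx q x y t * r x y t) + q x y t * q x y t * pdx r x y t)) := by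
    intro x y t
    rw [← hq.pdx_pdy, fq]
    have := ((hq.pdx.pdx.hasDerivAt_x x y t).fun_add ((((hq.hasDerivAt_x x y t).fun_mul
      (hq.hasDerivAt_x x y t)).fun_mul (hr.hasDerivAt_x x y t)).const_mul 2)).const_mul Complex.I
    exact (this.congr_deriv (by ring)).deriv
  have rxy : ∀ x y t, pdy (pdx r) x y t = -Complex.I * (pdx (pdx (pdx r)) x y t
      + 2 * (pdx q x y t * (r x y t * r x y t) + 2 * (q x y t * (r x y t * pdx r x y t)))) := by
    intro x y t
    rw [← hr.pdx_pdy, fr]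
    have := ((hr.pdx.pdx.hasDerivAt_x x y t).fun_add (((hq.hasDerivAt_x x y t).fun_mul
      ((hr.hasDerivAt_x x y t).fun_mul (hr.hasDerivAt_x x y t))).const_mul 2)).const_mul
      (-Complex.I)
    exact (this.congr_deriv (by ring)).deriv
  have Jy : ∀ x y t, pdy J x y t = Complex.I * (pdy (pdx q) x y t * r x y t
      + pdx q x y t * pdy r x y t - (pdy q x y t * pdx r x y t + q x y t * pdy (pdx r) x y t)) := by
    intro x y t
    have := (((hq.pdx.hasDerivAt_y x y t).fun_mul (hr.hasDerivAt_y x y t)).fun_sub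
      ((hq.hasDerivAt_y x y t).fun_mul (hr.pdx.hasDerivAt_y x y t))).const_mul Complex.I
    exact this.deriv
  have hE : (fun x y t => 4 * (pdt fun x y t => (u x y t : ℂ)) x y t
      - 12 * (u x y t : ℂ) * (pdx fun x y t => (u x y t : ℂ)) x y t
      - pdx (pdx (pdx fun x y t => (u x y t : ℂ))) x y t) = fun x y t => -3 * pdy J x y t := by
    funext x y t
    rw [ut, uxxx, ux, Jy, qxy, rxy, fq, fr]
    simp only [hu, h.flow3_q, h.flow3_r]
    linear_combination (3 * (pdx (pdx (pdx q)) x y t * r x y t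
      + q x y t * pdx (pdx (pdx r)) x y t - pdx q x y t * pdx (pdx r) x y t
      - pdx (pdx q) x y t * pdx r x y t + 4 * q x y t * r x y t * (pdx q x y t * r x y t
        + q x y t * pdx r x y t))) * hI
  have hfin : pdx (fun x y t => 4 * (pdt fun x y t => (u x y t : ℂ)) x y t
      - 12 * (u x y t : ℂ) * (pdx fun x y t => (u x y t : ℂ)) x y t
      - pdx (pdx (pdx fun x y t => (u x y t : ℂ))) x y t) x y t
      + 3 * pdy (pdy fun x y t => (u x y t : ℂ)) x y t = 0 := by
    rw [hE, uy, ← hJs.pdx_pdy]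
    have : pdx (fun x y t => -3 * pdy J x y t) x y t = -3 * pdx (pdy J) x y t :=
      ((hJs.pdy.hasDerivAt_x x y t).const_mul (-3)).deriv
    rw [this]
    ring
  -- descend from complex to real fields
  have hreal : Smooth3 fun x y t => 4 * pdt u x y t - 12 * u x y t * pdx u x y t
      - pdx (pdx (pdx u)) x y t :=
    ContDiff.sub (ContDiff.sub (contDiff_const.mul hus.pdt)
      (ContDiff.mul (contDiff_const.mul hus) hus.pdx)) hus.pdx.pdx.pdx
  rw [pdt_ofReal hus, pdx_ofReal hus, pdx_ofReal hus.pdx, pdx_ofReal hus.pdx.pdx, pdy_ofReal hus,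
    pdy_ofReal hus.pdy] at hfin
  have hcast := pdx_ofReal hreal
  push_cast at hcast
  rw [hcast] at hfin
  beta_reduce at hfin
  exact_mod_cast hfin

/-- The background `1` is removed by a Galilean transformation of the KP equation. -/
lemma IsKPSolution.galilean {u : ℝ → ℝ → ℝ → ℝ} (h : IsKPSolution u) :
    IsKPSolution fun x y t => u (x - 3 * t) y t - 1 := by
  obtain ⟨hus, hkp⟩ := h
  set v : ℝ → ℝ → ℝ → ℝ := fun x y t => u (x - 3 * t) y t - 1 with hv
  have hvs : Smooth3 v := by
    have h1 : ContDiff ℝ ∞ fun p : ℝ × ℝ × ℝ => (p.1 - 3 * p.2.2, p.2.1, p.2.2) := by fun_prop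
    exact (ContDiff.comp (g := fun p : ℝ × ℝ × ℝ => u p.1 p.2.1 p.2.2) hus h1).sub contDiff_const
  have shx : ∀ {f : ℝ → ℝ → ℝ → ℝ}, Smooth3 f →
      pdx (fun x y t => f (x - 3 * t) y t) = fun x y t => pdx f (x - 3 * t) y t := by
    intro f hf
    funext x y t
    exact ((hf.hasDerivAt_x (x - 3 * t) y t).comp_sub_const x (3 * t)).deriv
  have vx : pdx v = fun x y t => pdx u (x - 3 * t) y t := by
    funext x y t
    exact (((hus.hasDerivAt_x (x - 3 * t) y t).comp_sub_const x (3 * t)).sub_const 1).deriv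
  have vy : pdy v = fun x y t => pdy u (x - 3 * t) y t := by
    funext x y t
    exact ((hus.hasDerivAt_y (x - 3 * t) y t).sub_const 1).deriv
  have vyy : pdy (pdy v) = fun x y t => pdy (pdy u) (x - 3 * t) y t := by rw [vy]; rfl
  have vt : pdt v = fun x y t => pdt u (x - 3 * t) y t - 3 * pdx u (x - 3 * t) y t := by
    funext x y t
    have hγ : HasDerivAt (fun s : ℝ => (x - 3 * s, y, s)) ((-3 : ℝ), (0 : ℝ), (1 : ℝ)) t := by
      refine HasDerivAt.prodMk ?_ ((hasDerivAt_const t y).prodMk (hasDerivAt_id t))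
      exact (((hasDerivAt_id t).const_mul 3).const_sub x).congr_deriv (by ring)
    have h1 := (hus.hasDerivAt_comp hγ).sub_const 1
    refine h1.deriv.trans ?_
    have e : ((-3 : ℝ), (0 : ℝ), (1 : ℝ))
        = (0, 0, 1) + (-3 : ℝ) • ((1 : ℝ), (0 : ℝ), (0 : ℝ)) := by
      ext <;> simp
    rw [e, map_add, map_smul, hus.pdx_eq, hus.pdt_eq, smul_eq_mul]
    ring
  refine ⟨hvs, fun x y t => ?_⟩
  have hreal : Smooth3 fun x y t => 4 * pdt u x y t - 12 * u x y t * pdx u x y t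
      - pdx (pdx (pdx u)) x y t :=
    ContDiff.sub (ContDiff.sub (contDiff_const.mul hus.pdt)
      (ContDiff.mul (contDiff_const.mul hus) hus.pdx)) hus.pdx.pdx.pdx
  have hE : (fun x y t => 4 * pdt v x y t - 12 * v x y t * pdx v x y t - pdx (pdx (pdx v)) x y t)
      = fun x y t => 4 * pdt u (x - 3 * t) y t
        - 12 * u (x - 3 * t) y t * pdx u (x - 3 * t) y t - pdx (pdx (pdx u)) (x - 3 * t) y t := by
    rw [vt, vx, shx hus.pdx, shx hus.pdx.pdx]
    funext x y t
    simp only [hv]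
    ring
  rw [hE, vyy, shx hreal]
  exact hkp (x - 3 * t) y t

end KPLump

namespace KPLump

open Matrix

/-! ### Dressing the plane wave -/

lemma dressDeriv_smul (c : ℂ) (L0 L1 L2 L3 G0 G1 G2 F0 F1 F2 F3 : Matrix (Fin 2) (Fin 2) ℂ) :
    dressDeriv (c • L0) (c • L1) (c • L2) (c • L3) G0 G1 G2 F0 F1 F2 F3
      = c • dressDeriv L0 L1 L2 L3 G0 G1 G2 F0 F1 F2 F3 := by
  simp only [dressDeriv, dressL0, dressL1, dressL2]
  simp only [Matrix.add_mul, Matrix.sub_mul, Matrix.smul_mul, Matrix.mul_smul, smul_add,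
    smul_sub]

/-- The off-diagonal matrix with entries `r` and `q`. -/
def offDiag (q r : ℂ) : Matrix (Fin 2) (Fin 2) ℂ := !![0, r; q, 0]

section Identities

variable (q r : ℂ) (G0 G1 G2 G3 : Matrix (Fin 2) (Fin 2) ℂ)

/-- `-i` times the `x`-derivative of `G_k`, as a function of `G_0`, `G_k`, `G_{k+1}`. -/
def xDeriv (Gk Gk1 : Matrix (Fin 2) (Fin 2) ℂ) : Matrix (Fin 2) (Fin 2) ℂ :=
  ((offDiag q r + (G0 * pauli3 - pauli3 * G0)) * Gk - Gk * offDiag q r)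
    + (pauli3 * Gk1 - Gk1 * pauli3)

/-- `-i` times the `x`-derivative of `xDeriv`; the arguments `E` are the first derivatives. -/
def xDeriv2 (Gk E0 Ek Ek1 : Matrix (Fin 2) (Fin 2) ℂ) : Matrix (Fin 2) (Fin 2) ℂ :=
  xDeriv q r G0 Ek Ek1 + (E0 * pauli3 - pauli3 * E0) * Gk

/-- `-i` times the `x`-derivative of `xDeriv2`; the arguments `E`, `F` are the first and second
derivatives. -/
def xDeriv3 (Gk E0 Ek F0 Fk Fk1 : Matrix (Fin 2) (Fin 2) ℂ) : Matrix (Fin 2) (Fin 2) ℂ :=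
  xDeriv q r G0 Fk Fk1 + (E0 * pauli3 - pauli3 * E0) * Ek
    + ((F0 * pauli3 - pauli3 * F0) * Gk + (E0 * pauli3 - pauli3 * E0) * Ek)

lemma dressDeriv_x (F0 F1 F2 F3 : Matrix (Fin 2) (Fin 2) ℂ) :
    dressDeriv (offDiag q r) pauli3 0 0 G0 G1 G2 F0 F1 F2 F3 = xDeriv q r G0 F0 F1 := by
  simp [dressDeriv, dressL0, dressL1, dressL2, xDeriv]

/-- `-i` times the `y`-derivative of `G_0`. -/
def yDeriv : Matrix (Fin 2) (Fin 2) ℂ :=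
  dressDeriv (-(q * r) • pauli3) ((2 : ℂ) • offDiag q r) ((2 : ℂ) • pauli3) 0
    G0 G1 G2 G0 G1 G2 G3

/-- `-i` times the `t`-derivative of `G_0`. -/
def tDeriv : Matrix (Fin 2) (Fin 2) ℂ :=
  dressDeriv ((2 * (q * r)) • offDiag q r) ((2 * (q * r)) • pauli3) (-(4 : ℂ) • offDiag q r)
    (-(4 : ℂ) • pauli3) G0 G1 G2 G0 G1 G2 G3

/-- `-i` times the first `x`-derivative of `G_0`. -/
def xD1 : Matrix (Fin 2) (Fin 2) ℂ := xDeriv q r G0 G0 G1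

/-- `(-i)²` times the second `x`-derivative of `G_0`. -/
def xD2 : Matrix (Fin 2) (Fin 2) ℂ :=
  xDeriv2 q r G0 G0 (xD1 q r G0 G1) (xD1 q r G0 G1) (xDeriv q r G0 G1 G2)

/-- `(-i)³` times the third `x`-derivative of `G_0`. -/
def xD3 : Matrix (Fin 2) (Fin 2) ℂ :=
  xDeriv3 q r G0 G0 (xD1 q r G0 G1) (xD1 q r G0 G1) (xD2 q r G0 G1 G2) (xD2 q r G0 G1 G2)
    (xDeriv2 q r G0 G1 (xD1 q r G0 G1) (xDeriv q r G0 G1 G2) (xDeriv q r G0 G2 G3))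

lemma flow2_q_identity :
    q ^ 2 * r + yDeriv q r G0 G1 G2 G3 1 0
      = -xD2 q r G0 G1 G2 1 0 + (q + 2 * G0 1 0) ^ 2 * (r - 2 * G0 0 1) := by
  simp only [yDeriv, xD1, xD2, xDeriv, xDeriv2, dressDeriv, dressL0, dressL1, dressL2, offDiag,
    pauli3, Matrix.add_apply, Matrix.sub_apply, Matrix.smul_apply, Matrix.mul_apply,
    Fin.sum_univ_two, smul_eq_mul, Matrix.of_apply, Matrix.cons_val', Matrix.cons_val_zero,
    Matrix.cons_val_one, Matrix.cons_val_fin_one, Matrix.zero_apply, Matrix.zero_mul,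
    Matrix.mul_zero]
  ring

lemma flow2_r_identity :
    q * r ^ 2 + yDeriv q r G0 G1 G2 G3 0 1
      = xD2 q r G0 G1 G2 0 1 + (q + 2 * G0 1 0) * (r - 2 * G0 0 1) ^ 2 := by
  simp only [yDeriv, xD1, xD2, xDeriv, xDeriv2, dressDeriv, dressL0, dressL1, dressL2, offDiag,
    pauli3, Matrix.add_apply, Matrix.sub_apply, Matrix.smul_apply, Matrix.mul_apply,
    Fin.sum_univ_two, smul_eq_mul, Matrix.of_apply, Matrix.cons_val', Matrix.cons_val_zero,
    Matrix.cons_val_one, Matrix.cons_val_fin_one, Matrix.zero_apply, Matrix.zero_mul,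
    Matrix.mul_zero]
  ring

lemma flow3_q_identity :
    tDeriv q r G0 G1 G2 G3 1 0
      = -xD3 q r G0 G1 G2 G3 1 0
        + 6 * xD1 q r G0 G1 1 0 * (q + 2 * G0 1 0) * (r - 2 * G0 0 1) := by
  simp only [tDeriv, xD1, xD2, xD3, xDeriv, xDeriv2, xDeriv3, dressDeriv, dressL0, dressL1,
    dressL2, offDiag,
    pauli3, Matrix.add_apply, Matrix.sub_apply, Matrix.smul_apply, Matrix.mul_apply,
    Fin.sum_univ_two, smul_eq_mul, Matrix.of_apply, Matrix.cons_val', Matrix.cons_val_zero,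
    Matrix.cons_val_one, Matrix.cons_val_fin_one]
  ring

lemma flow3_r_identity :
    tDeriv q r G0 G1 G2 G3 0 1
      = -xD3 q r G0 G1 G2 G3 0 1
        + 6 * (q + 2 * G0 1 0) * (r - 2 * G0 0 1) * xD1 q r G0 G1 0 1 := by
  simp only [tDeriv, xD1, xD2, xD3, xDeriv, xDeriv2, xDeriv3, dressDeriv, dressL0, dressL1,
    dressL2, offDiag,
    pauli3, Matrix.add_apply, Matrix.sub_apply, Matrix.smul_apply, Matrix.mul_apply,
    Fin.sum_univ_two, smul_eq_mul, Matrix.of_apply, Matrix.cons_val', Matrix.cons_val_zero,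
    Matrix.cons_val_one, Matrix.cons_val_fin_one]
  ring

/-- The dressed potential matrix. -/
lemma offDiag_add_commutator :
    offDiag q r + (G0 * pauli3 - pauli3 * G0)
      = offDiag (q + 2 * G0 1 0) (r - 2 * G0 0 1) := by
  rw [← Matrix.ext_iff]
  simp only [Fin.forall_fin_two]
  refine ⟨⟨?_, ?_⟩, ?_, ?_⟩ <;>
    (simp only [offDiag, pauli3,
      Matrix.add_apply, Matrix.sub_apply,
      Matrix.mul_apply, Fin.sum_univ_two, Matrix.of_apply, Matrix.cons_val',
      Matrix.cons_val_zero, Matrix.cons_val_one, Matrix.cons_val_fin_one]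
     ring)

lemma dressL0_x :
    dressL0 G0 G1 G2 (offDiag q r) pauli3 0 0 = offDiag (q + 2 * G0 1 0) (r - 2 * G0 0 1) := by
  rw [← offDiag_add_commutator]
  simp [dressL0, dressL1, dressL2]

lemma dressL1_y :
    dressL1 G0 G1 ((2 : ℂ) • offDiag q r) ((2 : ℂ) • pauli3) 0
      = (2 : ℂ) • offDiag (q + 2 * G0 1 0) (r - 2 * G0 0 1) := by
  rw [← offDiag_add_commutator]
  simp [dressL1, dressL2, smul_sub]

/-- The constant term of `V` is reproduced by the dressing. -/
lemma dressL0_y :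
    dressL0 G0 G1 G2 (-(q * r) • pauli3) ((2 : ℂ) • offDiag q r) ((2 : ℂ) • pauli3) 0
      = -(pauli3 * offDiag (q + 2 * G0 1 0) (r - 2 * G0 0 1) ^ 2)
        + pauli3 * offDiag (2 * xD1 q r G0 G1 1 0) (-(2 * xD1 q r G0 G1 0 1)) := by
  rw [← Matrix.ext_iff]
  simp only [Fin.forall_fin_two]
  refine ⟨⟨?_, ?_⟩, ?_, ?_⟩ <;>
    (simp only [dressL0, dressL1, dressL2, xD1, xDeriv, offDiag, pauli3, pow_two,
      Matrix.add_apply, Matrix.sub_apply, Matrix.neg_apply, Matrix.smul_apply,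
      Matrix.mul_apply, Fin.sum_univ_two, smul_eq_mul, Matrix.of_apply, Matrix.cons_val',
      Matrix.cons_val_zero, Matrix.cons_val_one, Matrix.cons_val_fin_one, Matrix.zero_apply]
     ring)

lemma dressL2_t :
    dressL2 G0 (-(4 : ℂ) • offDiag q r) (-(4 : ℂ) • pauli3)
      = -(4 : ℂ) • offDiag (q + 2 * G0 1 0) (r - 2 * G0 0 1) := by
  rw [← offDiag_add_commutator]
  simp only [dressL2, Matrix.smul_mul, Matrix.mul_smul, smul_add, smul_sub]

/-- The coefficient of `λ` in `W` is reproduced by the dressing. -/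
lemma dressL1_t :
    dressL1 G0 G1 ((2 * (q * r)) • pauli3) (-(4 : ℂ) • offDiag q r) (-(4 : ℂ) • pauli3)
      = (2 : ℂ) • (pauli3 * offDiag (q + 2 * G0 1 0) (r - 2 * G0 0 1) ^ 2)
        - (2 : ℂ) • (pauli3 * offDiag (2 * xD1 q r G0 G1 1 0) (-(2 * xD1 q r G0 G1 0 1))) := by
  rw [← Matrix.ext_iff]
  simp only [Fin.forall_fin_two]
  refine ⟨⟨?_, ?_⟩, ?_, ?_⟩ <;>
    (simp only [dressL1, dressL2, xD1, xDeriv, offDiag, pauli3, pow_two,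
      Matrix.add_apply, Matrix.sub_apply, Matrix.smul_apply,
      Matrix.mul_apply, Fin.sum_univ_two, smul_eq_mul, Matrix.of_apply, Matrix.cons_val',
      Matrix.cons_val_zero, Matrix.cons_val_one, Matrix.cons_val_fin_one]
     ring)

/-- The constant term of `W` is reproduced by the dressing. -/
lemma dressL0_t :
    dressL0 G0 G1 G2 ((2 * (q * r)) • offDiag q r) ((2 * (q * r)) • pauli3)
        (-(4 : ℂ) • offDiag q r) (-(4 : ℂ) • pauli3)
      = offDiag (-(2 * xD2 q r G0 G1 G2 1 0)) (2 * xD2 q r G0 G1 G2 0 1)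
        + (2 : ℂ) • offDiag (q + 2 * G0 1 0) (r - 2 * G0 0 1) ^ 3
        + (offDiag (2 * xD1 q r G0 G1 1 0) (-(2 * xD1 q r G0 G1 0 1))
            * offDiag (q + 2 * G0 1 0) (r - 2 * G0 0 1)
          - offDiag (q + 2 * G0 1 0) (r - 2 * G0 0 1)
            * offDiag (2 * xD1 q r G0 G1 1 0) (-(2 * xD1 q r G0 G1 0 1))) := by
  rw [← Matrix.ext_iff]
  simp only [Fin.forall_fin_two]
  refine ⟨⟨?_, ?_⟩, ?_, ?_⟩ <;>
    (simp only [dressL0, dressL1, dressL2, xD1, xD2, xDeriv, xDeriv2, offDiag, pauli3,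
      pow_succ, pow_zero, one_mul,
      Matrix.add_apply, Matrix.sub_apply, Matrix.smul_apply,
      Matrix.mul_apply, Fin.sum_univ_two, smul_eq_mul, Matrix.of_apply, Matrix.cons_val',
      Matrix.cons_val_zero, Matrix.cons_val_one, Matrix.cons_val_fin_one]
     ring)

end Identities

end KPLump

namespace KPLump

open Matrix

/-! ### The resolvent of the Jordan block -/

section

variable {N : ℕ}

lemma dressG_sub_smul (Y : Matrix (Fin 2) (Fin N) ℂ) (M B C : Matrix (Fin N) (Fin N) ℂ) (c : ℂ) :
    dressG Y M (c • B - C) = c • dressG Y M B - dressG Y M C := by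
  simp only [dressG, Matrix.mul_sub, Matrix.sub_mul, Matrix.mul_smul, Matrix.smul_mul]

/-- The matrix `D(λ)` is the resolvent of `Λ†`. -/
lemma jordan_conjTranspose_mul_matD {lam : ℂ} (hl : lam ≠ Complex.I) :
    (jordan N)ᴴ * matD N lam = lam • matD N lam - 1 := by
  have hz : lam - Complex.I ≠ 0 := sub_ne_zero.2 hl
  ext i j
  have h1 : ((jordan N)ᴴ * matD N lam) i j
      = Complex.I * matD N lam i j
        + ∑ l : Fin N, (if (l : ℕ) + 1 = i then 1 else 0) * matD N lam l j := by
    rw [Matrix.mul_apply]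
    have : ∀ l, (jordan N)ᴴ i l * matD N lam l j
        = (if l = i then Complex.I * matD N lam l j else 0)
          + (if (l : ℕ) + 1 = i then 1 else 0) * matD N lam l j := by
      intro l
      rw [Matrix.conjTranspose_apply, jordan, Matrix.of_apply]
      by_cases h : l = i
      · subst h; simp
      · by_cases h' : (l : ℕ) + 1 = i
        · simp [h, h']
        · simp [h, h']
    rw [Finset.sum_congr rfl fun l _ => this l, Finset.sum_add_distrib]
    simp
  rw [h1, Matrix.sub_apply, Matrix.smul_apply, smul_eq_mul]
  suffices h : ∑ l : Fin N, (if (l : ℕ) + 1 = i then 1 else 0) * matD N lam l j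
      = (lam - Complex.I) * matD N lam i j - (1 : Matrix (Fin N) (Fin N) ℂ) i j by
    rw [h]; ring
  by_cases hi : (i : ℕ) = 0
  · rw [Finset.sum_eq_zero fun l _ => by rw [if_neg (by omega), zero_mul]]
    by_cases hij : i = j
    · subst hij
      simp [matD, hz]
    · have : ¬ j ≤ i := fun h => hij (Fin.ext (by have : (j : ℕ) ≤ i := h; omega))
      simp [matD, this, hij]
  · rw [Finset.sum_eq_single_of_mem (⟨i - 1, by omega⟩ : Fin N) (Finset.mem_univ _)
      fun l _ hl => by
        rw [if_neg (fun h => hl (Fin.ext (by simp; omega))), zero_mul]]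
    rw [if_pos (by simp; omega), one_mul]
    simp only [matD, Matrix.of_apply, Fin.le_def]
    rcases lt_trichotomy (i : ℕ) j with h | h | h
    · rw [if_neg (by omega), if_neg (by omega), Matrix.one_apply_ne (fun e => by simp [e] at h)]
      simp
    · have e : i = j := Fin.ext h
      subst e
      rw [if_neg (by omega), if_pos le_rfl, Matrix.one_apply_eq]
      simp [hz]
    · rw [if_pos (by omega), if_pos (by omega), Matrix.one_apply_ne (fun e => by simp [e] at h),
        show (i : ℕ) - 1 - j + 1 = i - j by omega, pow_succ]
      field_simp
      simp

lemma matD_mul_jordan_conjTranspose {lam : ℂ} (hl : lam ≠ Complex.I) :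
    matD N lam * (jordan N)ᴴ = (jordan N)ᴴ * matD N lam := by
  have h := jordan_conjTranspose_mul_matD (N := N) hl
  have h1 : (lam • 1 - (jordan N)ᴴ) * matD N lam = 1 := by
    rw [Matrix.sub_mul, h, Matrix.smul_mul, Matrix.one_mul]
    abel
  have h2 := mul_eq_one_comm.1 h1
  rw [Matrix.mul_sub, Matrix.mul_smul, Matrix.mul_one] at h2
  rw [h, ← h2]
  abel

end

lemma HasMDerivAt.mpdx_eq {F : MatField} {F' : Matrix (Fin 2) (Fin 2) ℂ} {x y t : ℝ}
    (h : HasMDerivAt (fun s => F s y t) F' x) : mpdx F x y t = F' :=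
  Matrix.ext fun i j => (h i j).deriv

lemma HasMDerivAt.mpdy_eq {F : MatField} {F' : Matrix (Fin 2) (Fin 2) ℂ} {x y t : ℝ}
    (h : HasMDerivAt (fun s => F x s t) F' y) : mpdy F x y t = F' :=
  Matrix.ext fun i j => (h i j).deriv

lemma HasMDerivAt.mpdt_eq {F : MatField} {F' : Matrix (Fin 2) (Fin 2) ℂ} {x y t : ℝ}
    (h : HasMDerivAt (fun s => F x y s) F' t) : mpdt F x y t = F' :=
  Matrix.ext fun i j => (h i j).deriv

section

variable {F0 Fk Fk1 : ℝ → Matrix (Fin 2) (Fin 2) ℂ} {s : ℝ} {q r : ℂ}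

lemma HasMDerivAt.xDeriv {E0 Ek Ek1 : Matrix (Fin 2) (Fin 2) ℂ}
    (h0 : HasMDerivAt F0 (Complex.I • E0) s) (hk : HasMDerivAt Fk (Complex.I • Ek) s)
    (hk1 : HasMDerivAt Fk1 (Complex.I • Ek1) s) :
    HasMDerivAt (fun s => xDeriv q r (F0 s) (Fk s) (Fk1 s))
      (Complex.I • xDeriv2 q r (F0 s) (Fk s) E0 Ek Ek1) s := by
  have hc := (h0.mul_const pauli3).sub (h0.const_mul pauli3)
  refine (((((hasMDerivAt_const (offDiag q r) s).add hc).mul hk).sub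
    (hk.mul_const (offDiag q r))).add
    ((hk1.const_mul pauli3).sub (hk1.mul_const pauli3))).congr_deriv ?_
  simp only [xDeriv2, KPLump.xDeriv, Matrix.smul_mul, Matrix.mul_smul, zero_add, ← smul_sub]
  module

lemma HasMDerivAt.xDeriv2 {H0 Hk Hk1 : ℝ → Matrix (Fin 2) (Fin 2) ℂ}
    {E0 Ek D0 Dk Dk1 : Matrix (Fin 2) (Fin 2) ℂ}
    (h0 : HasMDerivAt F0 (Complex.I • E0) s) (hk : HasMDerivAt Fk (Complex.I • Ek) s)
    (h0' : HasMDerivAt H0 (Complex.I • D0) s) (hk' : HasMDerivAt Hk (Complex.I • Dk) s)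
    (hk1' : HasMDerivAt Hk1 (Complex.I • Dk1) s) (hE0 : H0 s = E0) (hEk : Hk s = Ek) :
    HasMDerivAt (fun s => xDeriv2 q r (F0 s) (Fk s) (H0 s) (Hk s) (Hk1 s))
      (Complex.I • xDeriv3 q r (F0 s) (Fk s) E0 Ek D0 Dk Dk1) s := by
  have h1 := h0.xDeriv (q := q) (r := r) hk' hk1'
  have hc := ((h0'.mul_const pauli3).sub (h0'.const_mul pauli3)).mul hk
  refine (h1.add hc).congr_deriv ?_
  simp only [xDeriv3, KPLump.xDeriv2, Matrix.smul_mul, Matrix.mul_smul, ← smul_sub, hE0, hEk]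
  module

end

/-! ### The dressed potentials -/

/-- Data for the dressing of the plane wave: `Y` solves the linear system of the seed with spectral
matrix `Λ`, and `M` is an invertible solution of `Λ† M - M Λ = Y† Y`. -/
structure IsDressing {N : ℕ} (Y : ℝ → ℝ → ℝ → Matrix (Fin 2) (Fin N) ℂ)
    (M : ℝ → ℝ → ℝ → Matrix (Fin N) (Fin N) ℂ) : Prop where
  smooth_Y : ∀ c k, Smooth3 fun x y t => Y x y t c k
  smooth_M : ∀ j k, Smooth3 fun x y t => M x y t j k
  det_ne_zero : ∀ x y t, (M x y t).det ≠ 0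
  sylvester : ∀ x y t, (jordan N)ᴴ * M x y t - M x y t * jordan N = (Y x y t)ᴴ * Y x y t
  flow_x : ∀ x y t, HasMDerivAt (fun s => Y s y t)
    (Complex.I • (offDiag (seedQ x y t) (seedR x y t) * Y x y t
      + pauli3 * Y x y t * jordan N)) x
  flow_y : ∀ x y t, HasMDerivAt (fun s => Y x s t)
    (Complex.I • (-pauli3 * Y x y t
      + (2 : ℂ) • (offDiag (seedQ x y t) (seedR x y t) * Y x y t * jordan N)
      + (2 : ℂ) • (pauli3 * Y x y t * jordan N * jordan N))) y
  flow_t : ∀ x y t, HasMDerivAt (fun s => Y x y s)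
    (Complex.I • ((2 : ℂ) • (offDiag (seedQ x y t) (seedR x y t) * Y x y t)
      + (2 : ℂ) • (pauli3 * Y x y t * jordan N)
      - (4 : ℂ) • (offDiag (seedQ x y t) (seedR x y t) * Y x y t * jordan N * jordan N)
      - (4 : ℂ) • (pauli3 * Y x y t * jordan N * jordan N * jordan N))) t

lemma seedQ_mul_seedR (x y t : ℝ) : seedQ x y t * seedR x y t = 1 := by
  rw [seedQ, seedR, ← Complex.exp_add, add_neg_cancel, Complex.exp_zero]

lemma conj_seedQ (x y t : ℝ) : (starRingEnd ℂ) (seedQ x y t) = seedR x y t := by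
  rw [seedQ, seedR, ← Complex.exp_conj, map_mul, map_mul, Complex.conj_I, Complex.conj_ofReal,
    Complex.conj_ofNat]
  congr 1
  ring

lemma conj_seedR (x y t : ℝ) : (starRingEnd ℂ) (seedR x y t) = seedQ x y t := by
  rw [← conj_seedQ, Complex.conj_conj]

lemma smooth_seedQ : Smooth3 seedQ := by
  have h : ContDiff ℝ ∞ fun p : ℝ × ℝ × ℝ => 2 * Complex.I * (p.2.1 : ℂ) :=
    contDiff_const.mul (Complex.ofRealCLM.contDiff.comp (contDiff_fst.comp contDiff_snd))
  exact Complex.contDiff_exp.comp h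

lemma hasDerivAt_seedQ (x y t : ℝ) :
    HasDerivAt (fun s => seedQ x s t) (2 * Complex.I * seedQ x y t) y := by
  have h := ((Complex.ofRealCLM.hasDerivAt (x := y)).const_mul (2 * Complex.I)).cexp
  refine h.congr_deriv ?_
  simp [seedQ, mul_comm]

lemma hasDerivAt_seedR (x y t : ℝ) :
    HasDerivAt (fun s => seedR x s t) (-(2 * Complex.I) * seedR x y t) y := by
  have h := ((Complex.ofRealCLM.hasDerivAt (x := y)).const_mul (2 * Complex.I)).neg.cexp
  refine h.congr_deriv ?_
  simp [seedR, mul_comm]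

lemma conjTranspose_offDiag_seed (x y t : ℝ) :
    (offDiag (seedQ x y t) (seedR x y t))ᴴ = offDiag (seedQ x y t) (seedR x y t) := by
  ext i j
  fin_cases i <;> fin_cases j <;> simp [offDiag, conj_seedQ, conj_seedR]

lemma conjTranspose_pauli3 : pauli3ᴴ = pauli3 := by
  ext i j
  fin_cases i <;> fin_cases j <;> simp [pauli3]

namespace IsDressing

variable {N : ℕ} {Y : ℝ → ℝ → ℝ → Matrix (Fin 2) (Fin N) ℂ}
  {M : ℝ → ℝ → ℝ → Matrix (Fin N) (Fin N) ℂ}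

lemma smooth_dressG (h : IsDressing Y M) (B : Matrix (Fin N) (Fin N) ℂ) (i j : Fin 2) :
    Smooth3 fun x y t => dressG (Y x y t) (M x y t) B i j := by
  have hP : ∀ i j, ContDiff ℝ ∞ fun p : ℝ × ℝ × ℝ => (M p.1 p.2.1 p.2.2)⁻¹ i j :=
    contDiff_matrix_inv h.smooth_M fun p => h.det_ne_zero _ _ _
  have hYs : ∀ i j, ContDiff ℝ ∞ fun p : ℝ × ℝ × ℝ => (Y p.1 p.2.1 p.2.2)ᴴ i j :=
    fun i j => contDiff_conj (h.smooth_Y j i)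
  exact contDiff_matrix_mul (contDiff_matrix_mul (contDiff_matrix_mul h.smooth_Y hP)
    (G := fun _ => B) fun i j => contDiff_const) hYs i j

section Derivatives

variable {B : Matrix (Fin N) (Fin N) ℂ}

lemma hasMDerivAt_x (h : IsDressing Y M) (hB : B * (jordan N)ᴴ = (jordan N)ᴴ * B)
    (x y t : ℝ) : HasMDerivAt (fun s => dressG (Y s y t) (M s y t) B)
    (Complex.I • dressDeriv (offDiag (seedQ x y t) (seedR x y t)) pauli3 0 0
      (dressG (Y x y t) (M x y t) ((jordan N)ᴴ ^ 0)) (dressG (Y x y t) (M x y t) ((jordan N)ᴴ ^ 1))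
      (dressG (Y x y t) (M x y t) ((jordan N)ᴴ ^ 2))
      (dressG (Y x y t) (M x y t) B) (dressG (Y x y t) (M x y t) ((jordan N)ᴴ * B))
      (dressG (Y x y t) (M x y t) ((jordan N)ᴴ * ((jordan N)ᴴ * B)))
      (dressG (Y x y t) (M x y t) ((jordan N)ᴴ * ((jordan N)ᴴ * ((jordan N)ᴴ * B))))) x := by
  have hline : ContDiff ℝ ∞ fun s : ℝ => (s, y, t) := by fun_prop
  rw [← dressDeriv_smul]
  refine hasMDerivAt_dressG (M := fun s => M s y t) (Y := fun s => Y s y t) (s := x)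
    (fun i j => (h.smooth_M i j).comp hline) (fun e => h.det_ne_zero _ _ _)
    (fun e => h.sylvester _ _ _) ?_ ?_ ?_ ?_ ?_ rfl hB
    (G := fun k => dressG (Y x y t) (M x y t) ((jordan N)ᴴ ^ k)) (fun k => rfl)
  · simp [Matrix.conjTranspose_smul, conjTranspose_offDiag_seed]
  · simp [Matrix.conjTranspose_smul, conjTranspose_pauli3]
  · simp
  · simp
  · refine (h.flow_x x y t).congr_deriv ?_
    simp [Matrix.smul_mul, smul_add]

lemma hasMDerivAt_y (h : IsDressing Y M) (hB : B * (jordan N)ᴴ = (jordan N)ᴴ * B)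
    (x y t : ℝ) : HasMDerivAt (fun s => dressG (Y x s t) (M x s t) B)
    (Complex.I • dressDeriv (-(seedQ x y t * seedR x y t) • pauli3)
      ((2 : ℂ) • offDiag (seedQ x y t) (seedR x y t)) ((2 : ℂ) • pauli3) 0
      (dressG (Y x y t) (M x y t) ((jordan N)ᴴ ^ 0)) (dressG (Y x y t) (M x y t) ((jordan N)ᴴ ^ 1))
      (dressG (Y x y t) (M x y t) ((jordan N)ᴴ ^ 2))
      (dressG (Y x y t) (M x y t) B) (dressG (Y x y t) (M x y t) ((jordan N)ᴴ * B))
      (dressG (Y x y t) (M x y t) ((jordan N)ᴴ * ((jordan N)ᴴ * B)))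
      (dressG (Y x y t) (M x y t) ((jordan N)ᴴ * ((jordan N)ᴴ * ((jordan N)ᴴ * B))))) y := by
  have hline : ContDiff ℝ ∞ fun s : ℝ => (x, s, t) := by fun_prop
  rw [← dressDeriv_smul]
  refine hasMDerivAt_dressG (M := fun s => M x s t) (Y := fun s => Y x s t) (s := y)
    (fun i j => (h.smooth_M i j).comp hline) (fun e => h.det_ne_zero _ _ _)
    (fun e => h.sylvester _ _ _) ?_ ?_ ?_ ?_ ?_ rfl hB
    (G := fun k => dressG (Y x y t) (M x y t) ((jordan N)ᴴ ^ k)) (fun k => rfl)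
  · simp [Matrix.conjTranspose_smul, conjTranspose_pauli3, seedQ_mul_seedR]
  · simp [Matrix.conjTranspose_smul, conjTranspose_offDiag_seed]
  · simp [Matrix.conjTranspose_smul, conjTranspose_pauli3]
  · simp
  · refine (h.flow_y x y t).congr_deriv ?_
    simp [Matrix.smul_mul, smul_add, seedQ_mul_seedR]

lemma hasMDerivAt_t (h : IsDressing Y M) (hB : B * (jordan N)ᴴ = (jordan N)ᴴ * B)
    (x y t : ℝ) : HasMDerivAt (fun s => dressG (Y x y s) (M x y s) B)
    (Complex.I • dressDeriv
      ((2 * (seedQ x y t * seedR x y t)) • offDiag (seedQ x y t) (seedR x y t))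
      ((2 * (seedQ x y t * seedR x y t)) • pauli3)
      (-(4 : ℂ) • offDiag (seedQ x y t) (seedR x y t)) (-(4 : ℂ) • pauli3)
      (dressG (Y x y t) (M x y t) ((jordan N)ᴴ ^ 0)) (dressG (Y x y t) (M x y t) ((jordan N)ᴴ ^ 1))
      (dressG (Y x y t) (M x y t) ((jordan N)ᴴ ^ 2))
      (dressG (Y x y t) (M x y t) B) (dressG (Y x y t) (M x y t) ((jordan N)ᴴ * B))
      (dressG (Y x y t) (M x y t) ((jordan N)ᴴ * ((jordan N)ᴴ * B)))
      (dressG (Y x y t) (M x y t) ((jordan N)ᴴ * ((jordan N)ᴴ * ((jordan N)ᴴ * B))))) t := by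
  have hline : ContDiff ℝ ∞ fun s : ℝ => (x, y, s) := by fun_prop
  rw [← dressDeriv_smul]
  refine hasMDerivAt_dressG (M := fun s => M x y s) (Y := fun s => Y x y s) (s := t)
    (fun i j => (h.smooth_M i j).comp hline) (fun e => h.det_ne_zero _ _ _)
    (fun e => h.sylvester _ _ _) ?_ ?_ ?_ ?_ ?_ rfl hB
    (G := fun k => dressG (Y x y t) (M x y t) ((jordan N)ᴴ ^ k)) (fun k => rfl)
  · simp [Matrix.conjTranspose_smul, conjTranspose_offDiag_seed, seedQ_mul_seedR]
  · simp [Matrix.conjTranspose_smul, conjTranspose_pauli3, seedQ_mul_seedR]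
  · simp [Matrix.conjTranspose_smul, conjTranspose_offDiag_seed]
  · simp [Matrix.conjTranspose_smul, conjTranspose_pauli3]
  · refine (h.flow_t x y t).congr_deriv ?_
    simp only [Matrix.smul_mul, seedQ_mul_seedR, mul_one]
    module

end Derivatives

/-- The coefficient `G_k` of the expansion of the Darboux matrix at `λ = ∞`. -/
def coeffG (_ : IsDressing Y M) (k : ℕ) : MatField :=
  fun x y t => dressG (Y x y t) (M x y t) ((jordan N)ᴴ ^ k)

/-- The dressed potential `q`. -/
def newQ (h : IsDressing Y M) (x y t : ℝ) : ℂ := seedQ x y t + 2 * h.coeffG 0 x y t 1 0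

/-- The dressed potential `r`. -/
def newR (h : IsDressing Y M) (x y t : ℝ) : ℂ := seedR x y t - 2 * h.coeffG 0 x y t 0 1

lemma conj_newQ (h : IsDressing Y M) (x y t : ℝ) :
    (starRingEnd ℂ) (h.newQ x y t) = h.newR x y t := by
  have hinv : (-M x y t)⁻¹ = -(M x y t)⁻¹ := by
    refine Matrix.inv_eq_left_inv ?_
    rw [neg_mul_neg, Matrix.nonsing_inv_mul _ (isUnit_iff_ne_zero.2 (h.det_ne_zero x y t))]
  have h1 : (h.coeffG 0 x y t)ᴴ = -h.coeffG 0 x y t := by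
    simp only [coeffG, dressG, pow_zero, Matrix.mul_one, Matrix.conjTranspose_mul,
      Matrix.conjTranspose_nonsing_inv, Matrix.conjTranspose_conjTranspose,
      conjTranspose_of_sylvester (h.sylvester x y t), hinv, Matrix.mul_neg,
      Matrix.neg_mul, Matrix.mul_assoc]
  have h2 : (starRingEnd ℂ) (h.coeffG 0 x y t 1 0) = -h.coeffG 0 x y t 0 1 :=
    congrFun (congrFun h1 0) 1
  rw [newQ, newR, map_add, map_mul, conj_seedQ, h2, Complex.conj_ofNat]
  ring

lemma smooth_newQ (h : IsDressing Y M) : Smooth3 h.newQ :=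
  ContDiff.add smooth_seedQ (contDiff_const.mul (h.smooth_dressG _ 1 0))

lemma smooth_newR (h : IsDressing Y M) : Smooth3 h.newR := by
  have h1 : h.newR = fun x y t => (starRingEnd ℂ) (h.newQ x y t) := by
    funext x y t
    exact (h.conj_newQ x y t).symm
  rw [h1]
  exact contDiff_conj h.smooth_newQ

lemma jordan_pow_comm (k : ℕ) : (jordan N)ᴴ ^ k * (jordan N)ᴴ = (jordan N)ᴴ * (jordan N)ᴴ ^ k :=
  (pow_succ _ _).symm.trans (pow_succ' _ _)

lemma coeffG_x (h : IsDressing Y M) (k : ℕ) (x y t : ℝ) :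
    HasMDerivAt (fun s => h.coeffG k s y t) (Complex.I • xDeriv (seedQ x y t) (seedR x y t)
      (h.coeffG 0 x y t) (h.coeffG k x y t) (h.coeffG (k + 1) x y t)) x := by
  refine (h.hasMDerivAt_x (jordan_pow_comm k) x y t).congr_deriv ?_
  rw [dressDeriv_x, ← pow_succ']
  rfl

lemma coeffG_y (h : IsDressing Y M) (x y t : ℝ) :
    HasMDerivAt (fun s => h.coeffG 0 x s t) (Complex.I • yDeriv (seedQ x y t) (seedR x y t)
      (h.coeffG 0 x y t) (h.coeffG 1 x y t) (h.coeffG 2 x y t) (h.coeffG 3 x y t)) y := by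
  refine (h.hasMDerivAt_y (jordan_pow_comm 0) x y t).congr_deriv ?_
  simp only [← pow_succ', zero_add]
  rfl

lemma coeffG_t (h : IsDressing Y M) (x y t : ℝ) :
    HasMDerivAt (fun s => h.coeffG 0 x y s) (Complex.I • tDeriv (seedQ x y t) (seedR x y t)
      (h.coeffG 0 x y t) (h.coeffG 1 x y t) (h.coeffG 2 x y t) (h.coeffG 3 x y t)) t := by
  refine (h.hasMDerivAt_t (jordan_pow_comm 0) x y t).congr_deriv ?_
  simp only [← pow_succ', zero_add]
  rfl

/-- `-i` times the `x`-derivative of `G_0`. -/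
def fieldD1 (h : IsDressing Y M) : MatField := fun x y t =>
  xD1 (seedQ x y t) (seedR x y t) (h.coeffG 0 x y t) (h.coeffG 1 x y t)

/-- `(-i)²` times the second `x`-derivative of `G_0`. -/
def fieldD2 (h : IsDressing Y M) : MatField := fun x y t =>
  xD2 (seedQ x y t) (seedR x y t) (h.coeffG 0 x y t) (h.coeffG 1 x y t) (h.coeffG 2 x y t)

/-- `(-i)³` times the third `x`-derivative of `G_0`. -/
def fieldD3 (h : IsDressing Y M) : MatField := fun x y t =>
  xD3 (seedQ x y t) (seedR x y t) (h.coeffG 0 x y t) (h.coeffG 1 x y t) (h.coeffG 2 x y t)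
    (h.coeffG 3 x y t)

lemma fieldD1_x (h : IsDressing Y M) (x y t : ℝ) :
    HasMDerivAt (fun s => h.fieldD1 s y t) (Complex.I • h.fieldD2 x y t) x :=
  (h.coeffG_x 0 x y t).xDeriv (h.coeffG_x 0 x y t) (h.coeffG_x 1 x y t)

lemma fieldD2_x (h : IsDressing Y M) (x y t : ℝ) :
    HasMDerivAt (fun s => h.fieldD2 s y t) (Complex.I • h.fieldD3 x y t) x :=
  (h.coeffG_x 0 x y t).xDeriv2 (h.coeffG_x 0 x y t) (h.fieldD1_x x y t) (h.fieldD1_x x y t)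
    ((h.coeffG_x 0 x y t).xDeriv (h.coeffG_x 1 x y t) (h.coeffG_x 2 x y t)) rfl rfl

lemma pdx_newQ (h : IsDressing Y M) :
    pdx h.newQ = fun x y t => 2 * Complex.I * h.fieldD1 x y t 1 0 := by
  funext x y t
  refine ((((h.coeffG_x 0 x y t) 1 0).const_mul 2).const_add (seedQ x y t)).deriv.trans ?_
  rw [Matrix.smul_apply, smul_eq_mul, mul_assoc]
  rfl

lemma pdx_newR (h : IsDressing Y M) :
    pdx h.newR = fun x y t => -(2 * Complex.I) * h.fieldD1 x y t 0 1 := by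
  funext x y t
  refine ((((h.coeffG_x 0 x y t) 0 1).const_mul 2).const_sub (seedR x y t)).deriv.trans ?_
  rw [Matrix.smul_apply, smul_eq_mul, ← mul_assoc, ← neg_mul]
  rfl

lemma pdx_pdx_newQ (h : IsDressing Y M) :
    pdx (pdx h.newQ) = fun x y t => -2 * h.fieldD2 x y t 1 0 := by
  rw [pdx_newQ]
  funext x y t
  refine (((h.fieldD1_x x y t) 1 0).const_mul (2 * Complex.I)).deriv.trans ?_
  rw [Matrix.smul_apply, smul_eq_mul]
  linear_combination 2 * h.fieldD2 x y t 1 0 * Complex.I_mul_I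

lemma pdx_pdx_newR (h : IsDressing Y M) :
    pdx (pdx h.newR) = fun x y t => 2 * h.fieldD2 x y t 0 1 := by
  rw [pdx_newR]
  funext x y t
  refine (((h.fieldD1_x x y t) 0 1).const_mul (-(2 * Complex.I))).deriv.trans ?_
  rw [Matrix.smul_apply, smul_eq_mul]
  linear_combination -2 * h.fieldD2 x y t 0 1 * Complex.I_mul_I

lemma pdx_pdx_pdx_newQ (h : IsDressing Y M) :
    pdx (pdx (pdx h.newQ)) = fun x y t => -(2 * Complex.I) * h.fieldD3 x y t 1 0 := by
  rw [pdx_pdx_newQ]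
  funext x y t
  refine (((h.fieldD2_x x y t) 1 0).const_mul (-2)).deriv.trans ?_
  rw [Matrix.smul_apply, smul_eq_mul]
  ring

lemma pdx_pdx_pdx_newR (h : IsDressing Y M) :
    pdx (pdx (pdx h.newR)) = fun x y t => 2 * Complex.I * h.fieldD3 x y t 0 1 := by
  rw [pdx_pdx_newR]
  funext x y t
  refine (((h.fieldD2_x x y t) 0 1).const_mul 2).deriv.trans ?_
  rw [Matrix.smul_apply, smul_eq_mul]
  ring

/-- The dressed potentials solve the flows. -/
theorem isAKNSSolution (h : IsDressing Y M) : IsAKNSSolution h.newQ h.newR where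
  smooth_q := h.smooth_newQ
  smooth_r := h.smooth_newR
  flow2_q x y t := by
    have hy : pdy h.newQ x y t = _ :=
      ((hasDerivAt_seedQ x y t).fun_add (((h.coeffG_y x y t) 1 0).const_mul 2)).deriv
    rw [hy, pdx_pdx_newQ, Matrix.smul_apply, smul_eq_mul]
    have e := flow2_q_identity (seedQ x y t) (seedR x y t) (h.coeffG 0 x y t) (h.coeffG 1 x y t)
      (h.coeffG 2 x y t) (h.coeffG 3 x y t)
    have e1 := seedQ_mul_seedR x y t
    simp only [newQ, newR, fieldD2]
    linear_combination -2 * e + 2 * (seedQ x y t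
      + yDeriv (seedQ x y t) (seedR x y t) (h.coeffG 0 x y t) (h.coeffG 1 x y t)
        (h.coeffG 2 x y t) (h.coeffG 3 x y t) 1 0) * Complex.I_mul_I
      + 2 * seedQ x y t * e1
  flow2_r x y t := by
    have hy : pdy h.newR x y t = _ :=
      ((hasDerivAt_seedR x y t).fun_sub (((h.coeffG_y x y t) 0 1).const_mul 2)).deriv
    rw [hy, pdx_pdx_newR, Matrix.smul_apply, smul_eq_mul]
    have e := flow2_r_identity (seedQ x y t) (seedR x y t) (h.coeffG 0 x y t) (h.coeffG 1 x y t)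
      (h.coeffG 2 x y t) (h.coeffG 3 x y t)
    have e1 := seedQ_mul_seedR x y t
    simp only [newQ, newR, fieldD2]
    linear_combination 2 * e - 2 * (seedR x y t
      + yDeriv (seedQ x y t) (seedR x y t) (h.coeffG 0 x y t) (h.coeffG 1 x y t)
        (h.coeffG 2 x y t) (h.coeffG 3 x y t) 0 1) * Complex.I_mul_I
      - 2 * seedR x y t * e1
  flow3_q x y t := by
    have ht : pdt h.newQ x y t = _ :=
      (((h.coeffG_t x y t) 1 0).const_mul 2).const_add (seedQ x y t) |>.deriv
    rw [ht, pdx_pdx_pdx_newQ, pdx_newQ, Matrix.smul_apply, smul_eq_mul]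
    have e := flow3_q_identity (seedQ x y t) (seedR x y t) (h.coeffG 0 x y t) (h.coeffG 1 x y t)
      (h.coeffG 2 x y t) (h.coeffG 3 x y t)
    simp only [newQ, newR, fieldD1, fieldD3]
    linear_combination 2 * Complex.I * e
  flow3_r x y t := by
    have ht : pdt h.newR x y t = _ :=
      (((h.coeffG_t x y t) 0 1).const_mul 2).const_sub (seedR x y t) |>.deriv
    rw [ht, pdx_pdx_pdx_newR, pdx_newR, Matrix.smul_apply, smul_eq_mul]
    have e := flow3_r_identity (seedQ x y t) (seedR x y t) (h.coeffG 0 x y t) (h.coeffG 1 x y t)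
      (h.coeffG 2 x y t) (h.coeffG 3 x y t)
    simp only [newQ, newR, fieldD1, fieldD3]
    linear_combination -2 * Complex.I * e

end IsDressing

/-! ### The Darboux matrix -/

lemma laxU_eq (lam : ℂ) (q r : ℝ → ℝ → ℝ → ℂ) (x y t : ℝ) :
    laxU lam q r x y t = Complex.I • (offDiag (q x y t) (r x y t) + lam • pauli3
      + lam ^ 2 • (0 : Matrix (Fin 2) (Fin 2) ℂ) + lam ^ 3 • (0 : Matrix (Fin 2) (Fin 2) ℂ)) := by
  rw [laxU, smul_zero, smul_zero, add_zero, add_zero, add_comm]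
  rfl

lemma laxV_eq (lam : ℂ) (q r : ℝ → ℝ → ℝ → ℂ) (x y t : ℝ) {P1 : Matrix (Fin 2) (Fin 2) ℂ}
    (h1 : mpdx (potMat q r) x y t = Complex.I • P1) :
    laxV lam q r x y t = Complex.I • ((-(pauli3 * offDiag (q x y t) (r x y t) ^ 2) + pauli3 * P1)
      + lam • ((2 : ℂ) • offDiag (q x y t) (r x y t)) + lam ^ 2 • ((2 : ℂ) • pauli3)
      + lam ^ 3 • (0 : Matrix (Fin 2) (Fin 2) ℂ)) := by
  simp only [laxV, h1]
  rw [show potMat q r x y t = offDiag (q x y t) (r x y t) from rfl, Matrix.mul_smul]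
  module

lemma laxW_eq (lam : ℂ) (q r : ℝ → ℝ → ℝ → ℂ) (x y t : ℝ) {P1 P2 : Matrix (Fin 2) (Fin 2) ℂ}
    (h1 : mpdx (potMat q r) x y t = Complex.I • P1) (h2 : mpdx (mpdx (potMat q r)) x y t = P2) :
    laxW lam q r x y t = Complex.I • ((P2 + (2 : ℂ) • offDiag (q x y t) (r x y t) ^ 3
        + (P1 * offDiag (q x y t) (r x y t) - offDiag (q x y t) (r x y t) * P1))
      + lam • ((2 : ℂ) • (pauli3 * offDiag (q x y t) (r x y t) ^ 2) - (2 : ℂ) • (pauli3 * P1))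
      + lam ^ 2 • (-(4 : ℂ) • offDiag (q x y t) (r x y t)) + lam ^ 3 • (-(4 : ℂ) • pauli3)) := by
  simp only [laxW, h1, h2]
  rw [show potMat q r x y t = offDiag (q x y t) (r x y t) from rfl, Matrix.mul_smul,
    Matrix.smul_mul, Matrix.mul_smul]
  module

lemma offDiag_sq (q r : ℂ) : offDiag q r ^ 2 = (q * r) • (1 : Matrix (Fin 2) (Fin 2) ℂ) := by
  ext i j
  fin_cases i <;> fin_cases j <;> simp [offDiag, pow_two, mul_comm]

lemma mpdx_potMat_seed : mpdx (potMat seedQ seedR) = 0 := by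
  funext x y t
  ext i j
  fin_cases i <;> fin_cases j <;> simp [mpdx, pdx, potMat, seedQ, seedR]

namespace IsDressing

variable {N : ℕ} {Y : ℝ → ℝ → ℝ → Matrix (Fin 2) (Fin N) ℂ}
  {M : ℝ → ℝ → ℝ → Matrix (Fin N) (Fin N) ℂ}

lemma mpdx_potMat (h : IsDressing Y M) (x y t : ℝ) :
    mpdx (potMat h.newQ h.newR) x y t
      = Complex.I • offDiag (2 * h.fieldD1 x y t 1 0) (-(2 * h.fieldD1 x y t 0 1)) := by
  have hq := congrFun (congrFun (congrFun h.pdx_newQ x) y) t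
  have hr := congrFun (congrFun (congrFun h.pdx_newR x) y) t
  ext i j
  fin_cases i <;> fin_cases j
  · simp [mpdx, potMat, offDiag, pdx]
  · simp only [mpdx, potMat, offDiag, Matrix.of_apply, Matrix.smul_apply]
    refine hr.trans ?_
    simp; ring
  · simp only [mpdx, potMat, offDiag, Matrix.of_apply, Matrix.smul_apply]
    refine hq.trans ?_
    simp; ring
  · simp [mpdx, potMat, offDiag, pdx]

lemma mpdx_mpdx_potMat (h : IsDressing Y M) (x y t : ℝ) :
    mpdx (mpdx (potMat h.newQ h.newR)) x y t
      = offDiag (-(2 * h.fieldD2 x y t 1 0)) (2 * h.fieldD2 x y t 0 1) := by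
  have h1 : mpdx (potMat h.newQ h.newR)
      = potMat (fun x y t => Complex.I * (2 * h.fieldD1 x y t 1 0))
        (fun x y t => Complex.I * (-(2 * h.fieldD1 x y t 0 1))) := by
    funext x y t
    rw [mpdx_potMat]
    ext i j
    fin_cases i <;> fin_cases j <;> simp [potMat, offDiag]
  have hq := ((((h.fieldD1_x x y t) 1 0).const_mul 2).const_mul Complex.I).deriv
  have hr := (((((h.fieldD1_x x y t) 0 1).const_mul 2).fun_neg).const_mul Complex.I).deriv
  rw [h1]
  ext i j
  fin_cases i <;> fin_cases j
  · simp [mpdx, potMat, offDiag, pdx]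
  · simp only [mpdx, potMat, offDiag, Matrix.of_apply]
    refine hr.trans ?_
    simp only [Matrix.smul_apply, smul_eq_mul]
    change _ = 2 * h.fieldD2 x y t 0 1
    linear_combination -2 * h.fieldD2 x y t 0 1 * Complex.I_mul_I
  · simp only [mpdx, potMat, offDiag, Matrix.of_apply]
    refine hq.trans ?_
    simp only [Matrix.smul_apply, smul_eq_mul]
    change _ = -(2 * h.fieldD2 x y t 1 0)
    linear_combination 2 * h.fieldD2 x y t 1 0 * Complex.I_mul_I
  · simp [mpdx, potMat, offDiag, pdx]

/-- The dressing matrix `1 + Y M⁻¹ D(λ) Y†` transforms the Lax pair of the seed into the Lax pair of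
the dressed potentials. -/
theorem isDarbouxMatrix (h : IsDressing Y M) :
    IsDarbouxMatrix Complex.I
      (fun lam x y t => 1 + dressG (Y x y t) (M x y t) (matD N lam))
      seedQ seedR h.newQ h.newR := by
  -- multiplication by `Λ†` acts on the resolvent as a shifted multiplication by `λ`
  have hKB : ∀ lam : ℂ, lam ≠ Complex.I → ∀ x y t,
      let F := dressG (Y x y t) (M x y t) (matD N lam)
      let K := (jordan N)ᴴ
      dressG (Y x y t) (M x y t) (K * matD N lam) = lam • F - h.coeffG 0 x y t ∧
      dressG (Y x y t) (M x y t) (K * (K * matD N lam))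
        = lam • (lam • F - h.coeffG 0 x y t) - h.coeffG 1 x y t ∧
      dressG (Y x y t) (M x y t) (K * (K * (K * matD N lam)))
        = lam • (lam • (lam • F - h.coeffG 0 x y t) - h.coeffG 1 x y t) - h.coeffG 2 x y t := by
    intro lam hl x y t F K
    have e := jordan_conjTranspose_mul_matD (N := N) hl
    have e2 : K * (K * matD N lam) = lam • (K * matD N lam) - K := by
      rw [show K * matD N lam = _ from e, Matrix.mul_sub, Matrix.mul_smul, Matrix.mul_one,
        show K * matD N lam = _ from e]
    have e3 : K * (K * (K * matD N lam)) = lam • (K * (K * matD N lam)) - K ^ 2 := by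
      rw [e2, Matrix.mul_sub, Matrix.mul_smul, ← pow_two, e2]
    have f1 : dressG (Y x y t) (M x y t) (K * matD N lam) = lam • F - h.coeffG 0 x y t := by
      rw [show K * matD N lam = _ from e, dressG_sub_smul, coeffG, pow_zero]
    have f2 : dressG (Y x y t) (M x y t) (K * (K * matD N lam))
        = lam • (lam • F - h.coeffG 0 x y t) - h.coeffG 1 x y t := by
      rw [e2, dressG_sub_smul, f1, coeffG, coeffG, pow_one]
    refine ⟨f1, f2, ?_⟩
    rw [e3, dressG_sub_smul, f2]
    rfl
  refine ⟨?_, ?_, ?_, ?_⟩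
  · intro lam _ i j
    exact (Smooth3.const _).add (h.smooth_dressG _ i j)
  · intro lam hl x y t
    have hd := (hasMDerivAt_const (1 : Matrix (Fin 2) (Fin 2) ℂ) x).add
      (h.hasMDerivAt_x (matD_mul_jordan_conjTranspose hl) x y t)
    obtain ⟨f1, f2, f3⟩ := hKB lam hl x y t
    rw [HasMDerivAt.mpdx_eq hd, zero_add, f1, f2, f3, laxU_eq, laxU_eq, Matrix.mul_smul,
      Matrix.smul_mul, ← smul_add]
    have e := darboux_equation (L0 := offDiag (seedQ x y t) (seedR x y t)) (L1 := pauli3)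
      (L2 := 0) (L3 := 0) lam (h.coeffG 0 x y t) (h.coeffG 1 x y t) (h.coeffG 2 x y t)
      (dressG (Y x y t) (M x y t) (matD N lam))
    rw [dressL0_x] at e
    simp only [dressL1, dressL2, Matrix.mul_zero, Matrix.zero_mul, sub_zero, add_zero] at e
    exact congrArg (Complex.I • ·) e
  · intro lam hl x y t
    have hd := (hasMDerivAt_const (1 : Matrix (Fin 2) (Fin 2) ℂ) y).add
      (h.hasMDerivAt_y (matD_mul_jordan_conjTranspose hl) x y t)
    obtain ⟨f1, f2, f3⟩ := hKB lam hl x y t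
    rw [HasMDerivAt.mpdy_eq hd, zero_add, f1, f2, f3,
      laxV_eq (P1 := 0) lam seedQ seedR x y t (by rw [mpdx_potMat_seed, smul_zero]; rfl),
      laxV_eq lam _ _ x y t (h.mpdx_potMat x y t), Matrix.mul_smul, Matrix.smul_mul, ← smul_add]
    have e := darboux_equation (L0 := -(seedQ x y t * seedR x y t) • pauli3)
      (L1 := (2 : ℂ) • offDiag (seedQ x y t) (seedR x y t))
      (L2 := (2 : ℂ) • pauli3) (L3 := 0) lam (h.coeffG 0 x y t) (h.coeffG 1 x y t)
      (h.coeffG 2 x y t) (dressG (Y x y t) (M x y t) (matD N lam))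
    rw [dressL0_y, dressL1_y] at e
    simp only [dressL2, Matrix.mul_zero, Matrix.zero_mul, sub_zero, add_zero] at e
    rw [offDiag_sq (seedQ x y t), Matrix.mul_smul, Matrix.mul_one, Matrix.mul_zero, add_zero,
      ← neg_smul]
    exact congrArg (Complex.I • ·) e
  · intro lam hl x y t
    have hd := (hasMDerivAt_const (1 : Matrix (Fin 2) (Fin 2) ℂ) t).add
      (h.hasMDerivAt_t (matD_mul_jordan_conjTranspose hl) x y t)
    obtain ⟨f1, f2, f3⟩ := hKB lam hl x y t
    have hs : mpdx (potMat seedQ seedR) x y t = Complex.I • (0 : Matrix (Fin 2) (Fin 2) ℂ) := by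
      rw [mpdx_potMat_seed, smul_zero]; rfl
    have hs2 : mpdx (mpdx (potMat seedQ seedR)) x y t = 0 := by
      rw [mpdx_potMat_seed]
      ext i j
      simp [mpdx, pdx]
    rw [HasMDerivAt.mpdt_eq hd, zero_add, f1, f2, f3,
      laxW_eq lam seedQ seedR x y t hs hs2,
      laxW_eq lam _ _ x y t (h.mpdx_potMat x y t) (h.mpdx_mpdx_potMat x y t), Matrix.mul_smul,
      Matrix.smul_mul, ← smul_add]
    have e := darboux_equation
      (L0 := (2 * (seedQ x y t * seedR x y t)) • offDiag (seedQ x y t) (seedR x y t))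
      (L1 := (2 * (seedQ x y t * seedR x y t)) • pauli3)
      (L2 := -(4 : ℂ) • offDiag (seedQ x y t) (seedR x y t)) (L3 := -(4 : ℂ) • pauli3)
      lam (h.coeffG 0 x y t) (h.coeffG 1 x y t)
      (h.coeffG 2 x y t) (dressG (Y x y t) (M x y t) (matD N lam))
    rw [dressL0_t, dressL1_t, dressL2_t] at e
    rw [pow_succ (offDiag (seedQ x y t) _) 2, offDiag_sq (seedQ x y t), Matrix.mul_smul,
      Matrix.mul_one, Matrix.mul_zero, Matrix.zero_mul, Matrix.mul_zero, smul_zero, sub_zero,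
      sub_zero, zero_add, add_zero, Matrix.smul_mul, Matrix.one_mul,
      smul_smul (2 : ℂ) _ (offDiag _ _), smul_smul (2 : ℂ) _ pauli3]
    exact congrArg (Complex.I • ·) e

end IsDressing

end KPLump

namespace KPLump

open PowerSeries

/-! ### The linear system for the wave function -/

lemma expo_odd (c : ℂ) : expo (fun m => if Odd m then c ^ m / (m.factorial : ℂ) else 0)
    = taylor fun z => Complex.sinh (c * z) := by
  ext n
  by_cases hn : Odd n
  · rw [coeff_taylor_sinh_mul c hn, expo, coeff_mk, if_pos hn, if_neg (by rintro rfl; simp at hn)]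
  · rw [coeff_taylor_of_odd (f := fun z => Complex.sinh (c * z)) (by simp)
      (Nat.not_odd_iff_even.1 hn), expo, coeff_mk, if_neg hn, ite_self]

lemma taylor_sinh_two : taylor (fun z => Complex.sinh (2 * z)) = C 2 * (sinhS * coshS) := by
  simp only [Complex.sinh_two_mul, mul_assoc]
  rw [taylor_const_mul 2 ((analyticAt_sinh 0).fun_mul (analyticAt_cosh 0)),
    taylor_mul (analyticAt_sinh 0) (analyticAt_cosh 0)]
  rfl

lemma taylor_sinh_three :
    taylor (fun z => Complex.sinh (3 * z)) = C 4 * sinhS ^ 3 + C 3 * sinhS := by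
  simp only [Complex.sinh_three_mul]
  rw [taylor_add (analyticAt_const.fun_mul ((analyticAt_sinh 0).fun_pow 3))
    (analyticAt_const.fun_mul (analyticAt_sinh 0)),
    taylor_const_mul 4 ((analyticAt_sinh 0).fun_pow 3), taylor_const_mul 3 (analyticAt_sinh 0),
    taylor_pow (analyticAt_sinh 0)]
  rfl

lemma hasDerivAt_coeff_mul_expSeries (P : PowerSeries ℂ) {v : ℝ → ℕ → ℂ} {w : ℕ → ℂ} {s : ℝ}
    (h : ∀ m, HasDerivAt (fun s => v s m) (w m) s) (n : ℕ) :
    HasDerivAt (fun s => coeff n (P * expSeries (v s)))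
      (coeff n (expo w * (P * expSeries (v s)))) s := by
  rw [mul_left_comm]
  simp only [coeff_mul n P]
  exact HasDerivAt.fun_sum fun p _ => (hasDerivAt_schur h p.2).const_mul _

section Flows

variable {N : ℕ} (A : Fin (N - 1) → ℂ)

lemma xMinus_hasDerivAt_x (x y t : ℝ) (m : ℕ) : HasDerivAt (fun s => xMinus A 0 s y t m)
    (if Odd m then 1 ^ m / (m.factorial : ℂ) else 0) x := by
  by_cases hm : Odd m
  · simp only [xMinus, if_pos hm]
    have h := ((((((hasDerivAt_id x).ofReal_comp.add_const (3 * (t : ℂ))).sub_const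
      (2 ^ m * Complex.I * (y : ℂ))).div_const (m.factorial : ℂ)).add_const
      (3 ^ m * (t : ℂ) / (m.factorial : ℂ))).add_const ((starRingEnd ℂ) (aParam A m))).sub_const
      (if m = 1 then ((0 : ℕ) : ℂ) else 0)
    exact h.congr_deriv (by simp)
  · simp only [xMinus, if_neg hm]
    exact hasDerivAt_const _ _

lemma xMinus_hasDerivAt_y (x y t : ℝ) (m : ℕ) : HasDerivAt (fun s => xMinus A 0 x s t m)
    (-Complex.I * (if Odd m then 2 ^ m / (m.factorial : ℂ) else 0)) y := by
  by_cases hm : Odd m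
  · simp only [xMinus, if_pos hm]
    have h := (((((((hasDerivAt_id y).ofReal_comp.const_mul (2 ^ m * Complex.I)).const_sub
      ((x : ℂ) + 3 * t))).div_const (m.factorial : ℂ)).add_const
      (3 ^ m * (t : ℂ) / (m.factorial : ℂ))).add_const ((starRingEnd ℂ) (aParam A m))).sub_const
      (if m = 1 then ((0 : ℕ) : ℂ) else 0)
    exact h.congr_deriv (by simp; ring)
  · simp only [xMinus, if_neg hm, mul_zero]
    exact hasDerivAt_const _ _

lemma xMinus_hasDerivAt_t (x y t : ℝ) (m : ℕ) : HasDerivAt (fun s => xMinus A 0 x y s m)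
    (3 * (if Odd m then 1 ^ m / (m.factorial : ℂ) else 0)
      + (if Odd m then 3 ^ m / (m.factorial : ℂ) else 0)) t := by
  by_cases hm : Odd m
  · simp only [xMinus, if_pos hm]
    have h0 := (hasDerivAt_id t).ofReal_comp
    have h := ((((((h0.const_mul 3).const_add (x : ℂ)).sub_const
      (2 ^ m * Complex.I * (y : ℂ))).div_const (m.factorial : ℂ)).fun_add
      ((h0.const_mul (3 ^ m : ℂ)).div_const (m.factorial : ℂ))).add_const
      ((starRingEnd ℂ) (aParam A m))).sub_const (if m = 1 then ((0 : ℕ) : ℂ) else 0)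
    exact h.congr_deriv (by simp; ring)
  · simp only [xMinus, if_neg hm, mul_zero, add_zero]
    exact hasDerivAt_const _ _

lemma expo_const_mul (c : ℂ) (v : ℕ → ℂ) : expo (fun m => c * v m) = C c * expo v := by
  ext n
  rw [coeff_C_mul]
  by_cases hn : n = 0 <;> simp [expo, hn]

/-- The two components of `sinh κ · Φ`, up to even powers of `κ`, as power series in `κ`. -/
def psiSeries (x y t : ℝ) : Fin 2 → PowerSeries ℂ :=
  ![C (Complex.exp (-(Complex.I * y))) * ((coshS + 1 + sinhS) * expSeries (xMinus A 0 x y t)),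
    C (Complex.I * Complex.exp (Complex.I * y))
      * ((coshS + 1 - sinhS) * expSeries (xMinus A 0 x y t))]

variable (N) in
/-- The first `N` odd coefficients of a pair of power series. -/
def oddRows (F : Fin 2 → PowerSeries ℂ) : Matrix (Fin 2) (Fin N) ℂ :=
  Matrix.of fun c j => coeff (2 * (j : ℕ) + 1) (F c)

lemma oddCoeffs_eq (x y t : ℝ) : oddCoeffs A x y t = oddRows N (psiSeries A x y t) := by
  ext c j
  fin_cases c
  · exact (coeff_C_mul _ _ _).symm
  · exact (coeff_C_mul _ _ _).symm

lemma hasMDerivAt_oddCoeffs_x (x y t : ℝ) : HasMDerivAt (fun s => oddCoeffs A s y t)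
    (oddRows N fun c => sinhS * psiSeries A x y t c) x := by
  have h := fun P n => hasDerivAt_coeff_mul_expSeries P (xMinus_hasDerivAt_x A x y t) n
  have e : expo (fun m => if Odd m then 1 ^ m / (m.factorial : ℂ) else 0) = sinhS := by
    rw [expo_odd]
    simp only [one_mul]
    rfl
  rw [e] at h
  intro c j
  fin_cases c
  · refine ((h (coshS + 1 + sinhS) (2 * (j : ℕ) + 1)).const_mul
      (Complex.exp (-(Complex.I * y)))).congr_deriv ?_
    rw [← coeff_C_mul, mul_left_comm]
    rfl
  · refine ((h (coshS + 1 - sinhS) (2 * (j : ℕ) + 1)).const_mul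
      (Complex.I * Complex.exp (Complex.I * y))).congr_deriv ?_
    rw [← coeff_C_mul, mul_left_comm]
    rfl

lemma hasMDerivAt_oddCoeffs_y (x y t : ℝ) : HasMDerivAt (fun s => oddCoeffs A x s t)
    (oddRows N ![C (-Complex.I) * ((1 + 2 * (sinhS * coshS)) * psiSeries A x y t 0),
      C Complex.I * ((1 - 2 * (sinhS * coshS)) * psiSeries A x y t 1)]) y := by
  have h := fun P n => hasDerivAt_coeff_mul_expSeries P (xMinus_hasDerivAt_y A x y t) n
  rw [expo_const_mul, expo_odd, taylor_sinh_two] at h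
  have h0 := (Complex.ofRealCLM.hasDerivAt (x := y)).const_mul Complex.I
  have c2 : (C 2 : PowerSeries ℂ) = 2 := map_ofNat C 2
  intro c j
  fin_cases c
  · refine (h0.fun_neg.cexp.fun_mul (h (coshS + 1 + sinhS) (2 * (j : ℕ) + 1))).congr_deriv ?_
    rw [← coeff_C_mul, ← coeff_C_mul, ← map_add]
    change _ = coeff (2 * (j : ℕ) + 1)
      (C (-Complex.I) * ((1 + 2 * (sinhS * coshS)) * psiSeries A x y t 0))
    congr 1
    simp [psiSeries, c2]
    ring
  · refine ((h0.cexp.const_mul Complex.I).fun_mul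
      (h (coshS + 1 - sinhS) (2 * (j : ℕ) + 1))).congr_deriv ?_
    rw [← coeff_C_mul, ← coeff_C_mul, ← map_add]
    change _ = coeff (2 * (j : ℕ) + 1)
      (C Complex.I * ((1 - 2 * (sinhS * coshS)) * psiSeries A x y t 1))
    congr 1
    simp [psiSeries, c2]
    ring

lemma hasMDerivAt_oddCoeffs_t (x y t : ℝ) : HasMDerivAt (fun s => oddCoeffs A x y s)
    (oddRows N fun c => 2 * (sinhS * (1 + 2 * coshS ^ 2)) * psiSeries A x y t c) t := by
  have h := fun P n => hasDerivAt_coeff_mul_expSeries P (xMinus_hasDerivAt_t A x y t) n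
  have e : expo (fun m => (3 : ℂ) * (if Odd m then 1 ^ m / (m.factorial : ℂ) else 0)
      + (if Odd m then 3 ^ m / (m.factorial : ℂ) else 0))
      = 2 * (sinhS * (1 + 2 * coshS ^ 2)) := by
    rw [expo_add, expo_const_mul, expo_odd, expo_odd, taylor_sinh_three]
    simp only [one_mul]
    have c3 : (C 3 : PowerSeries ℂ) = 3 := map_ofNat C 3
    have c4 : (C 4 : PowerSeries ℂ) = 4 := map_ofNat C 4
    change C 3 * sinhS + _ = _
    rw [c3, c4]
    linear_combination -4 * sinhS * coshS_sq_sub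
  rw [e] at h
  intro c j
  fin_cases c
  · refine ((h (coshS + 1 + sinhS) (2 * (j : ℕ) + 1)).const_mul
      (Complex.exp (-(Complex.I * y)))).congr_deriv ?_
    rw [← coeff_C_mul, mul_left_comm]
    rfl
  · refine ((h (coshS + 1 - sinhS) (2 * (j : ℕ) + 1)).const_mul
      (Complex.I * Complex.exp (Complex.I * y))).congr_deriv ?_
    rw [← coeff_C_mul, mul_left_comm]
    rfl

lemma oddRows_mul_coshMat (F : Fin 2 → PowerSeries ℂ) :
    oddRows N F * (-Complex.I • coshMat N) = oddRows N fun c => C (-Complex.I) * (coshS * F c) := by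
  ext c j
  have h := sum_antidiagonal_coshS (N := N) (fun k => coeff k (F c)) j
  rw [← coeff_mul] at h
  rw [Matrix.mul_smul, Matrix.smul_apply, Matrix.mul_apply, oddRows, oddRows, Matrix.of_apply,
    coeff_C_mul, smul_eq_mul, h]
  rfl

lemma offDiag_mul_oddRows (q r : ℂ) (F : Fin 2 → PowerSeries ℂ) :
    offDiag q r * oddRows N F = oddRows N ![C r * F 1, C q * F 0] := by
  ext c j
  rw [Matrix.mul_apply, Fin.sum_univ_two]
  fin_cases c <;> simp [offDiag, oddRows]

lemma pauli3_mul_oddRows (F : Fin 2 → PowerSeries ℂ) :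
    pauli3 * oddRows N F = oddRows N ![F 0, -F 1] := by
  ext c j
  rw [Matrix.mul_apply, Fin.sum_univ_two]
  fin_cases c <;> simp [pauli3, oddRows]

lemma oddRows_add (F G : Fin 2 → PowerSeries ℂ) :
    oddRows N F + oddRows N G = oddRows N fun c => F c + G c := by
  ext c j; simp [oddRows]

lemma oddRows_sub (F G : Fin 2 → PowerSeries ℂ) :
    oddRows N F - oddRows N G = oddRows N fun c => F c - G c := by
  ext c j; simp [oddRows]

lemma smul_oddRows (a : ℂ) (F : Fin 2 → PowerSeries ℂ) :
    a • oddRows N F = oddRows N fun c => C a * F c := by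
  ext c j; simp [oddRows]

/-- The linear system of the seed at the point `λ = -i cosh κ` for the power series `ψ`, in the
three variables. -/
lemma oddCoeffs_system (x y t : ℝ) :
    let O := oddCoeffs A x y t
    let Q := offDiag (seedQ x y t) (seedR x y t)
    let L := -Complex.I • coshMat N
    HasMDerivAt (fun s => oddCoeffs A s y t) (Complex.I • (Q * O + pauli3 * O * L)) x ∧
    HasMDerivAt (fun s => oddCoeffs A x s t)
      (Complex.I • (-pauli3 * O + (2 : ℂ) • (Q * O * L) + (2 : ℂ) • (pauli3 * O * L * L))) y ∧
    HasMDerivAt (fun s => oddCoeffs A x y s)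
      (Complex.I • ((2 : ℂ) • (Q * O) + (2 : ℂ) • (pauli3 * O * L) - (4 : ℂ) • (Q * O * L * L)
        - (4 : ℂ) • (pauli3 * O * L * L * L))) t := by
  have hI : (C Complex.I : PowerSeries ℂ) * C Complex.I = -1 := by
    rw [← map_mul, Complex.I_mul_I, map_neg, map_one]
  have huv : (C (Complex.exp (Complex.I * y)) : PowerSeries ℂ)
      * C (Complex.exp (-(Complex.I * y))) = 1 := by
    rw [← map_mul, exp_mul_exp_neg_I, map_one]
  have hq : seedQ x y t = Complex.exp (Complex.I * y) * Complex.exp (Complex.I * y) := by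
    rw [seedQ, ← Complex.exp_add]; congr 1; ring
  have hr : seedR x y t = Complex.exp (-(Complex.I * y)) * Complex.exp (-(Complex.I * y)) := by
    rw [seedR, ← Complex.exp_add]; congr 1; ring
  have c2 : (C 2 : PowerSeries ℂ) = 2 := map_ofNat C 2
  have c4 : (C 4 : PowerSeries ℂ) = 4 := map_ofNat C 4
  have hcs := coshS_sq_sub
  -- the action of the potential matrix on `ψ`
  have h0 : C Complex.I * (C (seedR x y t) * psiSeries A x y t 1)
      = (sinhS - coshS) * psiSeries A x y t 0 := by
    simp only [psiSeries, hr, map_mul, Matrix.cons_val_zero, Matrix.cons_val_one]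
    set u := (C (Complex.exp (Complex.I * y)) : PowerSeries ℂ)
    set v := (C (Complex.exp (-(Complex.I * y))) : PowerSeries ℂ)
    set E := expSeries (xMinus A 0 x y t)
    linear_combination (v * v * u * (coshS + 1 - sinhS) * E) * hI
      - (v * (coshS + 1 - sinhS) * E) * huv + v * E * hcs
  have h1 : C Complex.I * (C (seedQ x y t) * psiSeries A x y t 0)
      = (sinhS + coshS) * psiSeries A x y t 1 := by
    simp only [psiSeries, hq, map_mul, Matrix.cons_val_zero, Matrix.cons_val_one]
    set u := (C (Complex.exp (Complex.I * y)) : PowerSeries ℂ)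
    set v := (C (Complex.exp (-(Complex.I * y))) : PowerSeries ℂ)
    set E := expSeries (xMinus A 0 x y t)
    linear_combination (C Complex.I * u * (coshS + 1 + sinhS) * E) * huv
      - C Complex.I * u * E * hcs
  intro O Q L
  refine ⟨(hasMDerivAt_oddCoeffs_x A x y t).congr_deriv ?_,
    (hasMDerivAt_oddCoeffs_y A x y t).congr_deriv ?_,
    (hasMDerivAt_oddCoeffs_t A x y t).congr_deriv ?_⟩
  · simp only [O, Q, L, oddCoeffs_eq, offDiag_mul_oddRows, pauli3_mul_oddRows,
      oddRows_mul_coshMat, oddRows_add, smul_oddRows]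
    congr 1
    funext c
    fin_cases c <;> simp only [Fin.zero_eta, Fin.mk_one, Matrix.cons_val_zero,
      Matrix.cons_val_one, map_neg]
    · linear_combination -h0 + coshS * psiSeries A x y t 0 * hI
    · linear_combination -h1 - coshS * psiSeries A x y t 1 * hI
  · simp only [O, Q, L, Matrix.neg_mul, oddCoeffs_eq, offDiag_mul_oddRows, pauli3_mul_oddRows,
      oddRows_mul_coshMat, oddRows_add, smul_oddRows, ← neg_one_smul ℂ (oddRows N _)]
    congr 1
    funext c
    fin_cases c <;> simp only [Fin.zero_eta, Fin.mk_one, Matrix.cons_val_zero,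
      Matrix.cons_val_one, map_neg, map_one, c2]
    · linear_combination 2 * coshS * C Complex.I * h0
        - 2 * C Complex.I * coshS ^ 2 * psiSeries A x y t 0 * hI
    · linear_combination 2 * coshS * C Complex.I * h1
        + 2 * C Complex.I * coshS ^ 2 * psiSeries A x y t 1 * hI
  · simp only [O, Q, L, oddCoeffs_eq, offDiag_mul_oddRows, pauli3_mul_oddRows,
      oddRows_mul_coshMat, oddRows_add, oddRows_sub, smul_oddRows]
    congr 1
    funext c
    fin_cases c <;> simp only [Fin.zero_eta, Fin.mk_one, Matrix.cons_val_zero,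
      Matrix.cons_val_one, map_neg, c2, c4]
    · linear_combination (-2 + 4 * coshS ^ 2 * C Complex.I * C Complex.I) * h0
        + (2 * coshS - 4 * coshS ^ 3 * C Complex.I * C Complex.I + 4 * coshS ^ 2 * sinhS)
          * psiSeries A x y t 0 * hI
    · linear_combination (-2 + 4 * coshS ^ 2 * C Complex.I * C Complex.I) * h1
        - (2 * coshS - 4 * coshS ^ 3 * C Complex.I * C Complex.I - 4 * coshS ^ 2 * sinhS)
          * psiSeries A x y t 1 * hI

end Flows

end KPLump

namespace KPLump

open Matrix

/-! ### The matrices `Y` and `M` of the Darboux transformation -/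

section

variable {N : ℕ} {A : Fin (N - 1) → ℂ} {a : ℂ → ℂ}

lemma matY_eq (ha : IsPhase A a) (x y t : ℝ) :
    matY N a x y t = oddCoeffs A x y t * (kappaBasis N)⁻¹ := by
  rw [← matY_mul_kappaBasis ha, Matrix.mul_assoc,
    Matrix.mul_nonsing_inv _ (isUnit_iff_ne_zero.2 (det_kappaBasis_ne_zero N)), Matrix.mul_one]

lemma kappaBasis_inv_mul_jordan (N : ℕ) :
    (kappaBasis N)⁻¹ * jordan N = (-Complex.I • coshMat N) * (kappaBasis N)⁻¹ := by
  have hu : IsUnit (kappaBasis N).det := isUnit_iff_ne_zero.2 (det_kappaBasis_ne_zero N)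
  calc (kappaBasis N)⁻¹ * jordan N
      = (kappaBasis N)⁻¹ * (jordan N * kappaBasis N) * (kappaBasis N)⁻¹ := by
        rw [Matrix.mul_assoc, Matrix.mul_assoc, Matrix.mul_nonsing_inv _ hu, Matrix.mul_one]
    _ = _ := by
        rw [jordan_mul_kappaBasis, ← Matrix.mul_assoc, Matrix.nonsing_inv_mul _ hu, Matrix.one_mul]

/-- The linear system of the seed for the Taylor coefficients of `Φ` at `λ = -i`. -/
lemma matY_system (ha : IsPhase A a) (x y t : ℝ) :
    let Y := matY N a x y t
    let Q := offDiag (seedQ x y t) (seedR x y t)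
    let L := jordan N
    HasMDerivAt (fun s => matY N a s y t) (Complex.I • (Q * Y + pauli3 * Y * L)) x ∧
    HasMDerivAt (fun s => matY N a x s t)
      (Complex.I • (-pauli3 * Y + (2 : ℂ) • (Q * Y * L) + (2 : ℂ) • (pauli3 * Y * L * L))) y ∧
    HasMDerivAt (fun s => matY N a x y s)
      (Complex.I • ((2 : ℂ) • (Q * Y) + (2 : ℂ) • (pauli3 * Y * L) - (4 : ℂ) • (Q * Y * L * L)
        - (4 : ℂ) • (pauli3 * Y * L * L * L))) t := by
  obtain ⟨hx, hy, ht⟩ := oddCoeffs_system A x y t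
  intro Y Q L
  have hL : ∀ Z : Matrix (Fin 2) (Fin N) ℂ,
      Z * (kappaBasis N)⁻¹ * L = Z * (-Complex.I • coshMat N) * (kappaBasis N)⁻¹ := by
    intro Z
    rw [Matrix.mul_assoc, kappaBasis_inv_mul_jordan, Matrix.mul_assoc]
  simp only [Y, matY_eq ha]
  refine ⟨(hx.mul_const (kappaBasis N)⁻¹).congr_deriv ?_,
    (hy.mul_const (kappaBasis N)⁻¹).congr_deriv ?_,
    (ht.mul_const (kappaBasis N)⁻¹).congr_deriv ?_⟩
  all_goals
    simp only [← Matrix.mul_assoc, hL]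
    simp only [Matrix.smul_mul, Matrix.add_mul, Matrix.sub_mul]
    rfl

lemma smooth_matY (ha : IsPhase A a) (c : Fin 2) (k : Fin N) :
    Smooth3 fun x y t => matY N a x y t c k := by
  simp only [matY_eq ha]
  have hv : ∀ m, ContDiff ℝ ∞ fun p : ℝ × ℝ × ℝ => xMinus A 0 p.1 p.2.1 p.2.2 m := by
    intro m
    have h1 : ContDiff ℝ ∞ fun p : ℝ × ℝ × ℝ => (p.1 : ℂ) :=
      Complex.ofRealCLM.contDiff.comp contDiff_fst
    have h2 : ContDiff ℝ ∞ fun p : ℝ × ℝ × ℝ => (p.2.1 : ℂ) :=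
      Complex.ofRealCLM.contDiff.comp (contDiff_fst.comp contDiff_snd)
    have h3 : ContDiff ℝ ∞ fun p : ℝ × ℝ × ℝ => (p.2.2 : ℂ) :=
      Complex.ofRealCLM.contDiff.comp (contDiff_snd.comp contDiff_snd)
    by_cases hm : Odd m
    · simp only [xMinus, if_pos hm]
      exact ((((((h1.add (contDiff_const.mul h3)).sub (contDiff_const.mul h2)).div_const _).add
        ((contDiff_const.mul h3).div_const _)).add contDiff_const).sub contDiff_const)
    · simp only [xMinus, if_neg hm]
      exact contDiff_const
  have hexp : ContDiff ℝ ∞ fun p : ℝ × ℝ × ℝ => Complex.I * (p.2.1 : ℂ) :=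
    contDiff_const.mul (Complex.ofRealCLM.contDiff.comp (contDiff_fst.comp contDiff_snd))
  have hco : ∀ (P : PowerSeries ℂ) (n : ℕ), ContDiff ℝ ∞ fun p : ℝ × ℝ × ℝ =>
      PowerSeries.coeff n (P * expSeries (xMinus A 0 p.1 p.2.1 p.2.2)) := by
    intro P n
    simp only [PowerSeries.coeff_mul]
    exact ContDiff.sum fun q _ => contDiff_const.mul (contDiff_schur hv q.2)
  refine contDiff_matrix_mul (F := fun p : ℝ × ℝ × ℝ => oddCoeffs A p.1 p.2.1 p.2.2)
    (G := fun _ => (kappaBasis N)⁻¹) ?_ (fun i j => contDiff_const) c k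
  intro i j
  fin_cases i
  · exact (Complex.contDiff_exp.comp hexp.neg).mul (hco _ _)
  · exact (contDiff_const.mul (Complex.contDiff_exp.comp hexp)).mul (hco _ _)

lemma smooth_matM (ha : IsPhase A a) (j k : Fin N) :
    Smooth3 fun x y t => matM N a x y t j k := by
  have hX : ∀ (i : Fin N × Fin 2) (j : Fin N),
      ContDiff ℝ ∞ fun p : ℝ × ℝ × ℝ => matX N a p.1 p.2.1 p.2.2 i j := by
    rintro ⟨i, c⟩ j
    by_cases h : i ≤ j
    · simp only [matX, Matrix.of_apply, if_pos h]
      exact smooth_matY ha c ⟨j - i, by omega⟩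
    · simp only [matX, Matrix.of_apply, if_neg h]
      exact contDiff_const
  exact contDiff_matrix_mul (contDiff_matrix_mul
    (F := fun p : ℝ × ℝ × ℝ => (matX N a p.1 p.2.1 p.2.2)ᴴ) (fun i j => contDiff_conj (hX j i))
    (G := fun _ => matS N) fun i j => contDiff_const) hX j k

/-- The coefficients of `1 / (2 i + z - w)`, which appear in `S`. -/
def cauchyCoeff (k l : ℕ) : ℂ :=
  (-1) ^ k * ((k + l).choose k : ℂ) / (2 * Complex.I) ^ (k + l + 1)

lemma cauchyCoeff_succ_succ (k l : ℕ) :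
    2 * Complex.I * cauchyCoeff (k + 1) (l + 1) + cauchyCoeff k (l + 1) - cauchyCoeff (k + 1) l
      = 0 := by
  have h2I : (2 * Complex.I) ≠ 0 := by simp
  have hch : ((k + 1 + (l + 1)).choose (k + 1) : ℂ)
      = ((k + (l + 1)).choose k : ℂ) + ((k + 1 + l).choose (k + 1) : ℂ) := by
    rw [show k + 1 + (l + 1) = (k + (l + 1)) + 1 by ring, Nat.choose_succ_succ,
      show k + (l + 1) = k + 1 + l by ring]
    push_cast
    rfl
  simp only [cauchyCoeff]
  rw [hch, show k + 1 + (l + 1) + 1 = (k + l + 2) + 1 by ring,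
    show k + (l + 1) + 1 = k + l + 2 by ring, show k + 1 + l + 1 = k + l + 2 by ring,
    pow_succ (2 * Complex.I) (k + l + 2), pow_succ (-1 : ℂ) k]
  have := pow_ne_zero (k + l + 2) h2I
  field_simp
  ring

lemma cauchyCoeff_zero_succ (l : ℕ) :
    2 * Complex.I * cauchyCoeff 0 (l + 1) - cauchyCoeff 0 l = 0 := by
  have h2I : (2 * Complex.I) ≠ 0 := by simp
  simp only [cauchyCoeff, Nat.choose_zero_right, zero_add]
  have := pow_ne_zero (l + 1) h2I
  rw [pow_succ _ (l + 1)]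
  field_simp
  ring

lemma cauchyCoeff_succ_zero (k : ℕ) :
    2 * Complex.I * cauchyCoeff (k + 1) 0 + cauchyCoeff k 0 = 0 := by
  have h2I : (2 * Complex.I) ≠ 0 := by simp
  simp only [cauchyCoeff, add_zero, Nat.choose_self]
  have := pow_ne_zero (k + 1) h2I
  rw [pow_succ _ (k + 1), pow_succ (-1 : ℂ) k]
  field_simp
  ring

lemma cauchyCoeff_zero_zero : 2 * Complex.I * cauchyCoeff 0 0 = 1 := by
  simp only [cauchyCoeff, pow_zero, zero_add, Nat.choose_self, Nat.cast_one, mul_one, pow_one]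
  exact mul_one_div_cancel (by simp)

/-- Convolution of `g` with the coefficients of `1 / (2 i + z - w)`. -/
def cauchySum (g : ℕ → ℕ → ℂ) (i j : ℕ) : ℂ :=
  ∑ k ∈ Finset.range (i + 1), ∑ l ∈ Finset.range (j + 1), cauchyCoeff k l * g (i - k) (j - l)

lemma cauchySum_sylvester (g : ℕ → ℕ → ℂ) (i j : ℕ) :
    2 * Complex.I * cauchySum g i j + (if i = 0 then 0 else cauchySum g (i - 1) j)
      - (if j = 0 then 0 else cauchySum g i (j - 1)) = g i j := by
  have e1 : (if i = 0 then 0 else cauchySum g (i - 1) j)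
      = ∑ k ∈ Finset.range (i + 1), ∑ l ∈ Finset.range (j + 1),
        (if k = 0 then 0 else cauchyCoeff (k - 1) l) * g (i - k) (j - l) := by
    cases i with
    | zero => simp
    | succ i =>
      rw [Finset.sum_range_succ']
      simp [cauchySum]
  have e2 : (if j = 0 then 0 else cauchySum g i (j - 1))
      = ∑ k ∈ Finset.range (i + 1), ∑ l ∈ Finset.range (j + 1),
        (if l = 0 then 0 else cauchyCoeff k (l - 1)) * g (i - k) (j - l) := by
    cases j with
    | zero => simp
    | succ j =>
      rw [if_neg (Nat.succ_ne_zero j)]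
      refine Finset.sum_congr rfl fun k _ => ?_
      rw [Finset.sum_range_succ' _ (j + 1)]
      simp
  rw [e1, e2, cauchySum, Finset.mul_sum, ← Finset.sum_add_distrib, ← Finset.sum_sub_distrib]
  have e3 : ∀ k l, 2 * Complex.I * cauchyCoeff k l + (if k = 0 then 0 else cauchyCoeff (k - 1) l)
      - (if l = 0 then 0 else cauchyCoeff k (l - 1)) = if k = 0 ∧ l = 0 then 1 else 0 := by
    intro k l
    rcases k with _ | k <;> rcases l with _ | l
    · simpa using cauchyCoeff_zero_zero
    · simpa using cauchyCoeff_zero_succ l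
    · simpa using cauchyCoeff_succ_zero k
    · simpa using cauchyCoeff_succ_succ k l
  have e4 : ∀ k, (2 * Complex.I * ∑ l ∈ Finset.range (j + 1), cauchyCoeff k l * g (i - k) (j - l)
      + ∑ l ∈ Finset.range (j + 1),
        (if k = 0 then 0 else cauchyCoeff (k - 1) l) * g (i - k) (j - l))
      - ∑ l ∈ Finset.range (j + 1), (if l = 0 then 0 else cauchyCoeff k (l - 1)) * g (i - k) (j - l)
      = if k = 0 then g i j else 0 := by
    intro k
    rw [Finset.mul_sum, ← Finset.sum_add_distrib, ← Finset.sum_sub_distrib]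
    have e5 : ∀ l, 2 * Complex.I * (cauchyCoeff k l * g (i - k) (j - l))
        + (if k = 0 then 0 else cauchyCoeff (k - 1) l) * g (i - k) (j - l)
        - (if l = 0 then 0 else cauchyCoeff k (l - 1)) * g (i - k) (j - l)
        = if l = 0 then (if k = 0 then g i j else 0) else 0 := by
      intro l
      rw [← mul_assoc, ← add_mul, ← sub_mul, e3]
      by_cases hk : k = 0 <;> by_cases hl : l = 0 <;> simp [hk, hl]
    rw [Finset.sum_congr rfl fun l _ => e5 l, Finset.sum_ite_eq']
    simp
  rw [Finset.sum_congr rfl fun k _ => e4 k, Finset.sum_ite_eq']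
  simp

/-- The pairing `Φ^{[i]}† Φ^{[j]}`. -/
def phiPairing (a : ℂ → ℂ) (x y t : ℝ) (i j : ℕ) : ℂ :=
  ∑ c : Fin 2, (starRingEnd ℂ) (phiCoeff a i x y t c) * phiCoeff a j x y t c

lemma sum_fin_ite_le (N : ℕ) (i : Fin N) (f : ℕ → ℂ) :
    ∑ k : Fin N, (if k ≤ i then f k else 0) = ∑ k ∈ Finset.range (i + 1), f k := by
  have h := Finset.sum_range (n := N) fun k => if k ≤ (i : ℕ) then f k else 0
  simp only [Fin.le_def]
  rw [← h, ← Finset.sum_filter]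
  congr 1
  ext k
  simp only [Finset.mem_filter, Finset.mem_range]
  omega

lemma matM_apply (x y t : ℝ) (i j : Fin N) :
    matM N a x y t i j = cauchySum (phiPairing a x y t) i j := by
  have h1 : ∀ k : Fin N, ∀ c : Fin 2, ∀ l : Fin N, ∀ d : Fin 2,
      (matX N a x y t)ᴴ i (k, c) * matS N (k, c) (l, d) * matX N a x y t (l, d) j
        = if c = d then (if k ≤ i then if l ≤ j then cauchyCoeff k l
          * ((starRingEnd ℂ) (phiCoeff a (i - k : ℕ) x y t c)
            * phiCoeff a (j - l : ℕ) x y t c) else 0 else 0) else 0 := by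
    intro k c l d
    rw [Matrix.conjTranspose_apply, matX, matS, Matrix.of_apply, Matrix.of_apply, Matrix.of_apply]
    by_cases hcd : c = d
    · subst hcd
      by_cases hk : k ≤ i <;> by_cases hl : l ≤ j <;> (simp [hk, hl, cauchyCoeff]; try ring)
    · simp [hcd]
  rw [matM, Matrix.mul_apply]
  simp only [Matrix.mul_apply, Finset.sum_mul, Fintype.sum_prod_type, h1]
  rw [cauchySum, ← sum_fin_ite_le N i fun k => ∑ l ∈ Finset.range (j + 1), cauchyCoeff k l
    * phiPairing a x y t (i - k) (j - l)]
  simp only [← sum_fin_ite_le N j]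
  -- reorder the sums over the two block indices and the two components
  have h2 : ∀ l : Fin N, ∑ d : Fin 2, ∑ k : Fin N, ∑ c : Fin 2,
      (if c = d then (if k ≤ i then if l ≤ j then cauchyCoeff k l
          * ((starRingEnd ℂ) (phiCoeff a (i - k : ℕ) x y t c)
            * phiCoeff a (j - l : ℕ) x y t c) else 0 else 0) else 0)
      = ∑ k : Fin N, (if k ≤ i then if l ≤ j then cauchyCoeff k l
          * phiPairing a x y t (i - k) (j - l) else 0 else 0) := by
    intro l
    rw [Finset.sum_comm]
    refine Finset.sum_congr rfl fun k _ => ?_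
    by_cases hk : k ≤ i <;> by_cases hl : l ≤ j <;>
      simp [hk, hl, phiPairing, mul_add]
  rw [Finset.sum_congr rfl fun l _ => h2 l, Finset.sum_comm]
  refine Finset.sum_congr rfl fun k _ => ?_
  by_cases hk : k ≤ i <;> simp [hk]

/-- `M = X† S X` solves the Sylvester equation. -/
lemma sylvester_matM (N : ℕ) (a : ℂ → ℂ) (x y t : ℝ) :
    (jordan N)ᴴ * matM N a x y t - matM N a x y t * jordan N
      = (matY N a x y t)ᴴ * matY N a x y t := by
  ext i j
  have hs := cauchySum_sylvester (phiPairing a x y t) i j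
  have hR : ((matY N a x y t)ᴴ * matY N a x y t) i j = phiPairing a x y t i j := by
    rw [Matrix.mul_apply, phiPairing]
    rfl
  have hshift : ∀ f : ℕ → ℂ, ∀ i : Fin N,
      (∑ l : Fin N, (if (l : ℕ) + 1 = i then f l else 0))
        = if (i : ℕ) = 0 then 0 else f (i - 1) := by
    intro f i
    by_cases hi : (i : ℕ) = 0
    · rw [if_pos hi]
      exact Finset.sum_eq_zero fun l _ => if_neg (by omega)
    · rw [if_neg hi, Finset.sum_eq_single_of_mem (⟨i - 1, by omega⟩ : Fin N) (Finset.mem_univ _)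
        fun l _ hl => if_neg fun h => hl (Fin.ext (by simp; omega))]
      exact if_pos (by simp; omega)
  have hL : ((jordan N)ᴴ * matM N a x y t) i j = Complex.I * cauchySum (phiPairing a x y t) i j
      + (if (i : ℕ) = 0 then 0 else cauchySum (phiPairing a x y t) (i - 1) j) := by
    rw [Matrix.mul_apply, ← hshift fun l => cauchySum (phiPairing a x y t) l j]
    have : ∀ l : Fin N, (jordan N)ᴴ i l * matM N a x y t l j
        = (if l = i then Complex.I * cauchySum (phiPairing a x y t) l j else 0)
          + (if (l : ℕ) + 1 = i then cauchySum (phiPairing a x y t) l j else 0) := by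
      intro l
      rw [Matrix.conjTranspose_apply, jordan, Matrix.of_apply, matM_apply]
      by_cases h : l = i
      · subst h; simp
      · by_cases h' : (l : ℕ) + 1 = i
        · simp [h, h']
        · simp [h, h']
    rw [Finset.sum_congr rfl fun l _ => this l, Finset.sum_add_distrib, Finset.sum_ite_eq']
    simp
  have hR2 : (matM N a x y t * jordan N) i j = -Complex.I * cauchySum (phiPairing a x y t) i j
      + (if (j : ℕ) = 0 then 0 else cauchySum (phiPairing a x y t) i (j - 1)) := by
    rw [Matrix.mul_apply, ← hshift fun l => cauchySum (phiPairing a x y t) i l]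
    have : ∀ l : Fin N, matM N a x y t i l * jordan N l j
        = (if l = j then -Complex.I * cauchySum (phiPairing a x y t) i l else 0)
          + (if (l : ℕ) + 1 = j then cauchySum (phiPairing a x y t) i l else 0) := by
      intro l
      rw [jordan, Matrix.of_apply, matM_apply]
      by_cases h : l = j
      · subst h; simp [mul_comm]
      · by_cases h' : (l : ℕ) + 1 = j
        · simp [h, h']
        · simp [h, h']
    rw [Finset.sum_congr rfl fun l _ => this l, Finset.sum_add_distrib, Finset.sum_ite_eq']
    simp
  rw [Matrix.sub_apply, hL, hR2, hR, ← hs]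
  ring

lemma phiCoeff_zero_ne_zero (a : ℂ → ℂ) (x y t : ℝ) : ∃ c, phiCoeff a 0 x y t c ≠ 0 := by
  have hxi : xi (-Complex.I) = 0 := by simp [xi]
  by_contra! h
  have h0 := h 0
  have h1 := h 1
  simp only [phiCoeff, iteratedDeriv_zero, phi, sinOverXi, hxi, zero_mul, Complex.cos_zero,
    Nat.factorial_zero, Nat.cast_one, div_one, Matrix.cons_val_zero, Matrix.cons_val_one,
    dslope_same, Complex.deriv_sin, mul_one, mul_eq_zero, Complex.exp_ne_zero, false_or] at h0 h1
  have hI := Complex.I_mul_I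
  have h2 : (Complex.I * -Complex.I + 1) * omega a (-Complex.I) x y t = 1 := by
    have : Complex.I * ((Complex.I * -Complex.I + 1) * omega a (-Complex.I) x y t - 1) = 0 := by
      linear_combination h1
    linear_combination (mul_eq_zero.1 this).resolve_left Complex.I_ne_zero
  rw [h2] at h0
  norm_num at h0

lemma det_matM_ne_zero (N : ℕ) (a : ℂ → ℂ) (x y t : ℝ) : (matM N a x y t).det ≠ 0 := by
  refine det_ne_zero_of_sylvester (sylvester_matM N a x y t) fun l hl => ?_
  obtain ⟨c, hc⟩ := phiCoeff_zero_ne_zero a x y t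
  refine ⟨c, ?_⟩
  rw [matY, Matrix.of_apply, hl]
  exact hc

/-- The Darboux transformation of the plane wave is a dressing. -/
theorem isDressing (ha : IsPhase A a) : IsDressing (matY N a) (matM N a) where
  smooth_Y := smooth_matY ha
  smooth_M := smooth_matM ha
  det_ne_zero := det_matM_ne_zero N a
  sylvester := sylvester_matM N a
  flow_x x y t := (matY_system ha x y t).1
  flow_y x y t := (matY_system ha x y t).2.1
  flow_t x y t := (matY_system ha x y t).2.2

lemma newQ_eq_darbouxQ (ha : IsPhase A a) : (isDressing ha).newQ = darbouxQ N a := by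
  funext x y t
  simp only [IsDressing.newQ, IsDressing.coeffG, dressG, pow_zero, Matrix.mul_one, darbouxQ]

lemma newR_eq_conj_darbouxQ (ha : IsPhase A a) :
    (isDressing ha).newR = fun x y t => (starRingEnd ℂ) (darbouxQ N a x y t) := by
  rw [← newQ_eq_darbouxQ ha]
  funext x y t
  exact ((isDressing ha).conj_newQ x y t).symm

/-! ### The determinant formula -/

lemma conjTranspose_coshMat (N : ℕ) : (coshMat N)ᴴ = (coshMat N)ᵀ := by
  have h : ∀ m : ℕ, (starRingEnd ℂ) (PowerSeries.coeff (2 * m) coshS)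
      = PowerSeries.coeff (2 * m) coshS := by
    intro m
    have h1 : PowerSeries.coeff (2 * m) coshS = schur unitOne (2 * m) := by
      rw [schur_eq_coeff, expSeries_unitOne, map_add, coeff_sinhS_of_even (even_two_mul m),
        add_zero]
    rw [h1, ← schur_conj]
    congr 1
    funext k
    by_cases hk : k = 1 <;> simp [unitOne, hk]
  ext i j
  rw [Matrix.conjTranspose_apply, Matrix.transpose_apply, coshMat, Matrix.of_apply]
  by_cases hij : j ≤ i
  · simp only [if_pos hij]
    exact h _
  · simp [hij]

lemma matM_eq (ha : IsPhase A a) (x y t : ℝ) :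
    matM N a x y t
      = (-4 * Complex.I) • ((kappaBasis N)⁻¹ᴴ * tauMat A 0 x y t * (kappaBasis N)⁻¹) := by
  refine sylvester_unique (sylvester_matM N a x y t) ?_
  have hJ := kappaBasis_inv_mul_jordan N
  have hK : (jordan N)ᴴ * (kappaBasis N)⁻¹ᴴ
      = (kappaBasis N)⁻¹ᴴ * (Complex.I • (coshMat N)ᵀ) := by
    rw [← Matrix.conjTranspose_mul, hJ, Matrix.conjTranspose_mul, Matrix.conjTranspose_smul,
      conjTranspose_coshMat]
    simp
  rw [matY_eq ha, Matrix.conjTranspose_mul, Matrix.mul_smul, Matrix.smul_mul]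
  have e1 : (jordan N)ᴴ * ((kappaBasis N)⁻¹ᴴ * tauMat A 0 x y t * (kappaBasis N)⁻¹)
      = Complex.I • ((kappaBasis N)⁻¹ᴴ * ((coshMat N)ᵀ * tauMat A 0 x y t)
        * (kappaBasis N)⁻¹) := by
    rw [← Matrix.mul_assoc, ← Matrix.mul_assoc, hK]
    simp only [Matrix.mul_assoc, Matrix.mul_smul, Matrix.smul_mul]
  have e2 : (kappaBasis N)⁻¹ᴴ * tauMat A 0 x y t * (kappaBasis N)⁻¹ * jordan N
      = -Complex.I • ((kappaBasis N)⁻¹ᴴ * (tauMat A 0 x y t * coshMat N)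
        * (kappaBasis N)⁻¹) := by
    rw [Matrix.mul_assoc, hJ]
    simp only [Matrix.mul_assoc, Matrix.mul_smul, Matrix.smul_mul]
  have e3 : (kappaBasis N)⁻¹ᴴ * (oddCoeffs A x y t)ᴴ * (oddCoeffs A x y t * (kappaBasis N)⁻¹)
      = (4 : ℂ) • ((kappaBasis N)⁻¹ᴴ * ((coshMat N)ᵀ * tauMat A 0 x y t
        + tauMat A 0 x y t * coshMat N) * (kappaBasis N)⁻¹) := by
    rw [sylvester_tauMat]
    simp only [Matrix.mul_assoc, Matrix.mul_smul, Matrix.smul_mul, smul_smul]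
    norm_num
  rw [e1, e2, e3, Matrix.mul_add, Matrix.add_mul, smul_smul, smul_smul, smul_add]
  have c1 : -4 * Complex.I * Complex.I = 4 := by linear_combination -4 * Complex.I_mul_I
  have c2 : -4 * Complex.I * -Complex.I = -4 := by linear_combination 4 * Complex.I_mul_I
  rw [c1, c2]
  module

/-- The perturbation of `M` that corresponds to passing from `σ_0` to `σ_1`. -/
lemma matM_add_eq (ha : IsPhase A a) (x y t : ℝ) :
    matM N a x y t + Matrix.replicateCol Unit (fun j => 2 * seedR x y t
        * (starRingEnd ℂ) (matY N a x y t 0 j))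
        * Matrix.replicateRow Unit (matY N a x y t 1)
      = (-4 * Complex.I) • ((kappaBasis N)⁻¹ᴴ * tauMat A 1 x y t * (kappaBasis N)⁻¹) := by
  have h1 : tauMat A 1 x y t = tauMat A 0 x y t + (Complex.I / 2 * seedR x y t) •
      (Matrix.replicateCol Unit (fun j => (starRingEnd ℂ) (oddCoeffs A x y t 0 j))
        * Matrix.replicateRow Unit (oddCoeffs A x y t 1)) := by
    ext i j
    have := tauMat_sub A x y t i j
    simp only [Matrix.add_apply, Matrix.smul_apply, Matrix.mul_apply, Matrix.replicateCol_apply,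
      Matrix.replicateRow_apply, smul_eq_mul, Finset.univ_unique, Finset.sum_singleton, seedR]
    linear_combination -this
  have h2 : Matrix.replicateCol Unit (fun j => 2 * seedR x y t
        * (starRingEnd ℂ) (matY N a x y t 0 j))
      = (2 * seedR x y t) • ((kappaBasis N)⁻¹ᴴ
        * Matrix.replicateCol Unit (fun j => (starRingEnd ℂ) (oddCoeffs A x y t 0 j))) := by
    ext i j
    simp only [Matrix.replicateCol_apply, Matrix.smul_apply, Matrix.mul_apply, smul_eq_mul,
      matY_eq ha, map_sum, map_mul, Matrix.conjTranspose_apply]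
    congr 1
    exact Finset.sum_congr rfl fun k _ => mul_comm _ _
  have h3 : Matrix.replicateRow Unit (matY N a x y t 1)
      = Matrix.replicateRow Unit (oddCoeffs A x y t 1) * (kappaBasis N)⁻¹ := by
    ext i j
    simp only [Matrix.replicateRow_apply, Matrix.mul_apply, matY_eq ha]
  rw [h1, h2, h3, matM_eq ha, Matrix.mul_add, Matrix.add_mul, smul_add]
  congr 1
  simp only [Matrix.mul_smul, Matrix.smul_mul, smul_smul, Matrix.mul_assoc]
  congr 1
  linear_combination 2 * seedR x y t * Complex.I_mul_I

lemma sigma_zero_ne_zero (A : Fin (N - 1) → ℂ) (x y t : ℝ) : sigma A 0 x y t ≠ 0 := by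
  obtain ⟨a, ha⟩ := exists_isPhase A
  have h := det_matM_ne_zero N a x y t
  rw [matM_eq ha, Matrix.det_smul, Matrix.det_mul, Matrix.det_mul] at h
  rw [sigma_eq_det]
  intro h0
  rw [h0] at h
  simp at h

/-- The determinant formula, a consequence of the matrix determinant lemma. -/
theorem darbouxQ_eq (ha : IsPhase A a) (x y t : ℝ) :
    darbouxQ N a x y t
      = Complex.exp (2 * Complex.I * y) * (sigma A 1 x y t / sigma A 0 x y t) := by
  have hd := det_matM_ne_zero N a x y t
  have h1 := Matrix.det_add_replicateCol_mul_replicateRow (isUnit_iff_ne_zero.2 hd)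
    (fun j => 2 * seedR x y t * (starRingEnd ℂ) (matY N a x y t 0 j)) (matY N a x y t 1)
    (ι := Unit)
  have h2 := congrArg Matrix.det (matM_eq ha x y t)
  have h3 : (1 + Matrix.replicateRow Unit (matY N a x y t 1) * (matM N a x y t)⁻¹
      * Matrix.replicateCol Unit (fun j => 2 * seedR x y t
        * (starRingEnd ℂ) (matY N a x y t 0 j))).det
      = 1 + 2 * seedR x y t
        * (matY N a x y t * (matM N a x y t)⁻¹ * (matY N a x y t)ᴴ) 1 0 := by
    rw [Matrix.det_unique, Matrix.add_apply, Matrix.one_apply_eq, Matrix.mul_apply,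
      Matrix.mul_apply, Finset.mul_sum]
    congr 1
    refine Finset.sum_congr rfl fun k _ => ?_
    rw [Matrix.replicateCol_apply, mul_left_comm, Matrix.mul_apply, Matrix.mul_apply]
    rfl
  rw [matM_add_eq ha, h3] at h1
  rw [h2, Matrix.det_smul, Matrix.det_smul, Matrix.det_mul, Matrix.det_mul, Matrix.det_mul,
    Matrix.det_mul, ← sigma_eq_det, ← sigma_eq_det] at h1
  rw [h2, Matrix.det_smul, Matrix.det_mul, Matrix.det_mul, ← sigma_eq_det] at hd
  have h4 : sigma A 1 x y t = sigma A 0 x y t * (1 + 2 * seedR x y t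
      * (matY N a x y t * (matM N a x y t)⁻¹ * (matY N a x y t)ᴴ) 1 0) := by
    have hk : (-4 * Complex.I) ^ Fintype.card (Fin N)
        * ((kappaBasis N)⁻¹ᴴ.det * (kappaBasis N)⁻¹.det) ≠ 0 := by
      intro h0
      apply hd
      linear_combination sigma A 0 x y t * h0
    refine mul_left_cancel₀ hk ?_
    linear_combination h1
  rw [h4, mul_div_cancel_left₀ _ (sigma_zero_ne_zero A x y t), darbouxQ,
    show Complex.exp (2 * Complex.I * y) = seedQ x y t from rfl]
  linear_combination -2 * (matY N a x y t * (matM N a x y t)⁻¹ * (matY N a x y t)ᴴ) 1 0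
    * seedQ_mul_seedR x y t

end

end KPLump

namespace KPLump

open Filter Topology

/-! ### Asymptotics of the determinants -/

section Schur

variable {α : Type*} {l : Filter α}

/-- If the first variable dominates, then the Schur polynomial `S_j` behaves like `x_1^j / j!`. -/
lemma tendsto_schur_div_pow {v : α → ℕ → ℂ} {z : α → ℂ}
    (h1 : Tendsto (fun p => v p 1 / z p) l (𝓝 1))
    (h2 : ∀ m, 2 ≤ m → Tendsto (fun p => v p m / z p ^ m) l (𝓝 0)) (j : ℕ) :
    Tendsto (fun p => schur (v p) j / z p ^ j) l (𝓝 (1 / (j.factorial : ℂ))) := by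
  induction j using Nat.strong_induction_on with
  | _ j ih =>
    cases j with
    | zero => simpa [schur_zero] using tendsto_const_nhds
    | succ n =>
      have e : ∀ p, schur (v p) (n + 1) / z p ^ (n + 1)
          = (∑ k ∈ Finset.range (n + 1), (v p (k + 1) / z p ^ (k + 1) * ((k : ℂ) + 1))
            * (schur (v p) (n - k) / z p ^ (n - k))) / ((n : ℂ) + 1) := by
        intro p
        rw [schur_succ, div_right_comm, Finset.sum_div]
        congr 1
        refine Finset.sum_congr rfl fun k hk => ?_
        rw [Finset.mem_range] at hk
        rw [div_mul_eq_mul_div, div_mul_div_comm, ← pow_add, show k + 1 + (n - k) = n + 1 by omega]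
      simp only [e]
      have hlim : Tendsto (fun p => (∑ k ∈ Finset.range (n + 1),
          (v p (k + 1) / z p ^ (k + 1) * ((k : ℂ) + 1))
            * (schur (v p) (n - k) / z p ^ (n - k))) / ((n : ℂ) + 1)) l
          (𝓝 ((∑ k ∈ Finset.range (n + 1), ((if k = 0 then 1 else 0) * ((k : ℂ) + 1))
            * (1 / ((n - k).factorial : ℂ))) / ((n : ℂ) + 1))) := by
        refine Tendsto.div_const (tendsto_finsetSum _ fun k _ => ?_) _
        refine Tendsto.mul (Tendsto.mul_const _ ?_) (ih (n - k) (by omega))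
        by_cases hk : k = 0
        · subst hk; simpa using h1
        · rw [if_neg hk]
          exact h2 (k + 1) (by omega)
      convert hlim using 2
      rw [Finset.sum_eq_single_of_mem 0 (by simp) fun k _ hk => by simp [hk]]
      rw [Nat.factorial_succ]
      push_cast
      simp
      ring

lemma tendsto_inv_of_norm_atTop {w : α → ℂ} (hw : Tendsto (fun p => ‖w p‖) l atTop) :
    Tendsto (fun p => (w p)⁻¹) l (𝓝 0) := by
  rw [tendsto_zero_iff_norm_tendsto_zero]
  exact hw.inv_tendsto_atTop.congr fun p => (norm_inv _).symm

/-- Schur polynomials in variables which are real-affine functions of `w → ∞`. -/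
lemma tendsto_schur_affine {v : α → ℕ → ℂ} {w : α → ℂ} {b c d : ℕ → ℂ}
    (hw : Tendsto (fun p => ‖w p‖) l atTop) (hb : b 1 = 1) (hc : c 1 = 0)
    (hv : ∀ m, 1 ≤ m → ∀ p, v p m = b m * w p + c m * (starRingEnd ℂ) (w p) + d m) (j : ℕ) :
    Tendsto (fun p => schur (v p) j / w p ^ j) l (𝓝 (1 / (j.factorial : ℂ))) := by
  have hinv := tendsto_inv_of_norm_atTop hw
  refine tendsto_schur_div_pow ?_ ?_ j
  · have h : Tendsto (fun p => 1 + d 1 * (w p)⁻¹) l (𝓝 (1 + d 1 * 0)) :=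
      (hinv.const_mul _).const_add 1
    rw [mul_zero, add_zero] at h
    refine h.congr' ?_
    filter_upwards [hw.eventually_gt_atTop 0] with p hp
    have hp0 : w p ≠ 0 := norm_pos_iff.1 hp
    rw [hv 1 le_rfl, hb, hc]
    field_simp
    ring
  · intro m hm
    obtain ⟨k, rfl⟩ : ∃ k, m = k + 2 := ⟨m - 2, by omega⟩
    have hn : ∀ u : α → ℂ, (∀ p, ‖u p‖ = ‖w p‖) →
        Tendsto (fun p => u p / w p ^ (k + 2)) l (𝓝 0) := by
      intro u hu
      rw [tendsto_zero_iff_norm_tendsto_zero]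
      have h3 : Tendsto (fun p => (‖w p‖⁻¹) ^ (k + 1)) l (𝓝 (0 ^ (k + 1))) :=
        hw.inv_tendsto_atTop.pow (k + 1)
      rw [zero_pow (Nat.succ_ne_zero k)] at h3
      refine h3.congr fun p => ?_
      rw [norm_div, norm_pow, hu]
      by_cases h0 : ‖w p‖ = 0
      · simp [h0]
      · rw [pow_succ ‖w p‖ (k + 1), inv_pow]
        field_simp
    have h1 := hn w fun _ => rfl
    have h2 := hn (fun p => (starRingEnd ℂ) (w p)) fun p => by simp
    have h3 : Tendsto (fun p => ((w p)⁻¹) ^ (k + 2)) l (𝓝 (0 ^ (k + 2))) := hinv.pow _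
    rw [zero_pow (by omega)] at h3
    have h4 := ((h1.const_mul (b (k + 2))).add (h2.const_mul (c (k + 2)))).add
      (h3.const_mul (d (k + 2)))
    simp only [mul_zero, add_zero] at h4
    refine h4.congr fun p => ?_
    rw [hv (k + 2) (by omega), inv_pow]
    ring

end Schur

/-- The limit of the normalized Schur polynomials. -/
def schurLimit (i ν : ℕ) : ℂ := if ν ≤ i then (1 / 2) ^ ν * (1 / ((i - ν).factorial : ℂ)) else 0

/-- The leading coefficients of the first `N` columns are, up to factors, the values of descending
factorials at the points `2 i + 1`. -/
lemma det_schurLimit_ne_zero (N : ℕ) :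
    (Matrix.of fun i ν : Fin N => schurLimit (2 * (i : ℕ) + 1) ν).det ≠ 0 := by
  have e : (Matrix.of fun i ν : Fin N => schurLimit (2 * (i : ℕ) + 1) ν)
      = Matrix.diagonal (fun i : Fin N => 1 / ((2 * (i : ℕ) + 1).factorial : ℂ))
        * Matrix.of (fun i ν : Fin N =>
          (descPochhammer ℂ ν).eval (((2 * (i : ℕ) + 1 : ℕ) : ℂ)))
        * Matrix.diagonal (fun ν : Fin N => (1 / 2 : ℂ) ^ (ν : ℕ)) := by
    ext i ν
    rw [Matrix.mul_diagonal, Matrix.diagonal_mul, Matrix.of_apply, Matrix.of_apply,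
      descPochhammer_eval_eq_descFactorial, schurLimit]
    by_cases h : (ν : ℕ) ≤ 2 * (i : ℕ) + 1
    · have h1 := Nat.factorial_mul_descFactorial h
      have h2 : ((2 * (i : ℕ) + 1 - (ν : ℕ)).factorial : ℂ)
          * ((2 * (i : ℕ) + 1).descFactorial ν : ℂ) = ((2 * (i : ℕ) + 1).factorial : ℂ) := by
        exact_mod_cast h1
      have h3 : ((2 * (i : ℕ) + 1 - (ν : ℕ)).factorial : ℂ) ≠ 0 := by
        exact_mod_cast Nat.factorial_ne_zero _
      have h4 : ((2 * (i : ℕ) + 1).factorial : ℂ) ≠ 0 := by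
        exact_mod_cast Nat.factorial_ne_zero _
      rw [if_pos h]
      field_simp
      rw [← h2]
    · rw [if_neg h, Nat.descFactorial_of_lt (by omega)]
      simp
  rw [e, Matrix.det_mul, Matrix.det_mul, Matrix.det_diagonal, Matrix.det_diagonal,
    ← Matrix.det_eval_matrixOfPolynomials_eq_det_vandermonde
      (fun i : Fin N => (((2 * (i : ℕ) + 1 : ℕ) : ℂ))) (fun ν : Fin N => descPochhammer ℂ ν)
      (fun ν => descPochhammer_natDegree ℂ ν) (fun ν => monic_descPochhammer ℂ ν)]
  refine mul_ne_zero (mul_ne_zero ?_ ?_) ?_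
  · exact Finset.prod_ne_zero_iff.2 fun i _ =>
      one_div_ne_zero (by exact_mod_cast Nat.factorial_ne_zero _)
  · rw [Matrix.det_vandermonde_ne_zero_iff]
    intro i j hij
    have : 2 * (i : ℕ) + 1 = 2 * (j : ℕ) + 1 := Nat.cast_injective (R := ℂ) hij
    exact Fin.ext (by omega)
  · exact Finset.prod_ne_zero_iff.2 fun i _ => pow_ne_zero _ (by norm_num)

/-- The dominant part of a determinant `det (L₁ E R₁ + ε^N L₂ E R₂)`, `E = diag (1, ε, …, ε^{N-1})`,
as `ε → 0`: factor out `L₁ E` from the left, where `ε^N E⁻¹ → 0`. -/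
lemma exists_tendsto_det {α : Type*} {l : Filter α} {N : ℕ}
    {L1 L2 R1 R2 : α → Matrix (Fin N) (Fin N) ℂ} {b b2 b' b2' : Matrix (Fin N) (Fin N) ℂ}
    {ε : α → ℂ} (hL1 : Tendsto L1 l (𝓝 b)) (hL2 : Tendsto L2 l (𝓝 b2))
    (hR1 : Tendsto R1 l (𝓝 b')) (hR2 : Tendsto R2 l (𝓝 b2')) (hε : Tendsto ε l (𝓝 0))
    (hb : b.det ≠ 0) :
    ∃ h : α → ℂ, Tendsto h l (𝓝 (b.det * b'.det)) ∧ ∀ᶠ p in l,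
      (L1 p * Matrix.diagonal (fun ν : Fin N => ε p ^ (ν : ℕ)) * R1 p
        + ε p ^ N • (L2 p * Matrix.diagonal (fun ν : Fin N => ε p ^ (ν : ℕ)) * R2 p)).det
        = (Matrix.diagonal (fun ν : Fin N => ε p ^ (ν : ℕ))).det * h p := by
  set E : α → Matrix (Fin N) (Fin N) ℂ := fun p => Matrix.diagonal fun ν : Fin N => ε p ^ (ν : ℕ)
    with hE
  set F : α → Matrix (Fin N) (Fin N) ℂ :=
    fun p => Matrix.diagonal fun ν : Fin N => ε p ^ (N - (ν : ℕ)) with hF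
  set P : α → Matrix (Fin N) (Fin N) ℂ :=
    fun p => (L1 p).det⁻¹ • ((L1 p).adjugate * L2 p) with hP
  have hdet : Tendsto (fun p => (L1 p).det) l (𝓝 b.det) :=
    ((continuous_id.matrix_det).tendsto b).comp hL1
  have hEt : Tendsto E l (𝓝 (Matrix.diagonal fun ν : Fin N => (0 : ℂ) ^ (ν : ℕ))) :=
    ((continuous_id.matrix_diagonal).tendsto _).comp
      (tendsto_pi_nhds.2 fun ν : Fin N => hε.pow (ν : ℕ))
  have hFt : Tendsto F l (𝓝 0) := by
    have h1 : Tendsto (fun p => fun ν : Fin N => ε p ^ (N - (ν : ℕ))) l (𝓝 0) := by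
      refine tendsto_pi_nhds.2 fun ν => ?_
      have h2 := hε.pow (N - (ν : ℕ))
      rwa [zero_pow (by omega)] at h2
    have h3 : Tendsto F l (𝓝 (Matrix.diagonal 0)) :=
      ((continuous_id.matrix_diagonal).tendsto (0 : Fin N → ℂ)).comp h1
    simpa using h3
  have hPt : Tendsto P l (𝓝 (b.det⁻¹ • (b.adjugate * b2))) :=
    (hdet.inv₀ hb).smul ((((continuous_id.matrix_adjugate).tendsto b).comp hL1).mul hL2)
  have hin : Tendsto (fun p => R1 p + F p * P p * E p * R2 p) l (𝓝 b') := by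
    have h := hR1.add (((hFt.mul hPt).mul hEt).mul hR2)
    simpa only [zero_mul, add_zero] using h
  refine ⟨fun p => (L1 p).det * (R1 p + F p * P p * E p * R2 p).det,
    hdet.mul (((continuous_id.matrix_det).tendsto b').comp hin), ?_⟩
  filter_upwards [hdet.eventually_ne hb] with p hp
  have hEF : E p * F p = ε p ^ N • (1 : Matrix (Fin N) (Fin N) ℂ) := by
    rw [hE, hF]
    simp only [Matrix.diagonal_mul_diagonal, ← pow_add]
    ext i j
    by_cases hij : i = j
    · subst hij
      simp
    · simp [hij]
  have hLP : L1 p * P p = L2 p := by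
    rw [hP]
    simp only [Matrix.mul_smul]
    rw [← Matrix.mul_assoc, Matrix.mul_adjugate, Matrix.smul_mul, Matrix.one_mul, smul_smul,
      inv_mul_cancel₀ hp, one_smul]
  have hfac : L1 p * E p * R1 p + ε p ^ N • (L2 p * E p * R2 p)
      = L1 p * E p * (R1 p + F p * P p * E p * R2 p) := by
    rw [Matrix.mul_add]
    congr 1
    have : L1 p * E p * (F p * P p * E p * R2 p) = L1 p * (E p * F p) * P p * E p * R2 p := by
      simp only [Matrix.mul_assoc]
    rw [this, hEF, Matrix.mul_smul (L1 p) (ε p ^ N) (1 : Matrix (Fin N) (Fin N) ℂ),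
      Matrix.mul_one, Matrix.smul_mul, hLP, Matrix.smul_mul, Matrix.smul_mul]
  rw [hfac, Matrix.det_mul, Matrix.det_mul]
  ring

section Sigma

variable {N : ℕ} (A : Fin (N - 1) → ℂ)

/-- The complex coordinate `x + 2 i y` in which the lump is localized. -/
def planeCoord (p : ℝ × ℝ) : ℂ := p.1 + 2 * Complex.I * p.2

lemma norm_le_norm_planeCoord (p : ℝ × ℝ) : ‖p‖ ≤ ‖planeCoord p‖ := by
  have hre : (planeCoord p).re = p.1 := by simp [planeCoord]
  have him : (planeCoord p).im = 2 * p.2 := by simp [planeCoord]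
  rw [Prod.norm_def, max_le_iff]
  constructor
  · rw [← hre]; exact Complex.abs_re_le_norm _
  · refine le_trans ?_ (Complex.abs_im_le_norm _)
    rw [him, abs_mul, Real.norm_eq_abs, abs_two]
    linarith [abs_nonneg p.2]

lemma tendsto_norm_planeCoord :
    Tendsto (fun p => ‖planeCoord p‖) (cocompact (ℝ × ℝ)) atTop :=
  tendsto_atTop_mono norm_le_norm_planeCoord tendsto_norm_cocompact_atTop

/-- The normalized Schur polynomials of `x^+ + ν s`. -/
def scaledPlus (n : ℕ) (t : ℝ) (p : ℝ × ℝ) (i ν : ℕ) : ℂ :=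
  if ν ≤ i then (1 / 2) ^ ν
    * (schur (fun m => xPlus A n (p.1 - 3 * t) p.2 t m + ν * sCoeff m) (i - ν)
    / planeCoord p ^ (i - ν)) else 0

/-- The normalized Schur polynomials of `x^- + ν s`. -/
def scaledMinus (n : ℕ) (t : ℝ) (p : ℝ × ℝ) (i ν : ℕ) : ℂ :=
  if ν ≤ i then (1 / 2) ^ ν
    * (schur (fun m => xMinus A n (p.1 - 3 * t) p.2 t m + ν * sCoeff m) (i - ν)
    / (starRingEnd ℂ) (planeCoord p) ^ (i - ν)) else 0

lemma tendsto_scaledPlus (n : ℕ) (t : ℝ) (i ν : ℕ) :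
    Tendsto (fun p => scaledPlus A n t p i ν) (cocompact (ℝ × ℝ)) (𝓝 (schurLimit i ν)) := by
  unfold scaledPlus schurLimit
  by_cases h : ν ≤ i
  · simp only [if_pos h]
    refine Tendsto.const_mul _ ?_
    refine tendsto_schur_affine
      (b := fun m => if Odd m then (1 / 2 + 2 ^ m / 4) / (m.factorial : ℂ) else 0)
      (c := fun m => if Odd m then (1 / 2 - 2 ^ m / 4) / (m.factorial : ℂ) else 0)
      (d := fun m => (if Odd m then 3 ^ m * (t : ℂ) / (m.factorial : ℂ) + aParam A m
        + (if m = 1 then (n : ℂ) else 0) else 0) + ν * sCoeff m)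
      tendsto_norm_planeCoord (by norm_num) (by norm_num) ?_ _
    intro m _ p
    by_cases hm : Odd m
    · simp only [xPlus, if_pos hm, planeCoord, map_add, map_mul, Complex.conj_ofReal,
        Complex.conj_I, Complex.conj_ofNat]
      push_cast
      ring
    · simp [xPlus, hm]
  · simp only [if_neg h]
    exact tendsto_const_nhds

lemma tendsto_scaledMinus (n : ℕ) (t : ℝ) (i ν : ℕ) :
    Tendsto (fun p => scaledMinus A n t p i ν) (cocompact (ℝ × ℝ)) (𝓝 (schurLimit i ν)) := by
  unfold scaledMinus schurLimit
  by_cases h : ν ≤ i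
  · simp only [if_pos h]
    refine Tendsto.const_mul _ ?_
    refine tendsto_schur_affine
      (b := fun m => if Odd m then (1 / 2 + 2 ^ m / 4) / (m.factorial : ℂ) else 0)
      (c := fun m => if Odd m then (1 / 2 - 2 ^ m / 4) / (m.factorial : ℂ) else 0)
      (d := fun m => (if Odd m then 3 ^ m * (t : ℂ) / (m.factorial : ℂ)
        + (starRingEnd ℂ) (aParam A m)
        - (if m = 1 then (n : ℂ) else 0) else 0) + ν * sCoeff m)
      (by simpa using tendsto_norm_planeCoord) (by norm_num) (by norm_num) ?_ _
    intro m _ p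
    by_cases hm : Odd m
    · simp only [xMinus, if_pos hm, planeCoord, map_add, map_mul, map_neg, Complex.conj_ofReal,
        Complex.conj_I, Complex.conj_ofNat]
      push_cast
      ring
    · simp [xMinus, hm]
  · simp only [if_neg h]
    exact tendsto_const_nhds

/-- The inverse square of the modulus of the coordinate. -/
def planeScale (p : ℝ × ℝ) : ℂ := (planeCoord p * (starRingEnd ℂ) (planeCoord p))⁻¹

lemma tendsto_planeScale : Tendsto planeScale (cocompact (ℝ × ℝ)) (𝓝 0) := by
  refine tendsto_inv_of_norm_atTop ?_
  have h := tendsto_norm_planeCoord.atTop_mul_atTop₀ tendsto_norm_planeCoord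
  simpa using h

lemma tau_eq_scaled (n : ℕ) (t : ℝ) {p : ℝ × ℝ} (hp : planeCoord p ≠ 0) {i j L : ℕ}
    (hL : min i j < L) :
    tau A n i j (p.1 - 3 * t) p.2 t = (-1) ^ n * (planeCoord p ^ i
      * (∑ ν ∈ Finset.range L, scaledPlus A n t p i ν * planeScale p ^ ν * scaledMinus A n t p j ν)
      * (starRingEnd ℂ) (planeCoord p) ^ j) := by
  have hp' : (starRingEnd ℂ) (planeCoord p) ≠ 0 := (map_ne_zero _).2 hp
  rw [tau]
  congr 1
  rw [Finset.mul_sum, Finset.sum_mul]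
  rw [← Finset.sum_subset (Finset.range_subset_range.2 (Nat.succ_le_of_lt hL))]
  · refine Finset.sum_congr rfl fun ν hν => ?_
    rw [Finset.mem_range, Nat.lt_succ_iff, le_min_iff] at hν
    rw [scaledPlus, scaledMinus, if_pos hν.1, if_pos hν.2, planeScale]
    obtain ⟨i', rfl⟩ := Nat.exists_eq_add_of_le hν.1
    obtain ⟨j', rfl⟩ := Nat.exists_eq_add_of_le hν.2
    rw [Nat.add_sub_cancel_left, Nat.add_sub_cancel_left]
    set z := planeCoord p
    set w := (starRingEnd ℂ) z
    have h4 : (4 : ℂ) ^ ν = 2 ^ ν * 2 ^ ν := by rw [← mul_pow]; norm_num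
    rw [h4, pow_add, pow_add, inv_pow, mul_pow, div_pow, one_pow]
    field_simp
  · intro ν _ hν
    rw [Finset.mem_range, not_lt] at hν
    rcases min_lt_iff.1 (Nat.lt_of_succ_le hν) with h | h
    · simp [scaledPlus, not_le.2 h]
    · simp [scaledMinus, not_le.2 h]

/-- The common algebraic growth of `σ_0` and `σ_1` at infinity. -/
lemma exists_tendsto_sigma (n : ℕ) (t : ℝ) :
    ∃ h : ℝ × ℝ → ℂ, Tendsto h (cocompact (ℝ × ℝ))
        (𝓝 ((Matrix.of fun i ν : Fin N => schurLimit (2 * (i : ℕ) + 1) ν).det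
          * (Matrix.of fun i ν : Fin N => schurLimit (2 * (i : ℕ) + 1) ν).det)) ∧
      ∀ᶠ p in cocompact (ℝ × ℝ), sigma A n (p.1 - 3 * t) p.2 t
        = ((-1) ^ n) ^ N * ((Matrix.diagonal fun i : Fin N => planeCoord p ^ (2 * (i : ℕ) + 1)).det
          * (Matrix.diagonal fun ν : Fin N => planeScale p ^ (ν : ℕ)).det
          * (Matrix.diagonal fun j : Fin N =>
            (starRingEnd ℂ) (planeCoord p) ^ (2 * (j : ℕ) + 1)).det) * h p := by
  set b : Matrix (Fin N) (Fin N) ℂ := Matrix.of fun i ν => schurLimit (2 * (i : ℕ) + 1) ν with hb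
  have hmat : ∀ {f : ℝ × ℝ → Matrix (Fin N) (Fin N) ℂ} {g : Matrix (Fin N) (Fin N) ℂ},
      (∀ i j, Tendsto (fun p => f p i j) (cocompact (ℝ × ℝ)) (𝓝 (g i j))) →
      Tendsto f (cocompact (ℝ × ℝ)) (𝓝 g) := fun h =>
    tendsto_pi_nhds.2 fun i => tendsto_pi_nhds.2 fun j => h i j
  obtain ⟨h, hlim, hdet⟩ := exists_tendsto_det
    (L1 := fun p => Matrix.of fun i ν : Fin N => scaledPlus A n t p (2 * (i : ℕ) + 1) ν)
    (L2 := fun p => Matrix.of fun i ν : Fin N => scaledPlus A n t p (2 * (i : ℕ) + 1) (N + ν))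
    (R1 := fun p => Matrix.of fun ν j : Fin N => scaledMinus A n t p (2 * (j : ℕ) + 1) ν)
    (R2 := fun p => Matrix.of fun ν j : Fin N => scaledMinus A n t p (2 * (j : ℕ) + 1) (N + ν))
    (b := b) (b' := b.transpose)
    (b2 := Matrix.of fun i ν : Fin N => schurLimit (2 * (i : ℕ) + 1) (N + ν))
    (b2' := Matrix.of fun ν j : Fin N => schurLimit (2 * (j : ℕ) + 1) (N + ν))
    (hmat fun i ν => tendsto_scaledPlus A n t _ _) (hmat fun i ν => tendsto_scaledPlus A n t _ _)
    (hmat fun ν j => tendsto_scaledMinus A n t _ _)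
    (hmat fun ν j => tendsto_scaledMinus A n t _ _) tendsto_planeScale (det_schurLimit_ne_zero N)
  rw [Matrix.det_transpose] at hlim
  refine ⟨h, hlim, ?_⟩
  filter_upwards [hdet, tendsto_norm_planeCoord.eventually_gt_atTop 0] with p hd hp
  have hp0 : planeCoord p ≠ 0 := norm_pos_iff.1 hp
  rw [sigma_eq_det]
  have e : tauMat A n (p.1 - 3 * t) p.2 t = ((-1 : ℂ) ^ n) •
      ((Matrix.diagonal fun i : Fin N => planeCoord p ^ (2 * (i : ℕ) + 1))
        * ((Matrix.of fun i ν : Fin N => scaledPlus A n t p (2 * (i : ℕ) + 1) ν)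
            * Matrix.diagonal (fun ν : Fin N => planeScale p ^ (ν : ℕ))
            * (Matrix.of fun ν j : Fin N => scaledMinus A n t p (2 * (j : ℕ) + 1) ν)
          + planeScale p ^ N •
            ((Matrix.of fun i ν : Fin N => scaledPlus A n t p (2 * (i : ℕ) + 1) (N + ν))
              * Matrix.diagonal (fun ν : Fin N => planeScale p ^ (ν : ℕ))
              * (Matrix.of fun ν j : Fin N => scaledMinus A n t p (2 * (j : ℕ) + 1) (N + ν))))
        * (Matrix.diagonal fun j : Fin N =>
            (starRingEnd ℂ) (planeCoord p) ^ (2 * (j : ℕ) + 1))) := by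
    ext i j
    rw [tauMat, Matrix.of_apply, tau_eq_scaled A n t hp0 (L := N + N) (by omega),
      Finset.sum_range_add, Matrix.smul_apply, Matrix.mul_diagonal, Matrix.diagonal_mul,
      Matrix.add_apply, Matrix.smul_apply, Matrix.mul_apply, Matrix.mul_apply, smul_eq_mul,
      smul_eq_mul]
    simp only [Matrix.mul_diagonal, Matrix.of_apply]
    rw [Finset.sum_range, Finset.sum_range]
    have hs : ∑ ν : Fin N, scaledPlus A n t p (2 * (i : ℕ) + 1) (N + ν)
          * planeScale p ^ (N + (ν : ℕ)) * scaledMinus A n t p (2 * (j : ℕ) + 1) (N + ν)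
        = planeScale p ^ N * ∑ ν : Fin N, scaledPlus A n t p (2 * (i : ℕ) + 1) (N + ν)
          * planeScale p ^ (ν : ℕ) * scaledMinus A n t p (2 * (j : ℕ) + 1) (N + ν) := by
      rw [Finset.mul_sum]
      refine Finset.sum_congr rfl fun ν _ => ?_
      rw [pow_add]
      ring
    rw [hs]
  rw [e, Matrix.det_smul, Matrix.det_mul, Matrix.det_mul, hd, Fintype.card_fin]
  ring

/-- The lump decays at infinity because `σ_0` and `σ_1` have the same leading behaviour, up to a
sign. -/
theorem tendsto_lumpU (t : ℝ) :
    Tendsto (fun p : ℝ × ℝ => lumpU A p.1 p.2 t) (cocompact (ℝ × ℝ)) (𝓝 0) := by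
  obtain ⟨h0, hlim0, e0⟩ := exists_tendsto_sigma A 0 t
  obtain ⟨h1, hlim1, e1⟩ := exists_tendsto_sigma A 1 t
  have hβ := det_schurLimit_ne_zero N
  have hquot := (hlim1.div hlim0 (mul_ne_zero hβ hβ)).norm.pow 2
  rw [div_self (mul_ne_zero hβ hβ), norm_one, one_pow] at hquot
  have hq := hquot.sub_const 1
  rw [sub_self] at hq
  refine hq.congr' ?_
  filter_upwards [e0, e1] with p he0 he1
  have hne := sigma_zero_ne_zero A (p.1 - 3 * t) p.2 t
  rw [he0] at hne
  rw [lumpU, he0, he1]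
  simp only [pow_zero, one_pow, one_mul, pow_one] at hne ⊢
  rw [mul_assoc, mul_div_assoc, norm_mul, norm_pow, norm_neg, norm_one, one_pow, one_mul,
    mul_div_mul_left _ _ (left_ne_zero_of_mul hne)]
  rfl

end Sigma

end KPLump

end

theorem theorem1 (N : ℕ) (hN : 1 ≤ N) (A : Fin (N - 1) → ℂ) :
    -- the denominator never vanishes and `u_N` is a lump solution of the KP equation
    (∀ x y t : ℝ, KPLump.sigma A 0 x y t ≠ 0) ∧
    KPLump.IsLumpSolution (KPLump.lumpU A) ∧
    -- the parameters are free: every `A` comes from a phase `a(λ)`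
    (∃ a : ℂ → ℂ, KPLump.IsPhase A a) ∧
    -- for each such phase, the solution comes from the `N`-th order Darboux transformation
    (∀ a : ℂ → ℂ, KPLump.IsPhase A a →
      -- the transformation is well defined, and it is a Darboux transformation
      (∀ x y t : ℝ, (KPLump.matM N a x y t).det ≠ 0) ∧
      KPLump.IsDarbouxMatrix Complex.I (KPLump.darbouxT N a) KPLump.seedQ KPLump.seedR
        (KPLump.darbouxQ N a) (fun x y t => (starRingEnd ℂ) (KPLump.darbouxQ N a x y t)) ∧
      -- the new potentials solve the AKNS flows and are given by the determinants
      KPLump.IsAKNSSolution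
        (KPLump.darbouxQ N a) (fun x y t => (starRingEnd ℂ) (KPLump.darbouxQ N a x y t)) ∧
      (∀ x y t : ℝ, KPLump.darbouxQ N a x y t
        = Complex.exp (2 * Complex.I * y) * (KPLump.sigma A 1 x y t / KPLump.sigma A 0 x y t)) ∧
      -- one-constraint: `u = q r` solves the KP equation, and `u_N` is obtained from it by
      -- removing the background `1`
      ∃ u : ℝ → ℝ → ℝ → ℝ,
        (∀ x y t : ℝ, (u x y t : ℂ)
          = KPLump.darbouxQ N a x y t * (starRingEnd ℂ) (KPLump.darbouxQ N a x y t)) ∧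
        KPLump.IsKPSolution u ∧
        ∀ x y t : ℝ, KPLump.lumpU A x y t = u (x - 3 * t) y t - 1) := by
  have hmain : ∀ a : ℂ → ℂ, KPLump.IsPhase A a →
      KPLump.IsAKNSSolution (KPLump.darbouxQ N a)
        (fun x y t => (starRingEnd ℂ) (KPLump.darbouxQ N a x y t)) ∧
      KPLump.IsKPSolution (fun x y t => ‖KPLump.darbouxQ N a x y t‖ ^ 2) ∧
      ∀ x y t : ℝ, KPLump.lumpU A x y t = ‖KPLump.darbouxQ N a (x - 3 * t) y t‖ ^ 2 - 1 := by
    intro a ha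
    have h := (KPLump.isDressing ha).isAKNSSolution
    rw [KPLump.newQ_eq_darbouxQ ha, KPLump.newR_eq_conj_darbouxQ ha] at h
    refine ⟨h, h.isKPSolution fun x y t => ?_, fun x y t => ?_⟩
    · rw [Complex.mul_conj, Complex.normSq_eq_norm_sq]
    · have he : ‖Complex.exp (2 * Complex.I * y)‖ = 1 := by
        rw [Complex.norm_exp]
        simp
      rw [KPLump.lumpU, KPLump.darbouxQ_eq ha, norm_mul, he, one_mul]
  refine ⟨KPLump.sigma_zero_ne_zero A, ?_, KPLump.exists_isPhase A, fun a ha => ?_⟩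
  · obtain ⟨a, ha⟩ := KPLump.exists_isPhase A
    obtain ⟨_, hkp, hu⟩ := hmain a ha
    have e : KPLump.lumpU A
        = fun x y t => ‖KPLump.darbouxQ N a (x - 3 * t) y t‖ ^ 2 - 1 :=
      funext fun x => funext fun y => funext fun t => hu x y t
    refine ⟨?_, KPLump.tendsto_lumpU A⟩
    rw [e]
    exact hkp.galilean
  · obtain ⟨hakns, hkp, hu⟩ := hmain a ha
    have hT := (KPLump.isDressing ha).isDarbouxMatrix
    rw [KPLump.newQ_eq_darbouxQ ha, KPLump.newR_eq_conj_darbouxQ ha] at hT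
    refine ⟨KPLump.det_matM_ne_zero N a, hT, hakns, KPLump.darbouxQ_eq ha, _, ?_, hkp, hu⟩
    intro x y t
    rw [Complex.mul_conj, Complex.normSq_eq_norm_sq]
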